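/- Let $\kappa$ be a regular (infinite) cardinal. A $\kappa$-coherent category is a category with all finite limits, pullback-stable image factorisations and pullback-stable unions of $\kappa$-small families of subobjects (a family is $\kappa$-small if it has fewer than $\kappa$ members); a $\kappa$-coherent functor is a functor that preserves finite limits, images and $\kappa$-small unions; and $Coh(A,C)$ is the category of $\kappa$-coherent functors $A\to C$ and all natural transformations. A $\kappa$-coherent theory over a many-sorted signature is a set of sequents $\varphi\vdash_{\vec x}\psi$ between formulae built from atomic formulae by finite conjunctions, $\kappa$-small disjunctions and existential quantification. The syntactic category $Syn(T)$ of such a theory $T$ has as objects the formulae in context $\varphi(\vec x)$ up to renaming of variables, and as morphisms $\varphi(\vec x)\to\psi(\vec y)$ the $T$-provable equivalence classes of $T$-provably functional formulae $\theta(\vec x,\vec y)$. For a $\kappa$-coherent category $C$, $T\text{-}Mod(C)$ is the category of models of $T$ in $C$ and their homomorphisms. Let $D$ be a small category and let $Sch(D)$ be the $\kappa$-coherent theory whose signature has one sort for each object of $D$, one unary operation $f:X\to Y$ for each morphism $f:X\to Y$ of $D$, and no predicates, and whose axioms are the sequents $\top\vdash_{x:X} g(f(x))=(gf)(x)$ for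 all composable $f:X\to Y$, $g:Y\to Z$ in $D$, and $\top\vdash_{x:X}\mathrm{id}_X(x)=x$ for all objects $X$ of $D$. Theorem. $Syn(Sch(D))$ is a $\kappa$-coherent category, and for every $\kappa$-coherent category $C$: 1. the functor category $Cat(D,C)$ is equivalent to $Coh(Syn(Sch(D)),C)$; 2. the functors $D\to C$ are exactly the models of $Sch(D)$ in $C$: there is an isomorphism of categories $Cat(D,C)\cong Sch(D)\text{-}Mod(C)$ that sends a functor $F$ to the structure that interprets each sort $X$ as $F(X)$ and each operation $f$ as $F(f)$. -/

import Mathlib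

open CategoryTheory CategoryTheory.Limits

universe u v₁ u₁ v₂ u₂

namespace KappaCoherent

/-! ## Signatures, terms, formulae, sequents, theories -/

/-- A many-sorted signature with finitary predicate and operation symbols.  The list `predDom p`
(resp. `opDom f`) is the list of sorts of the arguments of `p` (resp. `f`). -/
structure Signature where
  /-- sorts -/
  Srt : Type u
  /-- predicate symbols -/
  Pred : Type u
  /-- operation symbols -/
  Op : Type u
  predDom : Pred → List Srt
  opDom : Op → List Srt
  opCod : Op → Srt

/-- `Var Γ s` is the set of positions in the list of sorts `Γ` at which the sort `s` stands, that
is, the variables of sort `s` among the finite sequence of variables `x₁ : s₁, …, xₙ : sₙ`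
described by `Γ = [s₁, …, sₙ]`. -/
inductive Var {S : Type u} : List S → S → Type u
  | head {s : S} {Γ : List S} : Var (s :: Γ) s
  | tail {s t : S} {Γ : List S} (v : Var Γ s) : Var (t :: Γ) s

/-- Terms of a given sort whose free variables are among `Γ`. -/
inductive Term (L : Signature.{u}) (Γ : List L.Srt) : L.Srt → Type u
  | var {s : L.Srt} (v : Var Γ s) : Term L Γ s
  | app (f : L.Op) (ts : ∀ s, Var (L.opDom f) s → Term L Γ s) : Term L Γ (L.opCod f)

/-- `κ`-coherent formulae whose free variables are among `Γ`: atomic formulae, finite conjunctions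
(`⊤` and binary `∧`), disjunctions of `κ`-small families (`⊥` is the empty one), and existential
quantification.
Families are indexed by subsets `I` of cardinality `< κ` of a fixed set of cardinality `κ`; up to
reindexing these are all `κ`-small families, and the formulae form a set. Bound and free
variables are positions, so formulae that differ by a renaming of variables are equal. -/
inductive Formula (κ : Cardinal.{u}) (L : Signature.{u}) : List L.Srt → Type u
  | rel {Γ : List L.Srt} (p : L.Pred) (ts : ∀ s, Var (L.predDom p) s → Term L Γ s) :
      Formula κ L Γ
  | eq {Γ : List L.Srt} {s : L.Srt} (t t' : Term L Γ s) : Formula κ L Γ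
  | top {Γ : List L.Srt} : Formula κ L Γ
  | and {Γ : List L.Srt} (φ ψ : Formula κ L Γ) : Formula κ L Γ
  | disj {Γ : List L.Srt} (I : Set κ.out) (hI : Cardinal.mk I < κ) (φ : I → Formula κ L Γ) :
      Formula κ L Γ
  | ex {Γ : List L.Srt} (s : L.Srt) (φ : Formula κ L (s :: Γ)) : Formula κ L Γ

/-- A sequent `φ ⊢ ψ` in the variables `ctx`.  (A finite set of formulae on the left, resp. right,
is represented by its conjunction, resp. disjunction.) -/
structure Sequent (κ : Cardinal.{u}) (L : Signature.{u}) where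
  ctx : List L.Srt
  lhs : Formula κ L ctx
  rhs : Formula κ L ctx

/-- A `κ`-coherent theory over `L` is a set of `κ`-coherent sequents. -/
abbrev Theory (κ : Cardinal.{u}) (L : Signature.{u}) := Set (Sequent κ L)

/-! ## Substitution -/

variable {κ : Cardinal.{u}} {L : Signature.{u}}

/-- A simultaneous substitution of terms in the variables `Δ` for the variables `Γ`. -/
abbrev Subst (L : Signature.{u}) (Γ Δ : List L.Srt) := ∀ s, Var Γ s → Term L Δ s

def Term.subst {Γ Δ : List L.Srt} (σ : Subst L Γ Δ) : {s : L.Srt} → Term L Γ s → Term L Δ s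
  | _, .var v => σ _ v
  | _, .app f ts => .app f fun s v => (ts s v).subst σ

namespace Subst

def id (Γ : List L.Srt) : Subst L Γ Γ := fun _ v => .var v

def comp {Γ Δ Θ : List L.Srt} (σ : Subst L Γ Δ) (τ : Subst L Δ Θ) : Subst L Γ Θ :=
  fun s v => (σ s v).subst τ

/-- The weakening `Γ ⊆ (s, Γ)`. -/
def wk (s : L.Srt) (Γ : List L.Srt) : Subst L Γ (s :: Γ) := fun _ v => .var v.tail

/-- Substitute `t` for the first variable and `σ` for the others. -/
def cons {Γ Δ : List L.Srt} {s : L.Srt} (t : Term L Δ s) (σ : Subst L Γ Δ) : Subst L (s :: Γ) Δ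
  | _, .head => t
  | _, .tail v => σ _ v

/-- Substitution under a binder. -/
def lift {Γ Δ : List L.Srt} (s : L.Srt) (σ : Subst L Γ Δ) : Subst L (s :: Γ) (s :: Δ) :=
  cons (.var .head) (σ.comp (wk s Δ))

/-- The first block of variables of `Γ ++ Δ`. -/
def inl : (Γ Δ : List L.Srt) → Subst L Γ (Γ ++ Δ)
  | _ :: Γ, Δ => cons (.var .head) ((inl Γ Δ).comp (wk _ _))
  | [], _ => nofun

/-- The second block of variables of `Γ ++ Δ`. -/
def inr : (Γ Δ : List L.Srt) → Subst L Δ (Γ ++ Δ)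
  | [], Δ => id Δ
  | _ :: Γ, Δ => (inr Γ Δ).comp (wk _ _)

/-- Substitute `σ` for the first block and `τ` for the second block of variables. -/
def append {Ξ : List L.Srt} : {Γ Δ : List L.Srt} →
    (σ : Subst L Γ Ξ) → (τ : Subst L Δ Ξ) → Subst L (Γ ++ Δ) Ξ
  | [], _, _, τ => τ
  | _ :: _, _, σ, τ => cons (σ _ .head) (append (fun s v => σ s v.tail) τ)

end Subst

def Formula.subst : {Γ Δ : List L.Srt} → Subst L Γ Δ → Formula κ L Γ → Formula κ L Δ
  | _, _, σ, .rel p ts => .rel p fun s v => (ts s v).subst σ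
  | _, _, σ, .eq t t' => .eq (t.subst σ) (t'.subst σ)
  | _, _, _, .top => .top
  | _, _, σ, .and φ ψ => .and (φ.subst σ) (ψ.subst σ)
  | _, _, σ, .disj I hI φ => .disj I hI fun i => (φ i).subst σ
  | _, _, σ, .ex s φ => .ex s (φ.subst (σ.lift s))

/-- The block quantifier `∃ y₁ … yₙ`, where the variables `yᵢ` are the block `Δ`. -/
def Formula.exs {Γ : List L.Srt} : (Δ : List L.Srt) → Formula κ L (Δ ++ Γ) → Formula κ L Γ
  | [], φ => φ
  | s :: Δ, φ => Formula.exs Δ (.ex s φ)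

/-- The formula `σ = τ`, the finite conjunction of the equations `σᵢ = τᵢ`. -/
def Formula.eqs {Γ : List L.Srt} : {Δ : List L.Srt} → (σ τ : Subst L Δ Γ) → Formula κ L Γ
  | [], _, _ => .top
  | _ :: _, σ, τ => .and (.eq (σ _ .head) (τ _ .head))
      (Formula.eqs (fun s v => σ s v.tail) (fun s v => τ s v.tail))

/-! ## Provability -/

/-- `Provable T φ ψ`: the sequent `φ ⊢ ψ`, in the variables `Γ`, is derivable from the theory `T`
in `κ`-coherent logic. -/
inductive Provable (T : Theory κ L) :
    {Γ : List L.Srt} → Formula κ L Γ → Formula κ L Γ → Prop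
  | ax (S : Sequent κ L) (hS : S ∈ T) : Provable T S.lhs S.rhs
  | refl {Γ : List L.Srt} (φ : Formula κ L Γ) : Provable T φ φ
  | cut {Γ : List L.Srt} {φ ψ χ : Formula κ L Γ} :
      Provable T φ ψ → Provable T ψ χ → Provable T φ χ
  | subst {Γ Δ : List L.Srt} (σ : Subst L Γ Δ) {φ ψ : Formula κ L Γ} :
      Provable T φ ψ → Provable T (φ.subst σ) (ψ.subst σ)
  | eq_refl {Γ : List L.Srt} {s : L.Srt} (t : Term L Γ s) : Provable T .top (.eq t t)
  | eq_subst {Γ : List L.Srt} {s : L.Srt} (t t' : Term L Γ s) (φ : Formula κ L (s :: Γ)) :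
      Provable T (.and (.eq t t') (φ.subst (.cons t (.id Γ)))) (φ.subst (.cons t' (.id Γ)))
  | top_intro {Γ : List L.Srt} (φ : Formula κ L Γ) : Provable T φ .top
  | and_left {Γ : List L.Srt} (φ ψ : Formula κ L Γ) : Provable T (.and φ ψ) φ
  | and_right {Γ : List L.Srt} (φ ψ : Formula κ L Γ) : Provable T (.and φ ψ) ψ
  | and_intro {Γ : List L.Srt} {χ φ ψ : Formula κ L Γ} :
      Provable T χ φ → Provable T χ ψ → Provable T χ (.and φ ψ)
  | disj_intro {Γ : List L.Srt} (I : Set κ.out) (hI : Cardinal.mk I < κ) (φ : I → Formula κ L Γ)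
      (i : I) : Provable T (φ i) (.disj I hI φ)
  | disj_elim {Γ : List L.Srt} (I : Set κ.out) (hI : Cardinal.mk I < κ) (φ : I → Formula κ L Γ)
      (ψ : Formula κ L Γ) : (∀ i, Provable T (φ i) ψ) → Provable T (.disj I hI φ) ψ
  | distrib {Γ : List L.Srt} (I : Set κ.out) (hI : Cardinal.mk I < κ) (φ : Formula κ L Γ)
      (ψ : I → Formula κ L Γ) :
      Provable T (.and φ (.disj I hI ψ)) (.disj I hI fun i => .and φ (ψ i))
  | ex_intro {Γ : List L.Srt} {s : L.Srt} (φ : Formula κ L (s :: Γ)) (t : Term L Γ s) :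
      Provable T (φ.subst (.cons t (.id Γ))) (.ex s φ)
  | ex_elim {Γ : List L.Srt} {s : L.Srt} {φ : Formula κ L (s :: Γ)} {ψ : Formula κ L Γ} :
      Provable T φ (ψ.subst (.wk s Γ)) → Provable T (.ex s φ) ψ
  | frobenius {Γ : List L.Srt} {s : L.Srt} (φ : Formula κ L Γ) (ψ : Formula κ L (s :: Γ)) :
      Provable T (.and φ (.ex s ψ)) (.ex s (.and (φ.subst (.wk s Γ)) ψ))

/-! ## Substitution lemmas -/

theorem Term.subst_id {Γ : List L.Srt} {s : L.Srt} (t : Term L Γ s) :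
    t.subst (Subst.id Γ) = t := by
  induction t with
  | var v => rfl
  | app f ts ih => simp only [Term.subst, ih]

theorem Term.subst_subst {Γ Δ Θ : List L.Srt} (σ : Subst L Γ Δ) (τ : Subst L Δ Θ) {s : L.Srt}
    (t : Term L Γ s) : (t.subst σ).subst τ = t.subst (σ.comp τ) := by
  induction t with
  | var v => rfl
  | app f ts ih => simp only [Term.subst, ih]

namespace Subst

theorem comp_id {Γ Δ : List L.Srt} (σ : Subst L Γ Δ) : σ.comp (id Δ) = σ := by
  funext s v; exact Term.subst_id _

theorem id_comp {Γ Δ : List L.Srt} (σ : Subst L Γ Δ) : (id Γ).comp σ = σ := rfl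

theorem comp_assoc {Γ Δ Θ Ξ : List L.Srt} (σ : Subst L Γ Δ) (τ : Subst L Δ Θ)
    (ρ : Subst L Θ Ξ) : (σ.comp τ).comp ρ = σ.comp (τ.comp ρ) := by
  funext s v; exact Term.subst_subst _ _ _

theorem cons_comp {Γ Δ Θ : List L.Srt} {s : L.Srt} (t : Term L Δ s) (σ : Subst L Γ Δ)
    (τ : Subst L Δ Θ) : (cons t σ).comp τ = cons (t.subst τ) (σ.comp τ) := by
  funext r v; cases v <;> rfl

theorem wk_cons {Γ Δ : List L.Srt} {s : L.Srt} (t : Term L Δ s) (σ : Subst L Γ Δ) :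
    (wk s Γ).comp (cons t σ) = σ := rfl

theorem cons_eta {Γ Δ : List L.Srt} {s : L.Srt} (σ : Subst L (s :: Γ) Δ) :
    cons (σ _ .head) (fun r v => σ r v.tail) = σ := by
  funext r v; cases v <;> rfl

theorem lift_comp_cons {Γ Δ Θ : List L.Srt} {s : L.Srt} (σ : Subst L Γ Δ) (t : Term L Θ s)
    (τ : Subst L Δ Θ) : (σ.lift s).comp (cons t τ) = cons t (σ.comp τ) := by
  rw [lift, cons_comp, comp_assoc, wk_cons]; rfl

theorem lift_comp {Γ Δ Θ : List L.Srt} (s : L.Srt) (σ : Subst L Γ Δ) (τ : Subst L Δ Θ) :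
    (σ.lift s).comp (τ.lift s) = (σ.comp τ).lift s := by
  rw [lift, lift, cons_comp, comp_assoc, wk_cons, ← comp_assoc]; rfl

theorem lift_id (s : L.Srt) (Γ : List L.Srt) : (id Γ).lift s = id (s :: Γ) := by
  funext r v; cases v <;> rfl

theorem inl_append {Γ Δ Ξ : List L.Srt} (σ : Subst L Γ Ξ) (τ : Subst L Δ Ξ) :
    (inl Γ Δ).comp (append σ τ) = σ := by
  induction Γ with
  | nil => funext s v; cases v
  | cons s Γ ih => rw [inl, cons_comp, comp_assoc, append, wk_cons, ih]; exact cons_eta σ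

theorem inr_append {Γ Δ Ξ : List L.Srt} (σ : Subst L Γ Ξ) (τ : Subst L Δ Ξ) :
    (inr Γ Δ).comp (append σ τ) = τ := by
  induction Γ with
  | nil => rfl
  | cons s Γ ih => rw [inr, comp_assoc, append, wk_cons, ih]

theorem append_comp {Γ Δ Ξ Θ : List L.Srt} (σ : Subst L Γ Ξ) (τ : Subst L Δ Ξ)
    (ρ : Subst L Ξ Θ) : (append σ τ).comp ρ = append (σ.comp ρ) (τ.comp ρ) := by
  induction Γ with
  | nil => rfl
  | cons s Γ ih => rw [append, cons_comp, ih]; rfl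

theorem append_inl_inr (Γ Δ : List L.Srt) : append (inl Γ Δ) (inr Γ Δ) = id (Γ ++ Δ) := by
  induction Γ with
  | nil => rfl
  | cons s Γ ih =>
    change cons (.var .head) (append ((inl Γ Δ).comp (wk s _)) ((inr Γ Δ).comp (wk s _))) = _
    rw [← append_comp, ih]; exact lift_id s _

end Subst

theorem Formula.subst_id {Γ : List L.Srt} (φ : Formula κ L Γ) : φ.subst (Subst.id Γ) = φ := by
  induction φ with
  | rel p ts => simp only [Formula.subst, Term.subst_id]
  | eq t t' => simp only [Formula.subst, Term.subst_id]
  | top => rfl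
  | and φ ψ ih ih' => simp only [Formula.subst, ih, ih']
  | disj I hI φ ih => simp only [Formula.subst, ih]
  | ex s φ ih => simp only [Formula.subst, Subst.lift_id, ih]

theorem Formula.subst_subst {Γ Δ Θ : List L.Srt} (φ : Formula κ L Γ) (σ : Subst L Γ Δ)
    (τ : Subst L Δ Θ) : (φ.subst σ).subst τ = φ.subst (σ.comp τ) := by
  induction φ generalizing Δ Θ with
  | rel p ts => simp only [Formula.subst, Term.subst_subst]
  | eq t t' => simp only [Formula.subst, Term.subst_subst]
  | top => rfl
  | and φ ψ ih ih' => simp only [Formula.subst, ih, ih']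
  | disj I hI φ ih => simp only [Formula.subst, ih]
  | ex s φ ih => simp only [Formula.subst, ih, Subst.lift_comp]

theorem Formula.exs_subst {Γ Γ' : List L.Srt} (Δ : List L.Srt) (φ : Formula κ L (Δ ++ Γ))
    (σ : Subst L Γ Γ') : (Formula.exs Δ φ).subst σ =
      Formula.exs Δ (φ.subst (.append (.inl Δ Γ') (σ.comp (.inr Δ Γ')))) := by
  induction Δ with
  | nil =>
    change φ.subst σ = φ.subst (σ.comp (Subst.id Γ'))
    rw [Subst.comp_id]
  | cons s Δ ih =>
    change (Formula.exs Δ (.ex s φ)).subst σ = Formula.exs Δ (.ex s _)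
    rw [ih, Formula.subst, Subst.lift, Subst.append_comp, Subst.comp_assoc]
    rfl

theorem Formula.eqs_subst {Γ Γ' Δ : List L.Srt} (σ τ : Subst L Δ Γ) (ρ : Subst L Γ Γ') :
    (Formula.eqs σ τ).subst ρ = Formula.eqs (κ := κ) (σ.comp ρ) (τ.comp ρ) := by
  induction Δ with
  | nil => rfl
  | cons s Δ ih => rw [Formula.eqs, Formula.subst, ih]; rfl

/-! ## Derived rules -/

namespace Provable

variable {T : Theory κ L} {Γ : List L.Srt}

theorem ex_elim_exs {Δ : List L.Srt} {χ ψ : Formula κ L Γ} {φ : Formula κ L (Δ ++ Γ)}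
    (h : Provable T χ (.exs Δ φ))
    (h' : Provable T (.and (χ.subst (.inr Δ Γ)) φ) (ψ.subst (.inr Δ Γ))) : Provable T χ ψ := by
  refine .cut (.and_intro (.refl χ) h) ?_
  clear h
  induction Δ with
  | nil =>
    change Provable T (.and (χ.subst (Subst.id Γ)) φ) (ψ.subst (Subst.id Γ)) at h'
    rw [Formula.subst_id, Formula.subst_id] at h'
    exact h'
  | cons s Δ ih =>
    refine ih (φ := .ex s φ) (.cut (.frobenius _ _) (.ex_elim ?_))
    rw [Formula.subst_subst, Formula.subst_subst]
    exact h'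

theorem exs_intro {Δ : List L.Srt} (χ : Formula κ L Γ) (φ : Formula κ L (Δ ++ Γ))
    (τ : Subst L Δ Γ) (h : Provable T χ (φ.subst (.append τ (.id Γ)))) :
    Provable T χ (.exs Δ φ) := by
  induction Δ with
  | nil =>
    change Provable T χ (φ.subst (Subst.id Γ)) at h
    rw [Formula.subst_id] at h; exact h
  | cons s Δ ih =>
    refine ih (.ex s φ) (fun r v => τ r v.tail) (.cut ?_ (.ex_intro _ (τ s .head)))
    rw [Formula.subst_subst, Subst.lift_comp_cons, Subst.comp_id]
    exact h

theorem eq_mem {s : L.Srt} {χ : Formula κ L Γ} {t t' : Term L Γ s} (φ : Formula κ L (s :: Γ))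
    (h : Provable T χ (.eq t t')) (h' : Provable T χ (φ.subst (.cons t (.id Γ)))) :
    Provable T χ (φ.subst (.cons t' (.id Γ))) :=
  .cut (.and_intro h h') (.eq_subst t t' φ)

theorem eq_symm {s : L.Srt} {χ : Formula κ L Γ} {t t' : Term L Γ s}
    (h : Provable T χ (.eq t t')) : Provable T χ (.eq t' t) := by
  have e (r : Term L Γ s) : (Formula.eq (.var .head) (t.subst (.wk s Γ))).subst
      (κ := κ) (.cons r (.id Γ)) = .eq r t := by
    simp only [Formula.subst, Term.subst_subst, Subst.wk_cons, Term.subst_id]; rfl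
  have := eq_mem (.eq (.var .head) (t.subst (.wk s Γ))) h
    (by rw [e]; exact .cut (.top_intro _) (.eq_refl t))
  rwa [e] at this

theorem eq_trans {s : L.Srt} {χ : Formula κ L Γ} {t t' t'' : Term L Γ s}
    (h : Provable T χ (.eq t t')) (h' : Provable T χ (.eq t' t'')) :
    Provable T χ (.eq t t'') := by
  have e (r : Term L Γ s) : (Formula.eq (t.subst (.wk s Γ)) (.var .head)).subst
      (κ := κ) (.cons r (.id Γ)) = .eq t r := by
    simp only [Formula.subst, Term.subst_subst, Subst.wk_cons, Term.subst_id]; rfl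
  have := eq_mem (.eq (t.subst (.wk s Γ)) (.var .head)) h' (by rw [e]; exact h)
  rwa [e] at this

/-- Replacement of a block of terms by equal terms. -/
theorem eqs_mem {Δ Θ : List L.Srt} {χ : Formula κ L Γ} {τ τ' : Subst L Δ Γ} {σ : Subst L Θ Γ}
    (φ : Formula κ L (Δ ++ Θ)) (h : ∀ s v, Provable T χ (.eq (τ s v) (τ' s v)))
    (h' : Provable T χ (φ.subst (.append τ σ))) : Provable T χ (φ.subst (.append τ' σ)) := by
  induction Δ generalizing Θ with
  | nil => exact h'
  | cons s Δ ih =>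
    have e (t : Term L Γ s) (ρ : Subst L Δ Γ) :
        (φ.subst (.lift s (.append ρ σ))).subst (.cons t (.id Γ)) =
          φ.subst (.cons t (.append ρ σ)) := by
      rw [Formula.subst_subst, Subst.lift_comp_cons, Subst.comp_id]
    have h1 := eq_mem (φ.subst (.lift s (.append (fun r v => τ r v.tail) σ))) (h s .head)
      (by rw [e]; exact h')
    rw [e] at h1
    have e' (ρ : Subst L Δ Γ) :
        (φ.subst (.cons ((τ' s .head).subst (.inr Δ Γ))
          (.append (.inl Δ Γ) (σ.comp (.inr Δ Γ))))).subst (.append ρ (.id Γ)) =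
          φ.subst (.cons (τ' s .head) (.append ρ σ)) := by
      rw [Formula.subst_subst, Subst.cons_comp, Subst.append_comp, Subst.comp_assoc,
        Subst.inl_append, Subst.inr_append, Subst.comp_id, Term.subst_subst, Subst.inr_append,
        Term.subst_id]
    have h2 := ih (τ := fun r v => τ r v.tail) (τ' := fun r v => τ' r v.tail) (σ := .id Γ)
      (φ.subst (.cons ((τ' s .head).subst (.inr Δ Γ))
        (.append (.inl Δ Γ) (σ.comp (.inr Δ Γ))))) (fun r v => h r v.tail) (by rw [e']; exact h1)
    rw [e'] at h2
    exact h2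

theorem eqs_intro {Δ : List L.Srt} {χ : Formula κ L Γ} {σ τ : Subst L Δ Γ}
    (h : ∀ s v, Provable T χ (.eq (σ s v) (τ s v))) : Provable T χ (.eqs σ τ) := by
  induction Δ with
  | nil => exact .top_intro _
  | cons s Δ ih => exact .and_intro (h _ _) (ih fun r v => h r v.tail)

theorem eqs_elim {Δ : List L.Srt} {χ : Formula κ L Γ} {σ τ : Subst L Δ Γ}
    (h : Provable T χ (.eqs σ τ)) : ∀ s v, Provable T χ (.eq (σ s v) (τ s v)) := by
  induction Δ with
  | nil => intro s v; cases v
  | cons s Δ ih =>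
    intro r v
    cases v with
    | head => exact h.cut (.and_left _ _)
    | tail v => exact ih (h.cut (.and_right _ _)) r v

theorem subst_of {Δ : List L.Srt} {χ : Formula κ L Δ} {φ ψ : Formula κ L Γ} (σ : Subst L Γ Δ)
    (h : Provable T χ (φ.subst σ)) (h' : Provable T φ ψ) : Provable T χ (ψ.subst σ) :=
  h.cut (h'.subst σ)

end Provable

/-! ## Provably functional formulae -/

/-- The formula `θ(x⃗, y⃗)`, with `y⃗` the block `Δ` and `x⃗` the block `Γ` of its variables, is
`T`-provably functional from `φ(x⃗)` to `ψ(y⃗)`. -/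
structure IsFunctional (T : Theory κ L) {Γ Δ : List L.Srt} (φ : Formula κ L Γ)
    (ψ : Formula κ L Δ) (θ : Formula κ L (Δ ++ Γ)) : Prop where
  /-- `θ(x⃗, y⃗) ⊢ φ(x⃗) ∧ ψ(y⃗)` -/
  dom_cod : Provable T θ (.and (φ.subst (.inr Δ Γ)) (ψ.subst (.inl Δ Γ)))
  /-- `φ(x⃗) ⊢ ∃ y⃗, θ(x⃗, y⃗)` -/
  total : Provable T φ (.exs Δ θ)
  /-- `θ(x⃗, y⃗) ∧ θ(x⃗, y⃗') ⊢ y⃗ = y⃗'`, in the variables `y⃗, y⃗', x⃗` -/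
  unique : Provable T
    (.and
      (θ.subst (.append (.inl Δ (Δ ++ Γ)) ((Subst.inr Δ Γ).comp (.inr Δ (Δ ++ Γ)))))
      (θ.subst (.append ((Subst.inl Δ Γ).comp (.inr Δ (Δ ++ Γ)))
        ((Subst.inr Δ Γ).comp (.inr Δ (Δ ++ Γ))))))
    (.eqs (.inl Δ (Δ ++ Γ)) ((Subst.inl Δ Γ).comp (.inr Δ (Δ ++ Γ))))

namespace Formula

/-- The identity of `φ(x⃗)`: the formula `φ(x⃗) ∧ y⃗ = x⃗`. -/
def idRel {Γ : List L.Srt} (φ : Formula κ L Γ) : Formula κ L (Γ ++ Γ) :=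
  .and (φ.subst (.inr Γ Γ)) (.eqs (.inl Γ Γ) (.inr Γ Γ))

/-- The composite of `θ(x⃗, y⃗)` and `θ'(y⃗, z⃗)`: the formula `∃ y⃗, θ(x⃗, y⃗) ∧ θ'(y⃗, z⃗)`. -/
def compRel {Γ Δ Λ : List L.Srt} (θ : Formula κ L (Δ ++ Γ)) (θ' : Formula κ L (Λ ++ Δ)) :
    Formula κ L (Λ ++ Γ) :=
  .exs Δ (.and
    (θ.subst (.append (.inl Δ (Λ ++ Γ)) ((Subst.inr Λ Γ).comp (.inr Δ (Λ ++ Γ)))))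
    (θ'.subst (.append ((Subst.inl Λ Γ).comp (.inr Δ (Λ ++ Γ))) (.inl Δ (Λ ++ Γ)))))

theorem self_eq {Γ Δ : List L.Srt} (θ : Formula κ L (Δ ++ Γ)) :
    θ.subst (.append (.inl Δ Γ) (.inr Δ Γ)) = θ := by
  rw [Subst.append_inl_inr, subst_id]

end Formula

section Functional

variable {T : Theory κ L} {Γ Δ Λ Ξ : List L.Srt}

theorem Provable.inst_weaken {χ : Formula κ L Ξ} {ω : Formula κ L (Δ ++ Ξ)}
    {θ : Formula κ L Γ} {σ : Subst L Γ Ξ} (h : Provable T χ (θ.subst σ)) :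
    Provable T (.and (χ.subst (.inr Δ Ξ)) ω) (θ.subst (σ.comp (.inr Δ Ξ))) := by
  rw [← Formula.subst_subst]
  exact .cut (.and_left _ _) (h.subst _)

namespace IsFunctional

variable {φ : Formula κ L Γ} {ψ : Formula κ L Δ} {θ : Formula κ L (Δ ++ Γ)}

theorem dom (H : IsFunctional T φ ψ θ) {χ : Formula κ L Ξ} {x : Subst L Γ Ξ} {y : Subst L Δ Ξ}
    (h : Provable T χ (θ.subst (.append y x))) : Provable T χ (φ.subst x) := by
  have := Provable.subst_of _ h (H.dom_cod.cut (.and_left _ _))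
  rwa [Formula.subst_subst, Subst.inr_append] at this

theorem cod (H : IsFunctional T φ ψ θ) {χ : Formula κ L Ξ} {x : Subst L Γ Ξ} {y : Subst L Δ Ξ}
    (h : Provable T χ (θ.subst (.append y x))) : Provable T χ (ψ.subst y) := by
  have := Provable.subst_of _ h (H.dom_cod.cut (.and_right _ _))
  rwa [Formula.subst_subst, Subst.inl_append] at this

theorem elim (H : IsFunctional T φ ψ θ) {χ ω : Formula κ L Ξ} {x : Subst L Γ Ξ}
    (h : Provable T χ (φ.subst x))
    (h' : Provable T (.and (χ.subst (.inr Δ Ξ))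
      (θ.subst (.append (.inl Δ Ξ) (x.comp (.inr Δ Ξ))))) (ω.subst (.inr Δ Ξ))) :
    Provable T χ ω := by
  have := Provable.subst_of _ h H.total
  rw [Formula.exs_subst] at this
  exact .ex_elim_exs this h'

theorem uniq (H : IsFunctional T φ ψ θ) {χ : Formula κ L Ξ} {x : Subst L Γ Ξ}
    {y y' : Subst L Δ Ξ} (h : Provable T χ (θ.subst (.append y x)))
    (h' : Provable T χ (θ.subst (.append y' x))) (s : L.Srt) (v : Var Δ s) :
    Provable T χ (.eq (y s v) (y' s v)) := by
  have := (Provable.eqs_elim H.unique s v).subst (.append y (.append y' x))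
  simp only [Formula.subst, Formula.subst_subst, Subst.append_comp, Subst.comp_assoc,
    Subst.inl_append, Subst.inr_append] at this
  have e1 : ((Subst.inl Δ (Δ ++ Γ)) s v).subst (.append y (.append y' x)) = y s v :=
    congrFun (congrFun (Subst.inl_append y (.append y' x)) s) v
  have e2 : ((Subst.inl Δ Γ).comp (.inr Δ (Δ ++ Γ)) s v).subst (.append y (.append y' x)) =
      y' s v := by
    change ((Subst.inl Δ Γ).comp (.inr Δ (Δ ++ Γ))).comp (.append y (.append y' x)) s v = _
    rw [Subst.comp_assoc, Subst.inr_append, Subst.inl_append]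
  rw [e1, e2] at this
  exact .cut (.and_intro h h') this

end IsFunctional

theorem compRel_intro {θ : Formula κ L (Δ ++ Γ)} {θ' : Formula κ L (Λ ++ Δ)}
    {χ : Formula κ L Ξ} {x : Subst L Γ Ξ} (y : Subst L Δ Ξ) {z : Subst L Λ Ξ}
    (h : Provable T χ (θ.subst (.append y x))) (h' : Provable T χ (θ'.subst (.append z y))) :
    Provable T χ ((θ.compRel θ').subst (.append z x)) := by
  rw [Formula.compRel, Formula.exs_subst]
  refine .exs_intro _ _ y ?_
  simp only [Formula.subst, Formula.subst_subst, Subst.append_comp, Subst.comp_assoc,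
    Subst.inl_append, Subst.inr_append, Subst.comp_id]
  exact .and_intro h h'

theorem compRel_elim {θ : Formula κ L (Δ ++ Γ)} {θ' : Formula κ L (Λ ++ Δ)}
    {χ ω : Formula κ L Ξ} {x : Subst L Γ Ξ} {z : Subst L Λ Ξ}
    (h : Provable T χ ((θ.compRel θ').subst (.append z x)))
    (h' : ∀ χ' : Formula κ L (Δ ++ Ξ), Provable T χ' (χ.subst (.inr Δ Ξ)) →
      Provable T χ' (θ.subst (.append (.inl Δ Ξ) (x.comp (.inr Δ Ξ)))) →
      Provable T χ' (θ'.subst (.append (z.comp (.inr Δ Ξ)) (.inl Δ Ξ))) →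
      Provable T χ' (ω.subst (.inr Δ Ξ))) :
    Provable T χ ω := by
  rw [Formula.compRel, Formula.exs_subst] at h
  refine .ex_elim_exs h ?_
  simp only [Formula.subst, Formula.subst_subst, Subst.append_comp, Subst.comp_assoc,
    Subst.inl_append, Subst.inr_append]
  exact h' _ (.and_left _ _) (.cut (.and_right _ _) (.and_left _ _))
    (.cut (.and_right _ _) (.and_right _ _))

theorem idRel_iff {φ : Formula κ L Γ} {χ : Formula κ L Ξ} {x y : Subst L Γ Ξ} :
    Provable T χ (φ.idRel.subst (.append y x)) ↔
      Provable T χ (φ.subst x) ∧ ∀ s v, Provable T χ (.eq (y s v) (x s v)) := by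
  have e : φ.idRel.subst (.append y x) = .and (φ.subst x) (.eqs y x) := by
    simp only [Formula.idRel, Formula.subst, Formula.subst_subst, Formula.eqs_subst,
      Subst.inl_append, Subst.inr_append]
  rw [e]
  exact ⟨fun h => ⟨h.cut (.and_left _ _), .eqs_elim (h.cut (.and_right _ _))⟩,
    fun h => .and_intro h.1 (.eqs_intro h.2)⟩

/-- Replacement of equal terms in both arguments of a formula. -/
theorem Provable.eqs_mem_left {θ : Formula κ L Γ} {χ : Formula κ L Ξ} {x x' : Subst L Γ Ξ}
    (h : ∀ s v, Provable T χ (.eq (x s v) (x' s v))) (h' : Provable T χ (θ.subst x)) :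
    Provable T χ (θ.subst x') := by
  have e (r : Subst L Γ Ξ) : (θ.subst (.inl Γ Ξ)).subst (.append r (.id Ξ)) = θ.subst r := by
    rw [Formula.subst_subst, Subst.inl_append]
  have := Provable.eqs_mem (θ.subst (.inl Γ Ξ)) (σ := .id Ξ) h (by rw [e]; exact h')
  rwa [e] at this

theorem Provable.eqs_mem_both {θ : Formula κ L (Δ ++ Γ)} {χ : Formula κ L Ξ}
    {x x' : Subst L Γ Ξ} {y y' : Subst L Δ Ξ} (h : ∀ s v, Provable T χ (.eq (x s v) (x' s v)))
    (h' : ∀ s v, Provable T χ (.eq (y s v) (y' s v)))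
    (h'' : Provable T χ (θ.subst (.append y x))) : Provable T χ (θ.subst (.append y' x')) := by
  have e (r : Subst L Γ Ξ) : (θ.subst (.append (y'.comp (.inr Γ Ξ)) (.inl Γ Ξ))).subst
      (.append r (.id Ξ)) = θ.subst (.append y' r) := by
    rw [Formula.subst_subst, Subst.append_comp, Subst.comp_assoc, Subst.inl_append,
      Subst.inr_append, Subst.comp_id]
  have := Provable.eqs_mem (θ.subst (.append (y'.comp (.inr Γ Ξ)) (.inl Γ Ξ))) (σ := .id Ξ) h
    (by rw [e]; exact .eqs_mem _ h' h'')
  rwa [e] at this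

theorem Provable.eq_refl' {s : L.Srt} (χ : Formula κ L Ξ) (t : Term L Ξ s) :
    Provable T χ (.eq t t) :=
  .cut (.top_intro _) (.eq_refl t)

/-- Criterion for functionality, in terms of arbitrary instances. -/
theorem IsFunctional.mk' {φ : Formula κ L Γ} {ψ : Formula κ L Δ} {θ : Formula κ L (Δ ++ Γ)}
    (hdom : ∀ (Ξ : List L.Srt) (χ : Formula κ L Ξ) (x : Subst L Γ Ξ) (y : Subst L Δ Ξ),
      Provable T χ (θ.subst (.append y x)) →
        Provable T χ (φ.subst x) ∧ Provable T χ (ψ.subst y))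
    (htotal : Provable T φ (.exs Δ θ))
    (huniq : ∀ (Ξ : List L.Srt) (χ : Formula κ L Ξ) (x : Subst L Γ Ξ) (y y' : Subst L Δ Ξ),
      Provable T χ (θ.subst (.append y x)) → Provable T χ (θ.subst (.append y' x)) →
        ∀ s v, Provable T χ (.eq (y s v) (y' s v))) : IsFunctional T φ ψ θ where
  dom_cod := by
    have := hdom _ θ (.inr Δ Γ) (.inl Δ Γ) (by rw [Formula.self_eq]; exact .refl _)
    exact .and_intro this.1 this.2
  total := htotal
  unique := .eqs_intro (huniq _ _ _ _ _ (.and_left _ _) (.and_right _ _))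

theorem isFunctional_idRel (φ : Formula κ L Γ) : IsFunctional T φ φ φ.idRel := by
  refine .mk' (fun Ξ χ x y h => ?_) ?_ (fun Ξ χ x y y' h h' s v => ?_)
  · rw [idRel_iff] at h
    exact ⟨h.1, .eqs_mem_left (fun s v => (h.2 s v).eq_symm) h.1⟩
  · refine .exs_intro _ _ (.id Γ) (idRel_iff.2 ⟨?_, fun s v => .eq_refl' _ _⟩)
    rw [Formula.subst_id]; exact .refl _
  · rw [idRel_iff] at h h'
    exact .eq_trans (h.2 s v) (h'.2 s v).eq_symm

theorem isFunctional_compRel {φ : Formula κ L Γ} {ψ : Formula κ L Δ} {ω : Formula κ L Λ}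
    {θ : Formula κ L (Δ ++ Γ)} {θ' : Formula κ L (Λ ++ Δ)} (H : IsFunctional T φ ψ θ)
    (H' : IsFunctional T ψ ω θ') : IsFunctional T φ ω (θ.compRel θ') := by
  refine .mk' (fun Ξ χ x z h => ⟨?_, ?_⟩) ?_ (fun Ξ χ x z z' h h' s v => ?_)
  · refine compRel_elim h fun χ' _ h1 h2 => ?_
    rw [Formula.subst_subst]; exact H.dom h1
  · refine compRel_elim h fun χ' _ h1 h2 => ?_
    rw [Formula.subst_subst]; exact H'.cod h2
  · refine H.elim (x := .id Γ) (by rw [Formula.subst_id]; exact .refl _) ?_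
    have h1 : Provable T (.and (φ.subst (.inr Δ Γ))
        (θ.subst (.append (.inl Δ Γ) ((Subst.id Γ).comp (.inr Δ Γ)))))
        (θ.subst (.append (.inl Δ Γ) ((Subst.id Γ).comp (.inr Δ Γ)))) := .and_right _ _
    refine H'.elim (x := .inl Δ Γ) (H.cod h1) ?_
    rw [Formula.exs_subst, Formula.exs_subst]
    refine .exs_intro _ _ (.inl _ _) ?_
    have h2 := h1.inst_weaken (Δ := Λ)
      (ω := θ'.subst (.append (.inl Λ (Δ ++ Γ)) ((Subst.inl Δ Γ).comp (.inr Λ (Δ ++ Γ)))))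
    rw [Subst.append_comp] at h2
    have := compRel_intro _ h2 (.and_right _ _)
    simpa only [Formula.subst_subst, Subst.append_comp, Subst.comp_assoc,
      Subst.inl_append, Subst.inr_append, Subst.comp_id, Subst.id_comp] using this
  · refine compRel_elim h fun χ' hχ h1 h2 => ?_
    have h'' := h'.subst (.inr Δ Ξ)
    rw [Formula.subst_subst, Subst.append_comp] at h''
    refine compRel_elim (.cut hχ h'') fun χ'' hχ' h3 h4 => ?_
    have h1' : Provable T χ'' _ := .cut hχ' (h1.subst (.inr Δ _))
    have h2' : Provable T χ'' _ := .cut hχ' (h2.subst (.inr Δ _))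
    rw [Formula.subst_subst, Subst.append_comp] at h1' h2'
    have h5 := H.uniq h3 h1'
    exact H'.uniq h2' (.eqs_mem_both h5 (fun s v => .eq_refl' _ _) h4) s v

theorem compRel_assoc {Θ : List L.Srt} (θ : Formula κ L (Δ ++ Γ)) (θ' : Formula κ L (Λ ++ Δ))
    (θ'' : Formula κ L (Θ ++ Λ)) :
    Provable T ((θ.compRel θ').compRel θ'') (θ.compRel (θ'.compRel θ'')) ∧
      Provable T (θ.compRel (θ'.compRel θ'')) ((θ.compRel θ').compRel θ'') := by
  constructor
  · refine compRel_elim (x := .inr Θ Γ) (z := .inl Θ Γ) (θ := θ.compRel θ') (θ' := θ'')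
      (by rw [Formula.self_eq]; exact .refl _) fun χ' _ h1 h2 => ?_
    refine compRel_elim h1 fun χ'' hχ h3 h4 => ?_
    have h5 : Provable T χ'' _ := .cut hχ (h2.subst (.inr _ _))
    rw [Formula.subst_subst, Subst.append_comp] at h5
    rw [← Formula.self_eq (θ.compRel _), Formula.subst_subst, Formula.subst_subst,
      Subst.append_comp, ← Subst.comp_assoc, ← Subst.comp_assoc]
    exact compRel_intro _ h3 (compRel_intro _ h4 h5)
  · refine compRel_elim (x := .inr Θ Γ) (z := .inl Θ Γ) (θ := θ) (θ' := θ'.compRel θ'')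
      (by rw [Formula.self_eq]; exact .refl _) fun χ' _ h1 h2 => ?_
    refine compRel_elim h2 fun χ'' hχ h3 h4 => ?_
    have h5 : Provable T χ'' _ := .cut hχ (h1.subst (.inr _ _))
    rw [Formula.subst_subst, Subst.append_comp] at h5
    rw [← Formula.self_eq (Formula.compRel _ θ''), Formula.subst_subst, Formula.subst_subst,
      Subst.append_comp, ← Subst.comp_assoc, ← Subst.comp_assoc]
    exact compRel_intro _ (compRel_intro _ h5 h3) h4

theorem idRel_compRel {φ : Formula κ L Γ} {ψ : Formula κ L Δ} {θ : Formula κ L (Δ ++ Γ)}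
    (H : IsFunctional T φ ψ θ) :
    Provable T (φ.idRel.compRel θ) θ ∧ Provable T θ (φ.idRel.compRel θ) := by
  have h0 : Provable T θ (θ.subst (.append (.inl Δ Γ) (.inr Δ Γ))) := by
    rw [Formula.self_eq]; exact .refl _
  constructor
  · refine compRel_elim (x := .inr Δ Γ) (z := .inl Δ Γ) (θ := φ.idRel) (θ' := θ)
      (by rw [Formula.self_eq]; exact .refl _) fun χ' _ h1 h2 => ?_
    rw [← Formula.self_eq θ, Formula.subst_subst, Subst.append_comp]
    exact .eqs_mem_both (idRel_iff.1 h1).2 (fun s v => .eq_refl' _ _) h2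
  · rw [← Formula.self_eq (φ.idRel.compRel θ)]
    exact compRel_intro (.inr Δ Γ) (idRel_iff.2 ⟨H.dom h0, fun s v => .eq_refl' _ _⟩) h0

theorem compRel_idRel {φ : Formula κ L Γ} {ψ : Formula κ L Δ} {θ : Formula κ L (Δ ++ Γ)}
    (H : IsFunctional T φ ψ θ) :
    Provable T (θ.compRel ψ.idRel) θ ∧ Provable T θ (θ.compRel ψ.idRel) := by
  have h0 : Provable T θ (θ.subst (.append (.inl Δ Γ) (.inr Δ Γ))) := by
    rw [Formula.self_eq]; exact .refl _
  constructor
  · refine compRel_elim (x := .inr Δ Γ) (z := .inl Δ Γ) (θ := θ) (θ' := ψ.idRel)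
      (by rw [Formula.self_eq]; exact .refl _) fun χ' _ h1 h2 => ?_
    rw [← Formula.self_eq θ, Formula.subst_subst, Subst.append_comp]
    exact .eqs_mem_both (fun s v => .eq_refl' _ _)
      (fun s v => ((idRel_iff.1 h2).2 s v).eq_symm) h1
  · rw [← Formula.self_eq (θ.compRel ψ.idRel)]
    exact compRel_intro (.inl Δ Γ) h0 (idRel_iff.2 ⟨H.cod h0, fun s v => .eq_refl' _ _⟩)

theorem compRel_mono {θ₁ θ₂ : Formula κ L (Δ ++ Γ)} {θ₁' θ₂' : Formula κ L (Λ ++ Δ)}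
    (h : Provable T θ₁ θ₂) (h' : Provable T θ₁' θ₂') :
    Provable T (θ₁.compRel θ₁') (θ₂.compRel θ₂') := by
  refine compRel_elim (x := .inr Λ Γ) (z := .inl Λ Γ) (θ := θ₁) (θ' := θ₁')
    (by rw [Formula.self_eq]; exact .refl _) fun χ' _ h1 h2 => ?_
  rw [← Formula.self_eq (Formula.compRel θ₂ _), Formula.subst_subst, Subst.append_comp]
  exact compRel_intro _ (.subst_of _ h1 h) (.subst_of _ h2 h')

end Functional

/-! ## The syntactic category -/

/-- Objects of the syntactic category of `T`: formulae `φ(x⃗)` with a finite sequence of variables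
(up to renaming of variables). -/
structure Syn (T : Theory κ L) : Type u where
  ctx : List L.Srt
  formula : Formula κ L ctx

namespace Syn

variable {T : Theory κ L}

/-- `T`-provably functional formulae, up to `T`-provable equivalence. -/
def homSetoid (X Y : Syn T) :
    Setoid {θ : Formula κ L (Y.ctx ++ X.ctx) // IsFunctional T X.formula Y.formula θ} where
  r θ θ' := Provable T θ.1 θ'.1 ∧ Provable T θ'.1 θ.1
  iseqv :=
    { refl := fun _ => ⟨.refl _, .refl _⟩
      symm := fun h => ⟨h.2, h.1⟩
      trans := fun h h' => ⟨h.1.cut h'.1, h'.2.cut h.2⟩ }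

instance : Category.{u} (Syn T) where
  Hom X Y := Quotient (homSetoid X Y)
  id X := Quotient.mk _ ⟨X.formula.idRel, isFunctional_idRel _⟩
  comp {X Y Z} := Quotient.map₂ (sa := homSetoid X Y) (sb := homSetoid Y Z) (sc := homSetoid X Z)
    (fun θ θ' => ⟨θ.1.compRel θ'.1, isFunctional_compRel θ.2 θ'.2⟩)
    (fun _ _ h _ _ h' => ⟨compRel_mono h.1 h'.1, compRel_mono h.2 h'.2⟩)
  id_comp f := by
    induction f using Quotient.inductionOn with
    | _ θ => exact Quotient.sound (idRel_compRel θ.2)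
  comp_id f := by
    induction f using Quotient.inductionOn with
    | _ θ => exact Quotient.sound (compRel_idRel θ.2)
  assoc f g h := by
    induction f using Quotient.inductionOn with
    | _ θ =>
      induction g using Quotient.inductionOn with
      | _ θ' =>
        induction h using Quotient.inductionOn with
        | _ θ'' => exact Quotient.sound (compRel_assoc _ _ _)

end Syn

/-! ## `κ`-coherent categories and functors -/

section Categories

variable {C : Type u₁} [Category.{v₁} C]

/-- `I` is the image of `f`: the least subobject of the codomain through which `f` factors. -/
def IsImageSubobject {X Y : C} (f : X ⟶ Y) (I : Subobject Y) : Prop :=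
  IsLeast {A : Subobject Y | A.Factors f} I

/-- A category with finite limits is `κ`-coherent if it has pullback-stable images and
pullback-stable unions of `κ`-small families of subobjects. -/
class KappaCoherentCategory (κ : Cardinal.{u}) (C : Type u₁) [Category.{v₁} C]
    [HasFiniteLimits C] : Prop where
  exists_image : ∀ {X Y : C} (f : X ⟶ Y), ∃ I, IsImageSubobject f I
  image_pullback : ∀ {X Y X' Y' : C} {f : X ⟶ Y} {f' : X' ⟶ Y'} {g : Y' ⟶ Y} {g' : X' ⟶ X}
    (_ : IsPullback g' f' f g) (I : Subobject Y), IsImageSubobject f I →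
      IsImageSubobject f' ((Subobject.pullback g).obj I)
  exists_union : ∀ {X : C} {ι : Type u} (_ : Cardinal.mk ι < κ) (A : ι → Subobject X),
    ∃ U, IsLUB (Set.range A) U
  union_pullback : ∀ {X Y : C} (g : Y ⟶ X) {ι : Type u} (_ : Cardinal.mk ι < κ)
    (A : ι → Subobject X) (U : Subobject X), IsLUB (Set.range A) U →
      IsLUB (Set.range fun i => (Subobject.pullback g).obj (A i)) ((Subobject.pullback g).obj U)

variable {E : Type u₂} [Category.{v₂} E]

/-- The image `F A ↣ F X` of a subobject `A ↣ X` under a functor that preserves finite limits. -/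
noncomputable def mapSubobject (F : C ⥤ E) [PreservesFiniteLimits F] {X : C} (A : Subobject X) :
    Subobject (F.obj X) :=
  Subobject.mk (F.map A.arrow)

/-- A `κ`-coherent functor preserves finite limits, images, and unions of `κ`-small families of
subobjects. -/
class IsKappaCoherentFunctor (κ : Cardinal.{u}) (F : C ⥤ E) : Prop
    extends PreservesFiniteLimits F where
  map_image : ∀ {X Y : C} (f : X ⟶ Y) (I : Subobject Y), IsImageSubobject f I →
    IsImageSubobject (F.map f) (mapSubobject F I)
  map_union : ∀ {X : C} {ι : Type u} (_ : Cardinal.mk ι < κ) (A : ι → Subobject X)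
    (U : Subobject X), IsLUB (Set.range A) U →
      IsLUB (Set.range fun i => mapSubobject F (A i)) (mapSubobject F U)

end Categories

/-- The category of `κ`-coherent functors and all natural transformations between them. -/
abbrev Coh (κ : Cardinal.{u}) (C : Type u₁) [Category.{v₁} C] (E : Type u₂) [Category.{v₂} E] :=
  ObjectProperty.FullSubcategory (C := C ⥤ E) fun F => IsKappaCoherentFunctor κ F

/-! ## Structures and models -/

noncomputable section

section Products

variable {C : Type u₁} [Category.{v₁} C] [HasFiniteLimits C] {S : Type u}

/-- The product `M(s₁) × ⋯ × M(sₙ)` (with a terminal last factor). -/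
@[reducible] def prodObj (M : S → C) : List S → C
  | [] => ⊤_ C
  | s :: Γ => M s ⨯ prodObj M Γ

def prodProj (M : S → C) : {Γ : List S} → {s : S} → Var Γ s → (prodObj M Γ ⟶ M s)
  | _, _, .head => prod.fst
  | _, _, .tail v => prod.snd ≫ prodProj M v

def prodLift (M : S → C) {X : C} : {Γ : List S} → (∀ s, Var Γ s → (X ⟶ M s)) →
    (X ⟶ prodObj M Γ)
  | [], _ => terminal.from X
  | _ :: _, a => prod.lift (a _ .head) (prodLift M fun s v => a s v.tail)

def prodMap {M N : S → C} (α : ∀ s, M s ⟶ N s) (Γ : List S) : prodObj M Γ ⟶ prodObj N Γ :=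
  prodLift N fun s v => prodProj M v ≫ α s

theorem prodLift_proj (M : S → C) {X : C} {Γ : List S} (a : ∀ s, Var Γ s → (X ⟶ M s)) {s : S}
    (v : Var Γ s) : prodLift M a ≫ prodProj M v = a s v := by
  induction v with
  | head => exact prod.lift_fst _ _
  | tail v ih =>
    exact (Category.assoc _ _ _).symm.trans
      ((congrArg (· ≫ prodProj M v) (prod.lift_snd _ _)).trans (ih _))

theorem prod_hom_ext (M : S → C) {X : C} {Γ : List S} {f g : X ⟶ prodObj M Γ}
    (h : ∀ s (v : Var Γ s), f ≫ prodProj M v = g ≫ prodProj M v) : f = g := by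
  induction Γ with
  | nil => exact terminal.hom_ext _ _
  | cons s Γ ih =>
    refine prod.hom_ext (h s .head) (ih fun r v => ?_)
    exact (Category.assoc _ _ _).trans ((h r v.tail).trans (Category.assoc _ _ _).symm)

theorem prodMap_id (M : S → C) (Γ : List S) : prodMap (fun s => 𝟙 (M s)) Γ = 𝟙 _ :=
  prod_hom_ext M fun s v => by
    rw [prodMap, prodLift_proj, Category.comp_id, Category.id_comp]

theorem prodMap_comp {M N P : S → C} (α : ∀ s, M s ⟶ N s) (β : ∀ s, N s ⟶ P s) (Γ : List S) :
    prodMap (fun s => α s ≫ β s) Γ = prodMap α Γ ≫ prodMap β Γ :=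
  prod_hom_ext P fun s v => by
    rw [Category.assoc, prodMap, prodMap, prodMap, prodLift_proj, prodLift_proj,
      ← Category.assoc, ← Category.assoc, prodLift_proj]

end Products

/-- A `C`-structure of type `L`. -/
structure Struct (L : Signature.{u}) (C : Type u₁) [Category.{v₁} C] [HasFiniteLimits C] where
  obj : L.Srt → C
  rel : ∀ p : L.Pred, Subobject (prodObj obj (L.predDom p))
  op : ∀ f : L.Op, prodObj obj (L.opDom f) ⟶ obj (L.opCod f)

namespace Struct

variable {C : Type u₁} [Category.{v₁} C] [HasFiniteLimits C] (M : Struct L C)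

/-- The interpretation `M(x⃗) ⟶ M(s)` of a term of sort `s`. -/
def interpTerm {Γ : List L.Srt} : {s : L.Srt} → Term L Γ s → (prodObj M.obj Γ ⟶ M.obj s)
  | _, .var v => prodProj M.obj v
  | _, .app f ts => prodLift M.obj (fun s v => interpTerm (ts s v)) ≫ M.op f

/-- The interpretation of a formula as a subobject of `M(x⃗)`. -/
def interp [KappaCoherentCategory κ C] :
    {Γ : List L.Srt} → Formula κ L Γ → Subobject (prodObj M.obj Γ)
  | _, .rel p ts =>
      (Subobject.pullback (prodLift M.obj fun s v => M.interpTerm (ts s v))).obj (M.rel p)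
  | _, .eq t t' => equalizerSubobject (M.interpTerm t) (M.interpTerm t')
  | _, .top => ⊤
  | _, .and φ ψ => interp φ ⊓ interp ψ
  | _, .disj _ hI φ =>
      (KappaCoherentCategory.exists_union (κ := κ) hI fun i => interp (φ i)).choose
  | Γ, .ex s φ =>
      (KappaCoherentCategory.exists_image κ
        ((interp φ).arrow ≫ (prod.snd : M.obj s ⨯ prodObj M.obj Γ ⟶ prodObj M.obj Γ))).choose

/-- A sequent is valid in `M`. -/
def Valid [KappaCoherentCategory κ C] (S : Sequent κ L) : Prop :=
  M.interp S.lhs ≤ M.interp S.rhs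

end Struct

/-- A model of the theory `T` in `C`. -/
structure Model (T : Theory κ L) (C : Type u₁) [Category.{v₁} C] [HasFiniteLimits C]
    [KappaCoherentCategory κ C] where
  str : Struct L C
  valid : ∀ S ∈ T, str.Valid S

namespace Model

variable {T : Theory κ L} {C : Type u₁} [Category.{v₁} C] [HasFiniteLimits C]
  [KappaCoherentCategory κ C]

/-- A morphism of models: a family of morphisms that commutes with the operations and maps the
predicates of `M` into those of `N`. -/
@[ext]
structure Hom (M N : Model T C) where
  app : ∀ s : L.Srt, M.str.obj s ⟶ N.str.obj s
  op : ∀ f : L.Op, M.str.op f ≫ app (L.opCod f) = prodMap app (L.opDom f) ≫ N.str.op f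
  rel : ∀ p : L.Pred,
    (N.str.rel p).Factors ((M.str.rel p).arrow ≫ prodMap app (L.predDom p))

/-- Models of `T` in `C` and their morphisms form a category. -/
instance : Category (Model T C) where
  Hom := Hom
  id M :=
    { app := fun _ => 𝟙 _
      op := fun f => by rw [prodMap_id, Category.comp_id, Category.id_comp]
      rel := fun p => by rw [prodMap_id, Category.comp_id]; exact Subobject.factors_self _ }
  comp {M N P} α β :=
    { app := fun s => α.app s ≫ β.app s
      op := fun f => by
        rw [prodMap_comp, ← Category.assoc, α.op, Category.assoc, β.op, Category.assoc]
      rel := fun p => by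
        rw [prodMap_comp, ← Category.assoc,
          ← Subobject.factorThru_arrow _ _ (α.rel p), Category.assoc]
        exact Subobject.factors_of_factors_right _ (β.rel p) }

end Model

/-! ## The theory of a database schema -/

section Schema

variable (D : Type u) [SmallCategory D]

/-- The signature of the schema `D`: one sort per object, one unary operation per morphism, and no
predicates. -/
abbrev schSignature : Signature.{u} where
  Srt := D
  Pred := PEmpty
  Op := Σ X Y : D, X ⟶ Y
  predDom := nofun
  opDom f := [f.1]
  opCod f := f.2.1

variable {D}

/-- The term `f(t)`. -/
def schApp {Γ : List D} {X Y : D} (f : X ⟶ Y) (t : Term (schSignature D) Γ X) :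
    Term (schSignature D) Γ Y :=
  .app (L := schSignature D) ⟨X, Y, f⟩ fun _ v =>
    match v with
    | .head => t

/-- The variable `x` of the sort `X`. -/
def schVar (X : D) : Term (schSignature D) [X] X := .var (L := schSignature D) .head

variable (κ D)

/-- The theory of the schema `D`: its axioms are the composition equations
`⊤ ⊢ g(f(x)) = (f ≫ g)(x)` and, for the empty composites, `⊤ ⊢ 𝟙_X(x) = x`. -/
inductive SchAxiom : Sequent κ (schSignature D) → Prop
  | comp {X Y Z : D} (f : X ⟶ Y) (g : Y ⟶ Z) :
      SchAxiom ⟨[X], .top, .eq (s := Z) (schApp g (schApp f (schVar X))) (schApp (f ≫ g) (schVar X))⟩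
  | id (X : D) : SchAxiom ⟨[X], .top, .eq (s := X) (schApp (𝟙 X) (schVar X)) (schVar X)⟩

/-- The `κ`-coherent theory `Sch(D)`. -/
def Sch : Theory κ (schSignature D) := {S | SchAxiom κ D S}

variable {D}

/-- The structure given by a functor `F : D ⥤ C`: it interprets the sort `X` as `F X` and the unary
operation `f` as `F f`. -/
def schStruct {C : Type u₁} [Category.{v₁} C] [HasFiniteLimits C] (F : D ⥤ C) :
    Struct (schSignature D) C where
  obj := F.obj
  rel := nofun
  op f := prod.fst ≫ F.map f.2.2

end Schema

end

end KappaCoherent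

/-! The generic model sends an object X of `D` to the formula ⊤ in one variable of sort X.
Restriction along it is shown to be an equivalence from κ-coherent functors on Syn(Sch(D)) to
functors on `D`.

Morphisms of the syntactic category are handled through their elements. `Sends χ f x y` says that,
under the hypothesis χ, the terms x are sent by f to the terms y. Two facts make this effective. A
hypothesis χ is itself an object, and terms satisfying a formula are morphisms out of it
(`ofSubst_comp_eq_iff`). Moreover, every morphism is given by terms after precomposition with an
isomorphism given by terms, the projection of its graph to its domain (`exists_ofSubst`).

Syn(T) is κ-coherent for every theory T. The graph of a monomorphism, read backwards, is provably
functional on its image, so subobjects of ψ are formulae entailing ψ, ordered by provability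
(`sub_im`, `sub_le_sub_iff`). Images are then existential formulae and unions are disjunctions. They
are stable under pullback because the Frobenius and distributivity rules allow quantifiers and
disjunctions to be eliminated under side hypotheses.

Essential surjectivity: a functor F is a model of Sch(D). By soundness (`interp_le_of_provable`)
formulae become subobjects of products, and provably functional formulae become morphisms
(`exists_sends`). The resulting κ-coherent functor on Syn(Sch(D)) restricts to F up to the
isomorphism F(X) × 1 ≅ F(X).

Faithfulness: every formula is a subobject of its context, every context is a finite product of
sorts, and both facts survive a functor that preserves finite limits (`natTrans_ext`). Fullness: a
family on the sorts that commutes with the operations extends to contexts and commutes with all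
terms. As there are no predicates, it restricts to each formula by induction, since κ-coherent
functors preserve the universal properties of the connectives (`exists_restrict`). Naturality need
only be checked on morphisms given by terms (`exists_natTrans`).

For the isomorphism with models, the axioms of Sch(D) are the two functor laws and homomorphisms are
natural transformations (`forall_valid_sch_iff`). -/

namespace KappaCoherent

/-! ## Morphisms of the syntactic category -/

namespace Syn

variable {κ : Cardinal.{u}} {L : Signature.{u}} {T : Theory κ L} {Γ Δ Ξ : List L.Srt}

/-- The morphism given by a provably functional formula. -/
def homMk {X Y : Syn T} (θ : Formula κ L (Y.ctx ++ X.ctx))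
    (H : IsFunctional T X.formula Y.formula θ) : X ⟶ Y :=
  Quotient.mk (homSetoid X Y) ⟨θ, H⟩

/-- A formula that represents the morphism `f`. -/
noncomputable def graph {X Y : Syn T} (f : X ⟶ Y) : Formula κ L (Y.ctx ++ X.ctx) :=
  (Quotient.out (s := homSetoid X Y) f).1

theorem isFunctional_graph {X Y : Syn T} (f : X ⟶ Y) :
    IsFunctional T X.formula Y.formula (graph f) :=
  (Quotient.out (s := homSetoid X Y) f).2

theorem homMk_graph {X Y : Syn T} (f : X ⟶ Y) : homMk (graph f) (isFunctional_graph f) = f :=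
  Quotient.out_eq (s := homSetoid X Y) f

/-- `Sends χ f x y`: it follows from `χ` that `f` sends the terms `x` to the terms `y`. -/
def Sends {X Y : Syn T} (χ : Formula κ L Ξ) (f : X ⟶ Y) (x : Subst L X.ctx Ξ)
    (y : Subst L Y.ctx Ξ) : Prop :=
  Provable T χ ((graph f).subst (.append y x))

section

variable {X Y Z W : Syn T} {χ ω : Formula κ L Ξ}

/-- `graph` selects an arbitrary representative; it is provably equivalent to `θ`, so the choice is
invisible to `Sends`. -/
theorem sends_homMk_iff {θ : Formula κ L (Y.ctx ++ X.ctx)}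
    {H : IsFunctional T X.formula Y.formula θ} {x : Subst L X.ctx Ξ} {y : Subst L Y.ctx Ξ} :
    Sends χ (homMk θ H) x y ↔ Provable T χ (θ.subst (.append y x)) := by
  have h := Quotient.mk_out (s := homSetoid X Y) ⟨θ, H⟩
  exact ⟨fun h' => .subst_of _ h' h.1, fun h' => .subst_of _ h' h.2⟩

theorem Sends.dom {f : X ⟶ Y} {x : Subst L X.ctx Ξ} {y : Subst L Y.ctx Ξ}
    (h : Sends χ f x y) : Provable T χ (X.formula.subst x) :=
  (isFunctional_graph f).dom h

theorem Sends.cod {f : X ⟶ Y} {x : Subst L X.ctx Ξ} {y : Subst L Y.ctx Ξ}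
    (h : Sends χ f x y) : Provable T χ (Y.formula.subst y) :=
  (isFunctional_graph f).cod h

theorem Sends.uniq {f : X ⟶ Y} {x : Subst L X.ctx Ξ} {y y' : Subst L Y.ctx Ξ}
    (h : Sends χ f x y) (h' : Sends χ f x y') (s : L.Srt) (v : Var Y.ctx s) :
    Provable T χ (.eq (y s v) (y' s v)) :=
  (isFunctional_graph f).uniq h h' s v

theorem Sends.congr {f : X ⟶ Y} {x x' : Subst L X.ctx Ξ} {y y' : Subst L Y.ctx Ξ}
    (h : Sends χ f x y) (hx : ∀ s v, Provable T χ (.eq (x s v) (x' s v)))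
    (hy : ∀ s v, Provable T χ (.eq (y s v) (y' s v))) : Sends χ f x' y' :=
  .eqs_mem_both hx hy h

theorem Sends.subst {f : X ⟶ Y} {x : Subst L X.ctx Ξ} {y : Subst L Y.ctx Ξ}
    (h : Sends χ f x y) {χ' : Formula κ L Γ} (σ : Subst L Ξ Γ)
    (hχ : Provable T χ' (χ.subst σ)) : Sends χ' f (x.comp σ) (y.comp σ) := by
  have := Provable.subst_of σ hχ h
  rwa [Formula.subst_subst, Subst.append_comp] at this

/-- Totality as an elimination rule: fresh variables may be introduced for the value of `f` at `x`.
Quantifying over every `χ'` that entails the weakened `χ` hides the exact shape of the enlarged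
hypothesis. -/
theorem sends_elim (f : X ⟶ Y) {x : Subst L X.ctx Ξ} (h : Provable T χ (X.formula.subst x))
    (h' : ∀ χ' : Formula κ L (Y.ctx ++ Ξ), Provable T χ' (χ.subst (.inr Y.ctx Ξ)) →
      Sends χ' f (x.comp (.inr Y.ctx Ξ)) (.inl Y.ctx Ξ) →
      Provable T χ' (ω.subst (.inr Y.ctx Ξ))) : Provable T χ ω :=
  (isFunctional_graph f).elim h (h' _ (.and_left _ _) (.and_right _ _))

theorem sends_id_iff {x y : Subst L X.ctx Ξ} :
    Sends χ (𝟙 X) x y ↔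
      Provable T χ (X.formula.subst x) ∧ ∀ s v, Provable T χ (.eq (y s v) (x s v)) :=
  (sends_homMk_iff (H := isFunctional_idRel X.formula)).trans idRel_iff

theorem comp_eq (f : X ⟶ Y) (g : Y ⟶ Z) : f ≫ g =
    homMk ((graph f).compRel (graph g))
      (isFunctional_compRel (isFunctional_graph f) (isFunctional_graph g)) := by
  conv_lhs => rw [← homMk_graph f, ← homMk_graph g]
  rfl

theorem Sends.comp {f : X ⟶ Y} {g : Y ⟶ Z} {x : Subst L X.ctx Ξ} {y : Subst L Y.ctx Ξ}
    {z : Subst L Z.ctx Ξ} (h : Sends χ f x y) (h' : Sends χ g y z) : Sends χ (f ≫ g) x z := by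
  rw [comp_eq, sends_homMk_iff]
  exact compRel_intro y h h'

/-- A fresh value of `g` at `y` is a value of `f ≫ g` at `x`, hence equals `z` by uniqueness. -/
theorem Sends.of_comp {f : X ⟶ Y} {g : Y ⟶ Z} {x : Subst L X.ctx Ξ} {y : Subst L Y.ctx Ξ}
    {z : Subst L Z.ctx Ξ} (h : Sends χ (f ≫ g) x z) (h' : Sends χ f x y) : Sends χ g y z := by
  refine sends_elim g h'.cod fun χ' hχ h1 => ?_
  rw [Formula.subst_subst, Subst.append_comp]
  have h2 := (h'.subst _ hχ).comp h1
  exact h1.congr (fun s v => .eq_refl' _ _) (h2.uniq (h.subst _ hχ))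

/-- One implication suffices between functional relations: if `g` relates x to y, then the value of
`f` at x is also a value of `g` at x, and uniqueness for `g` identifies it with y. -/
theorem hom_ext_of_sends {f g : X ⟶ Y}
    (h : ∀ {Ξ : List L.Srt} (χ : Formula κ L Ξ) (x : Subst L X.ctx Ξ) (y : Subst L Y.ctx Ξ),
      Sends χ f x y → Sends χ g x y) : f = g := by
  have h1 : Provable T (graph f) (graph g) := by
    have := h (graph f) (.inr _ _) (.inl _ _)
      (by rw [Sends, Formula.self_eq]; exact .refl _)
    rwa [Sends, Formula.self_eq] at this
  have h2 : Provable T (graph g) (graph f) := by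
    have h0 : Sends (graph g) g (.inr _ _) (.inl _ _) := by
      rw [Sends, Formula.self_eq]; exact .refl _
    refine sends_elim f h0.dom fun χ' hχ h3 => ?_
    have h4 := (h _ _ _ h3).uniq (h0.subst _ hχ)
    have := h3.congr (fun s v => .eq_refl' _ _) h4
    rwa [Sends, ← Subst.append_comp, ← Formula.subst_subst, Formula.self_eq] at this
  rw [← homMk_graph f, ← homMk_graph g]
  exact Quotient.sound ⟨h1, h2⟩

end

/-! ### Morphisms given by terms -/

theorem ofSubst_aux {X Y : Syn T} {χ : Formula κ L Ξ} (σ : Subst L Y.ctx X.ctx)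
    {x : Subst L X.ctx Ξ} {y : Subst L Y.ctx Ξ} :
    Provable T χ ((Formula.and (X.formula.subst (.inr Y.ctx X.ctx))
      (.eqs (.inl Y.ctx X.ctx) (σ.comp (.inr Y.ctx X.ctx)))).subst (.append y x)) ↔
    Provable T χ (X.formula.subst x) ∧ ∀ s v, Provable T χ (.eq (y s v) (σ.comp x s v)) := by
  rw [Formula.subst, Formula.subst_subst, Formula.eqs_subst, Subst.comp_assoc, Subst.inl_append,
    Subst.inr_append]
  exact ⟨fun h => ⟨h.cut (.and_left _ _), .eqs_elim (h.cut (.and_right _ _))⟩,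
    fun h => .and_intro h.1 (.eqs_intro h.2)⟩

theorem isFunctional_ofSubst {X Y : Syn T} (σ : Subst L Y.ctx X.ctx)
    (hσ : Provable T X.formula (Y.formula.subst σ)) :
    IsFunctional T X.formula Y.formula (.and (X.formula.subst (.inr Y.ctx X.ctx))
      (.eqs (.inl Y.ctx X.ctx) (σ.comp (.inr Y.ctx X.ctx)))) := by
  refine .mk' (fun Ξ χ x y h => ?_) ?_ (fun Ξ χ x y y' h h' s v => ?_)
  · rw [ofSubst_aux] at h
    have := Provable.subst_of x h.1 hσ
    rw [Formula.subst_subst] at this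
    exact ⟨h.1, .eqs_mem_left (fun s v => (h.2 s v).eq_symm) this⟩
  · refine .exs_intro _ _ σ ((ofSubst_aux σ).2 ⟨?_, fun s v => ?_⟩)
    · rw [Formula.subst_id]; exact .refl _
    · rw [Subst.comp_id]; exact .eq_refl' _ _
  · rw [ofSubst_aux] at h h'
    exact (h.2 s v).eq_trans (h'.2 s v).eq_symm

/-- The morphism `x⃗ ↦ σ(x⃗)` given by the terms `σ`. -/
def ofSubst {X Y : Syn T} (σ : Subst L Y.ctx X.ctx)
    (hσ : Provable T X.formula (Y.formula.subst σ)) : X ⟶ Y :=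
  homMk _ (isFunctional_ofSubst σ hσ)

section

variable {X Y Z W : Syn T} {χ : Formula κ L Ξ}

theorem sends_ofSubst_iff {σ : Subst L Y.ctx X.ctx}
    {hσ : Provable T X.formula (Y.formula.subst σ)} {x : Subst L X.ctx Ξ} {y : Subst L Y.ctx Ξ} :
    Sends χ (ofSubst σ hσ) x y ↔
      Provable T χ (X.formula.subst x) ∧ ∀ s v, Provable T χ (.eq (y s v) (σ.comp x s v)) :=
  sends_homMk_iff.trans (ofSubst_aux σ)

theorem sends_ofSubst {σ : Subst L Y.ctx X.ctx}
    {hσ : Provable T X.formula (Y.formula.subst σ)} {x : Subst L X.ctx Ξ}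
    (h : Provable T χ (X.formula.subst x)) : Sends χ (ofSubst σ hσ) x (σ.comp x) :=
  sends_ofSubst_iff.2 ⟨h, fun _ _ => .eq_refl' _ _⟩

theorem subst_id_refl (X : Syn T) : Provable T X.formula (X.formula.subst (.id _)) := by
  rw [Formula.subst_id]; exact .refl _

theorem sends_ofSubst_self {σ : Subst L Y.ctx X.ctx}
    {hσ : Provable T X.formula (Y.formula.subst σ)} :
    Sends X.formula (ofSubst σ hσ) (.id _) σ := by
  have := sends_ofSubst (hσ := hσ) (subst_id_refl X)
  rwa [Subst.comp_id] at this

/-- The bridge between diagrams and derivations: a triangle with two sides given by terms commutes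
exactly when one statement about `f` is provable from the formula of `W`. -/
theorem ofSubst_comp_eq_iff {x : Subst L X.ctx W.ctx}
    {hx : Provable T W.formula (X.formula.subst x)} {f : X ⟶ Y} {y : Subst L Y.ctx W.ctx}
    {hy : Provable T W.formula (Y.formula.subst y)} :
    ofSubst x hx ≫ f = ofSubst y hy ↔ Sends W.formula f x y := by
  constructor
  · intro h
    have h1 : Sends W.formula (ofSubst x hx ≫ f) (.id _) y := by
      rw [h]; exact sends_ofSubst_self
    exact h1.of_comp sends_ofSubst_self
  · intro h
    refine (hom_ext_of_sends fun χ w z hz => ?_).symm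
    have h1 := sends_ofSubst_iff.1 hz
    exact (sends_ofSubst (x := w) h1.1).comp
      ((h.subst w h1.1).congr (fun _ _ => .eq_refl' _ _) fun s v => (h1.2 s v).eq_symm)

theorem id_eq_ofSubst (X : Syn T) : 𝟙 X = ofSubst (.id _) (subst_id_refl X) := by
  refine hom_ext_of_sends fun χ x y h => ?_
  rw [sends_id_iff] at h
  exact sends_ofSubst_iff.2 h

theorem ofSubst_eq_iff {σ τ : Subst L Y.ctx X.ctx}
    {hσ : Provable T X.formula (Y.formula.subst σ)}
    {hτ : Provable T X.formula (Y.formula.subst τ)} :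
    ofSubst σ hσ = ofSubst τ hτ ↔ ∀ s v, Provable T X.formula (.eq (σ s v) (τ s v)) := by
  rw [← Category.comp_id (ofSubst σ hσ), ofSubst_comp_eq_iff, sends_id_iff]
  exact ⟨fun h s v => (h.2 s v).eq_symm, fun h => ⟨hσ, fun s v => (h s v).eq_symm⟩⟩

theorem provable_comp {σ : Subst L X.ctx W.ctx} {τ : Subst L Y.ctx X.ctx}
    (hσ : Provable T W.formula (X.formula.subst σ))
    (hτ : Provable T X.formula (Y.formula.subst τ)) :
    Provable T W.formula (Y.formula.subst (τ.comp σ)) := by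
  rw [← Formula.subst_subst]; exact .subst_of _ hσ hτ

theorem ofSubst_comp {σ : Subst L X.ctx W.ctx}
    {hσ : Provable T W.formula (X.formula.subst σ)} {τ : Subst L Y.ctx X.ctx}
    {hτ : Provable T X.formula (Y.formula.subst τ)} :
    ofSubst σ hσ ≫ ofSubst τ hτ = ofSubst (τ.comp σ) (provable_comp hσ hτ) := by
  rw [ofSubst_comp_eq_iff]
  exact sends_ofSubst hσ

/-- The graph of `f` as an object. -/
noncomputable abbrev graphObj (f : X ⟶ Y) : Syn T := ⟨Y.ctx ++ X.ctx, graph f⟩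

theorem sends_graph (f : X ⟶ Y) :
    Sends (graphObj f).formula f (.inr Y.ctx X.ctx) (.inl Y.ctx X.ctx) := by
  rw [Sends, Formula.self_eq]; exact .refl _

noncomputable def graphFst (f : X ⟶ Y) : graphObj f ⟶ X :=
  ofSubst (.inr Y.ctx X.ctx) (sends_graph f).dom

noncomputable def graphSnd (f : X ⟶ Y) : graphObj f ⟶ Y :=
  ofSubst (.inl Y.ctx X.ctx) (sends_graph f).cod

theorem graphFst_comp (f : X ⟶ Y) : graphFst f ≫ f = graphSnd f :=
  ofSubst_comp_eq_iff.2 (sends_graph f)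

/-- The displayed formula is the graph of `graphFst f` read backwards; it serves as the inverse in
`isIso_graphFst`. -/
theorem graph_section_aux (f : X ⟶ Y) {χ : Formula κ L Ξ} {x : Subst L X.ctx Ξ}
    {w : Subst L (Y.ctx ++ X.ctx) Ξ} :
    Provable T χ ((Formula.and ((graph f).subst (.inl (Y.ctx ++ X.ctx) X.ctx))
      (.eqs (.inr (Y.ctx ++ X.ctx) X.ctx)
        ((Subst.inr Y.ctx X.ctx).comp (.inl (Y.ctx ++ X.ctx) X.ctx)))).subst (.append w x)) ↔
    Provable T χ ((graph f).subst w) ∧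
      ∀ s v, Provable T χ (.eq (x s v) ((Subst.inr Y.ctx X.ctx).comp w s v)) := by
  rw [Formula.subst, Formula.subst_subst, Formula.eqs_subst, Subst.comp_assoc, Subst.inl_append,
    Subst.inr_append]
  exact ⟨fun h => ⟨h.cut (.and_left _ _), .eqs_elim (h.cut (.and_right _ _))⟩,
    fun h => .and_intro h.1 (.eqs_intro h.2)⟩

theorem eq_append (w : Subst L (Γ ++ Δ) Ξ) :
    w = .append ((Subst.inl Γ Δ).comp w) ((Subst.inr Γ Δ).comp w) := by
  rw [← Subst.append_comp, Subst.append_inl_inr, Subst.id_comp]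

theorem provable_append_eq {χ : Formula κ L Ξ} {x x' : Subst L Γ Ξ} {y y' : Subst L Δ Ξ}
    (hx : ∀ s v, Provable T χ (.eq (x s v) (x' s v)))
    (hy : ∀ s v, Provable T χ (.eq (y s v) (y' s v))) :
    ∀ s v, Provable T χ (.eq (Subst.append x y s v) (Subst.append x' y' s v)) := by
  induction Γ with
  | nil => exact hy
  | cons s Γ ih =>
    intro r v
    cases v with
    | head => exact hx _ _
    | tail v => exact ih (fun r v => hx r v.tail) _ v

/-- The inverse is x ↦ (f(x), x). As f(x) need not be a term, it has to be defined by a formula,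
whose totality and uniqueness are those of `f`. -/
instance isIso_graphFst (f : X ⟶ Y) : IsIso (graphFst f) := by
  have H : IsFunctional T X.formula (graphObj f).formula
      (Formula.and ((graph f).subst (.inl (Y.ctx ++ X.ctx) X.ctx))
        (.eqs (.inr (Y.ctx ++ X.ctx) X.ctx)
          ((Subst.inr Y.ctx X.ctx).comp (.inl (Y.ctx ++ X.ctx) X.ctx)))) := by
    refine .mk' (fun Ξ χ x w h => ?_) ?_ (fun Ξ χ x w w' h h' => ?_)
    · rw [graph_section_aux] at h
      refine ⟨?_, h.1⟩
      have := Provable.subst_of w h.1 (sends_graph f).dom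
      rw [Formula.subst_subst] at this
      exact .eqs_mem_left (fun s v => (h.2 s v).eq_symm) this
    · refine sends_elim f (x := .id _) (subst_id_refl X) fun χ' hχ h => ?_
      rw [Formula.exs_subst]
      refine .exs_intro _ _ (.id _) ?_
      rw [Formula.subst_subst, Subst.append_comp, Subst.comp_assoc, Subst.inl_append,
        Subst.inr_append, Subst.comp_id, graph_section_aux]
      refine ⟨?_, fun s v => by rw [Subst.comp_id]; exact .eq_refl' _ _⟩
      rw [Sends, Subst.id_comp, Formula.self_eq] at h
      rwa [Formula.subst_id]
    · rw [graph_section_aux] at h h'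
      rw [eq_append w] at h ⊢
      rw [eq_append w'] at h' ⊢
      rw [Subst.inr_append] at h h'
      have e := fun s v => (h.2 s v).eq_symm.eq_trans (h'.2 s v)
      refine provable_append_eq ?_ e
      exact Sends.uniq (f := f) (Sends.congr (f := f) h.1 e fun _ _ => .eq_refl' _ _) h'.1
  refine ⟨homMk _ H, ?_, hom_ext_of_sends fun χ x x' h => ?_⟩
  · rw [id_eq_ofSubst]
    refine ofSubst_comp_eq_iff.2 ?_
    rw [sends_homMk_iff, graph_section_aux]
    exact ⟨subst_id_refl _, fun _ _ => by rw [Subst.comp_id]; exact .eq_refl' _ _⟩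
  · rw [sends_id_iff]
    refine ⟨h.dom, fun s v => ?_⟩
    refine sends_elim (homMk _ H) h.dom fun χ' hχ h1 => ?_
    have h2 := (h.subst _ hχ).of_comp h1
    rw [sends_homMk_iff, graph_section_aux] at h1
    exact ((sends_ofSubst_iff.1 h2).2 s v).eq_trans (h1.2 s v).eq_symm

/-- Every morphism is given by terms, up to an isomorphism given by terms. -/
theorem exists_ofSubst (f : X ⟶ Y) : ∃ (W : Syn T) (σ : Subst L X.ctx W.ctx)
    (hσ : Provable T W.formula (X.formula.subst σ)) (τ : Subst L Y.ctx W.ctx)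
    (hτ : Provable T W.formula (Y.formula.subst τ)),
    IsIso (ofSubst σ hσ) ∧ ofSubst σ hσ ≫ f = ofSubst τ hτ :=
  ⟨graphObj f, _, _, _, _, isIso_graphFst f, graphFst_comp f⟩

end

end Syn

end KappaCoherent
-- Case distinctions, small index sets, and generalised elements of subobjects
namespace KappaCoherent

/-- Distributivity is what keeps the hypothesis `χ` available in every case. -/
theorem Provable.disj_cases {κ : Cardinal.{u}} {L : Signature.{u}} {T : Theory κ L}
    {Γ : List L.Srt} {I : Set κ.out} {hI : Cardinal.mk I < κ} {χ ω : Formula κ L Γ}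
    {φ : I → Formula κ L Γ} (h : Provable T χ (.disj I hI φ))
    (h' : ∀ i, Provable T (.and χ (φ i)) ω) : Provable T χ ω :=
  .cut (.and_intro (.refl χ) h) (.cut (.distrib I hI χ φ) (.disj_elim I hI _ _ h'))

/-- The syntax has disjunctions only over subsets of `κ.out`; any κ-small index type can be replaced
by one of these. -/
theorem exists_equiv_set_out {κ : Cardinal.{u}} {ι : Type u} (hι : Cardinal.mk ι < κ) :
    ∃ I : Set κ.out, Cardinal.mk I < κ ∧ Nonempty (I ≃ ι) := by
  have h : Cardinal.mk ι ≤ Cardinal.mk κ.out := by rw [Cardinal.mk_out]; exact hι.le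
  obtain ⟨f⟩ := h
  have e := Equiv.ofInjective f f.injective
  exact ⟨Set.range f, (Cardinal.mk_congr e.symm).trans_lt hι, ⟨e.symm⟩⟩

section

variable {C : Type u₁} [Category.{v₁} C]

theorem mk_le_iff_factors {X Y : C} (f : X ⟶ Y) [Mono f] (S : Subobject Y) :
    Subobject.mk f ≤ S ↔ S.Factors f :=
  ⟨fun h => Subobject.factors_of_le _ h (Subobject.mk_factors_self f),
    fun h => Subobject.mk_le_of_comm (S.factorThru f h) (Subobject.factorThru_arrow _ _ _)⟩

theorem le_iff_factors {Y : C} (R S : Subobject Y) :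
    R ≤ S ↔ ∀ {X : C} (f : X ⟶ Y), R.Factors f → S.Factors f :=
  ⟨fun h _ f hf => Subobject.factors_of_le f h hf,
    fun h => Subobject.le_of_factors (h _ (Subobject.factors_self R))⟩

theorem isPullback_of_exists {P X Y Z : C} {p : P ⟶ X} {q : P ⟶ Y} {f : X ⟶ Z} {g : Y ⟶ Z}
    (w : p ≫ f = q ≫ g)
    (h : ∀ {W : C} (a : W ⟶ X) (b : W ⟶ Y), a ≫ f = b ≫ g → ∃ l, l ≫ p = a ∧ l ≫ q = b)
    (h' : ∀ {W : C} (m m' : W ⟶ P), m ≫ p = m' ≫ p → m ≫ q = m' ≫ q → m = m') :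
    IsPullback p q f g where
  w := w
  isLimit' := ⟨PullbackCone.IsLimit.mk _
    (fun s => (h s.fst s.snd s.condition).choose)
    (fun s => (h s.fst s.snd s.condition).choose_spec.1)
    (fun s => (h s.fst s.snd s.condition).choose_spec.2)
    (fun s _ h1 h2 => h' _ _ (h1.trans (h s.fst s.snd s.condition).choose_spec.1.symm)
      (h2.trans (h s.fst s.snd s.condition).choose_spec.2.symm))⟩

end

namespace Syn

variable {κ : Cardinal.{u}} {L : Signature.{u}} {T : Theory κ L} {Γ Δ Ξ : List L.Srt}
  {X Y Z W : Syn T}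

/-! ### Finite limits -/

/-- Make `f` a term morphism first, then do the same for `g` seen from the new domain; isomorphisms
given by terms compose. -/
theorem exists_ofSubst₂ (f : W ⟶ X) (g : W ⟶ Y) : ∃ (W' : Syn T) (σ : Subst L W.ctx W'.ctx)
    (hσ : Provable T W'.formula (W.formula.subst σ)) (x : Subst L X.ctx W'.ctx)
    (hx : Provable T W'.formula (X.formula.subst x)) (y : Subst L Y.ctx W'.ctx)
    (hy : Provable T W'.formula (Y.formula.subst y)),
    IsIso (ofSubst σ hσ) ∧ ofSubst σ hσ ≫ f = ofSubst x hx ∧ ofSubst σ hσ ≫ g = ofSubst y hy := by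
  obtain ⟨W₁, σ, hσ, x, hx, h1, h2⟩ := exists_ofSubst f
  obtain ⟨W₂, τ, hτ, y, hy, h3, h4⟩ := exists_ofSubst (ofSubst σ hσ ≫ g)
  have e : ofSubst τ hτ ≫ ofSubst σ hσ = ofSubst (σ.comp τ) _ := ofSubst_comp
  refine ⟨W₂, σ.comp τ, ?_, x.comp τ, ?_, y, hy, ?_, ?_, ?_⟩
  · exact provable_comp hτ hσ
  · exact provable_comp hτ hx
  · rw [← e]; infer_instance
  · rw [← e, Category.assoc, h2, ofSubst_comp]
  · rw [← e, Category.assoc, h4]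

/-- The terminal object: the formula `⊤` in the empty context. -/
def isTerminalTop : IsTerminal (⟨[], .top⟩ : Syn T) :=
  IsTerminal.ofUniqueHom (fun W => ofSubst (X := W) (Y := ⟨[], .top⟩) nofun (.top_intro _))
    fun W m => by
      obtain ⟨W', σ, hσ, τ, hτ, h1, h2⟩ := exists_ofSubst m
      rw [← cancel_epi (ofSubst σ hσ), h2]
      refine Eq.trans ?_ ofSubst_comp.symm
      exact ofSubst_eq_iff.2 nofun

instance : HasTerminal (Syn T) := isTerminalTop.hasTerminal

/-- The formula `f(x⃗) = z⃗ ∧ g(y⃗) = z⃗`. -/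
noncomputable abbrev pullbackObj (f : X ⟶ Z) (g : Y ⟶ Z) : Syn T where
  ctx := Z.ctx ++ (X.ctx ++ Y.ctx)
  formula := .and
    ((graph f).subst (.append (.inl _ _) ((Subst.inl _ _).comp (.inr _ _))))
    ((graph g).subst (.append (.inl _ _) ((Subst.inr _ _).comp (.inr _ _))))

theorem provable_pullbackObj_iff {f : X ⟶ Z} {g : Y ⟶ Z} {χ : Formula κ L Ξ}
    {x : Subst L X.ctx Ξ} {y : Subst L Y.ctx Ξ} {z : Subst L Z.ctx Ξ} :
    Provable T χ ((pullbackObj f g).formula.subst (.append z (.append x y))) ↔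
      Sends χ f x z ∧ Sends χ g y z := by
  rw [Formula.subst, Formula.subst_subst, Formula.subst_subst, Subst.append_comp,
    Subst.append_comp, Subst.comp_assoc, Subst.comp_assoc, Subst.inl_append, Subst.inr_append,
    Subst.inl_append, Subst.inr_append]
  exact ⟨fun h => ⟨h.cut (.and_left _ _), h.cut (.and_right _ _)⟩, fun h => .and_intro h.1 h.2⟩

theorem sends_pullbackObj (f : X ⟶ Z) (g : Y ⟶ Z) :
    Sends (pullbackObj f g).formula f ((Subst.inl X.ctx Y.ctx).comp (.inr _ _)) (.inl _ _) ∧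
    Sends (pullbackObj f g).formula g ((Subst.inr X.ctx Y.ctx).comp (.inr _ _)) (.inl _ _) :=
  ⟨.and_left _ _, .and_right _ _⟩

noncomputable def pullbackFst (f : X ⟶ Z) (g : Y ⟶ Z) : pullbackObj f g ⟶ X :=
  ofSubst _ (sends_pullbackObj f g).1.dom

noncomputable def pullbackSnd (f : X ⟶ Z) (g : Y ⟶ Z) : pullbackObj f g ⟶ Y :=
  ofSubst _ (sends_pullbackObj f g).2.dom

noncomputable def pullbackMid (f : X ⟶ Z) (g : Y ⟶ Z) : pullbackObj f g ⟶ Z :=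
  ofSubst _ (sends_pullbackObj f g).1.cod

theorem pullbackFst_comp (f : X ⟶ Z) (g : Y ⟶ Z) : pullbackFst f g ≫ f = pullbackMid f g :=
  ofSubst_comp_eq_iff.2 (sends_pullbackObj f g).1

theorem pullbackSnd_comp (f : X ⟶ Z) (g : Y ⟶ Z) : pullbackSnd f g ≫ g = pullbackMid f g :=
  ofSubst_comp_eq_iff.2 (sends_pullbackObj f g).2

/-- The third block of the context, the common value z, is determined by the other two because
`pullbackMid` factors through `pullbackFst`. -/
theorem pullback_hom_ext {f : X ⟶ Z} {g : Y ⟶ Z} {m m' : W ⟶ pullbackObj f g}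
    (h : m ≫ pullbackFst f g = m' ≫ pullbackFst f g)
    (h' : m ≫ pullbackSnd f g = m' ≫ pullbackSnd f g) : m = m' := by
  have h'' : m ≫ pullbackMid f g = m' ≫ pullbackMid f g := by
    rw [← pullbackFst_comp, ← Category.assoc, h, Category.assoc]
  obtain ⟨W', σ, hσ, w, hw, w', hw', h1, h2, h3⟩ := exists_ofSubst₂ m m'
  rw [← cancel_epi (ofSubst σ hσ), h2, h3, ofSubst_eq_iff]
  replace h := congrArg (ofSubst σ hσ ≫ ·) h
  replace h' := congrArg (ofSubst σ hσ ≫ ·) h'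
  replace h'' := congrArg (ofSubst σ hσ ≫ ·) h''
  simp only [← Category.assoc, h2, h3] at h h' h''
  rw [pullbackFst, ofSubst_comp, ofSubst_comp, ofSubst_eq_iff] at h
  rw [pullbackSnd, ofSubst_comp, ofSubst_comp, ofSubst_eq_iff] at h'
  rw [pullbackMid, ofSubst_comp, ofSubst_comp, ofSubst_eq_iff] at h''
  rw [eq_append w, eq_append w', eq_append ((Subst.inr _ _).comp w),
    eq_append ((Subst.inr _ _).comp w')]
  rw [Subst.comp_assoc, Subst.comp_assoc] at h h'
  exact provable_append_eq h'' (provable_append_eq (Γ := X.ctx) h h')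

theorem exists_pullback_lift {f : X ⟶ Z} {g : Y ⟶ Z} (a : W ⟶ X) (b : W ⟶ Y)
    (h : a ≫ f = b ≫ g) :
    ∃ l : W ⟶ pullbackObj f g, l ≫ pullbackFst f g = a ∧ l ≫ pullbackSnd f g = b := by
  obtain ⟨W₁, σ, hσ, x, hx, y, hy, h1, h2, h3⟩ := exists_ofSubst₂ a b
  -- A second change of domain turns the common value of `a ≫ f` and `b ≫ g` into terms too, as
  -- needed for the block of `Z` in `pullbackObj`.
  obtain ⟨W₂, τ, hτ, z, hz, h4, h5⟩ := exists_ofSubst (ofSubst σ hσ ≫ a ≫ f)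
  have hf : Sends W₂.formula f (x.comp τ) z := by
    rw [reassoc_of% h2, ← Category.assoc, ofSubst_comp, ofSubst_comp_eq_iff] at h5
    exact h5
  have hg : Sends W₂.formula g (y.comp τ) z := by
    rw [h, reassoc_of% h3, ← Category.assoc, ofSubst_comp, ofSubst_comp_eq_iff] at h5
    exact h5
  refine ⟨inv (ofSubst σ hσ) ≫ inv (ofSubst τ hτ) ≫
    ofSubst (Y := pullbackObj f g) _ (provable_pullbackObj_iff.2 ⟨hf, hg⟩), ?_, ?_⟩
  · simp only [Category.assoc, IsIso.inv_comp_eq]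
    rw [pullbackFst, ofSubst_comp, h2, ofSubst_comp, ofSubst_eq_iff]
    intro s v
    rw [Subst.comp_assoc, Subst.inr_append, Subst.inl_append]
    exact .eq_refl' _ _
  · simp only [Category.assoc, IsIso.inv_comp_eq]
    rw [pullbackSnd, ofSubst_comp, h3, ofSubst_comp, ofSubst_eq_iff]
    intro s v
    rw [Subst.comp_assoc, Subst.inr_append, Subst.inr_append]
    exact .eq_refl' _ _

theorem isPullback_pullbackObj (f : X ⟶ Z) (g : Y ⟶ Z) :
    IsPullback (pullbackFst f g) (pullbackSnd f g) f g :=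
  isPullback_of_exists ((pullbackFst_comp f g).trans (pullbackSnd_comp f g).symm)
    exists_pullback_lift fun _ _ => pullback_hom_ext

instance : HasPullbacks (Syn T) :=
  have (X Y Z : Syn T) (f : X ⟶ Z) (g : Y ⟶ Z) : HasLimit (cospan f g) :=
    (isPullback_pullbackObj f g).hasPullback
  hasPullbacks_of_hasLimit_cospan _

instance : HasFiniteLimits (Syn T) := hasFiniteLimits_of_hasTerminal_and_pullbacks

/-! ### Subobjects -/

/-- The inclusion of the subobject of `Y` defined by a formula `A ⊢ Y`. -/
def incl (A : Formula κ L Y.ctx) (hA : Provable T A Y.formula) : (⟨Y.ctx, A⟩ : Syn T) ⟶ Y :=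
  ofSubst (X := ⟨Y.ctx, A⟩) (.id _) (by rw [Formula.subst_id]; exact hA)

theorem sends_incl_iff {A : Formula κ L Y.ctx} {hA : Provable T A Y.formula} {χ : Formula κ L Ξ}
    {x y : Subst L Y.ctx Ξ} : Sends χ (incl A hA) x y ↔
      Provable T χ (A.subst x) ∧ ∀ s v, Provable T χ (.eq (y s v) (x s v)) :=
  sends_ofSubst_iff

theorem ofSubst_incl {A : Formula κ L Y.ctx} {hA : Provable T A Y.formula}
    (y : Subst L Y.ctx W.ctx) (hy : Provable T W.formula (A.subst y)) :
    ofSubst (Y := ⟨Y.ctx, A⟩) y hy ≫ incl A hA = ofSubst y (.subst_of _ hy hA) :=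
  ofSubst_comp_eq_iff.2 (sends_incl_iff.2 ⟨hy, fun _ _ => .eq_refl' _ _⟩)

/-- Equality of morphisms given by terms is provable equality of the terms, in which the codomain
formula plays no part. -/
instance mono_incl (A : Formula κ L Y.ctx) (hA : Provable T A Y.formula) : Mono (incl A hA) where
  right_cancellation {W} f g h := by
    obtain ⟨W', σ, hσ, x, hx, y, hy, h1, h2, h3⟩ := exists_ofSubst₂ f g
    rw [← cancel_epi (ofSubst σ hσ), h2, h3, ofSubst_eq_iff]
    replace h := congrArg (ofSubst σ hσ ≫ ·) h
    simp only [← Category.assoc, h2, h3] at h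
    rwa [ofSubst_incl, ofSubst_incl, ofSubst_eq_iff] at h

/-- The subobject of `Y` defined by a formula `A ⊢ Y`. -/
noncomputable def sub (A : Formula κ L Y.ctx) (hA : Provable T A Y.formula) : Subobject Y :=
  Subobject.mk (incl A hA)

/-- For the converse, precomposing with the isomorphism `graphFst f` turns `f` into a block of
variables, and the same variables define a morphism into `A`. -/
theorem factors_sub_iff {A : Formula κ L Y.ctx} {hA : Provable T A Y.formula} {f : X ⟶ Y} :
    (sub A hA).Factors f ↔ ∀ {Ξ : List L.Srt} (χ : Formula κ L Ξ) (x : Subst L X.ctx Ξ)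
      (y : Subst L Y.ctx Ξ), Sends χ f x y → Provable T χ (A.subst y) := by
  constructor
  · rintro ⟨g, rfl⟩ Ξ χ x y h
    change X ⟶ ⟨Y.ctx, A⟩ at g
    change Sends χ (g ≫ incl A hA) x y at h
    refine sends_elim g h.dom fun χ' hχ h1 => ?_
    have h2 := h1.comp (sends_incl_iff (hA := hA).2 ⟨h1.cod, fun _ _ => .eq_refl' _ _⟩)
    rw [Formula.subst_subst]
    exact .eqs_mem_left (h2.uniq (h.subst _ hχ)) h1.cod
  · intro h
    refine ⟨inv (graphFst f) ≫ ofSubst (Y := ⟨Y.ctx, A⟩) (.inl _ _)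
      (h (graph f) _ _ (sends_graph f)), ?_⟩
    change (_ ≫ _) ≫ incl A hA = f
    rw [Category.assoc, ofSubst_incl, IsIso.inv_comp_eq, graphFst_comp]
    rfl

theorem factors_sub_ofSubst_iff {A : Formula κ L Y.ctx} {hA : Provable T A Y.formula}
    {y : Subst L Y.ctx W.ctx} {hy : Provable T W.formula (Y.formula.subst y)} :
    (sub A hA).Factors (ofSubst y hy) ↔ Provable T W.formula (A.subst y) :=
  ⟨fun h => factors_sub_iff.1 h _ _ _ sends_ofSubst_self, fun h => ⟨_, ofSubst_incl (hA := hA) y h⟩⟩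

theorem sub_le_sub_iff {A B : Formula κ L Y.ctx} {hA : Provable T A Y.formula}
    {hB : Provable T B Y.formula} : sub A hA ≤ sub B hB ↔ Provable T A B := by
  rw [sub, mk_le_iff_factors, incl, factors_sub_ofSubst_iff, Formula.subst_id]

/-- The formula `∃ x⃗, f(x⃗) = y⃗`. -/
noncomputable def im (f : X ⟶ Y) : Formula κ L Y.ctx :=
  .exs X.ctx ((graph f).subst (.append (.inr X.ctx Y.ctx) (.inl X.ctx Y.ctx)))

theorem im_intro {f : X ⟶ Y} {χ : Formula κ L Ξ} {x : Subst L X.ctx Ξ} {y : Subst L Y.ctx Ξ}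
    (h : Sends χ f x y) : Provable T χ ((im f).subst y) := by
  rw [im, Formula.exs_subst]
  refine .exs_intro _ _ x ?_
  simpa only [Formula.subst_subst, Subst.append_comp, Subst.comp_assoc,
    Subst.inl_append, Subst.inr_append, Subst.comp_id, Sends] using h

theorem im_elim {f : X ⟶ Y} {χ ω : Formula κ L Ξ} {y : Subst L Y.ctx Ξ}
    (h : Provable T χ ((im f).subst y))
    (h' : ∀ χ' : Formula κ L (X.ctx ++ Ξ), Provable T χ' (χ.subst (.inr X.ctx Ξ)) →
      Sends χ' f (.inl X.ctx Ξ) (y.comp (.inr X.ctx Ξ)) →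
      Provable T χ' (ω.subst (.inr X.ctx Ξ))) : Provable T χ ω := by
  rw [im, Formula.exs_subst] at h
  refine .ex_elim_exs h ?_
  simp only [Formula.subst_subst, Subst.append_comp, Subst.inl_append, Subst.inr_append]
  exact h' _ (.and_left _ _) (.and_right _ _)

theorem im_le (f : X ⟶ Y) : Provable T (im f) Y.formula := by
  refine im_elim (y := .id _) (by rw [Formula.subst_id]; exact .refl _) fun χ' _ h => ?_
  exact h.cod

/-- The hypothesis `χ` is an object, and `x`, `x'` are two morphisms from it to `X` that become
equal after the monomorphism `f`. -/
theorem sends_inj (f : X ⟶ Y) [Mono f] {χ : Formula κ L Ξ} {x x' : Subst L X.ctx Ξ}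
    {y : Subst L Y.ctx Ξ} (h : Sends χ f x y) (h' : Sends χ f x' y) :
    ∀ s v, Provable T χ (.eq (x s v) (x' s v)) := by
  refine (ofSubst_eq_iff (X := ⟨Ξ, χ⟩) (hσ := h.dom) (hτ := h'.dom)).1 ?_
  rw [← cancel_mono f, (ofSubst_comp_eq_iff (hy := h.cod)).2 h,
    (ofSubst_comp_eq_iff (hy := h.cod)).2 h']

/-- The graph of a monomorphism read backwards is functional from `im f` to `X`: totality is the
definition of `im`, and uniqueness is `sends_inj`. This gives an inverse to X → im f, so every
subobject is defined by a formula. -/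
theorem sub_im (f : X ⟶ Y) [Mono f] : sub (im f) (im_le f) = Subobject.mk f := by
  have e {Ξ : List L.Srt} {χ : Formula κ L Ξ} {x : Subst L X.ctx Ξ} {y : Subst L Y.ctx Ξ} :
      Provable T χ (((graph f).subst (.append (.inr X.ctx Y.ctx) (.inl X.ctx Y.ctx))).subst
        (.append x y)) ↔ Sends χ f x y := by
    rw [Formula.subst_subst, Subst.append_comp, Subst.inl_append, Subst.inr_append]
    rfl
  have H : IsFunctional T (im f) X.formula
      ((graph f).subst (.append (.inr X.ctx Y.ctx) (.inl X.ctx Y.ctx))) := by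
    refine .mk' (fun Ξ χ y x h => ?_) (.refl _) (fun Ξ χ y x x' h h' => ?_)
    · rw [e] at h
      exact ⟨im_intro h, h.dom⟩
    · rw [e] at h h'
      exact sends_inj f h h'
  refine le_antisymm ?_ ((mk_le_iff_factors _ _).2 (factors_sub_iff.2 fun χ x y h => im_intro h))
  refine (mk_le_iff_factors _ _).2 ⟨homMk (X := ⟨Y.ctx, im f⟩) _ H, ?_⟩
  refine (hom_ext_of_sends fun χ y y' h => ?_).symm
  rw [sends_incl_iff] at h
  refine im_elim (f := f) h.1 fun χ' hχ h1 => ?_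
  rw [Formula.subst_subst, Subst.append_comp]
  have h2 := Sends.comp (f := homMk (X := ⟨Y.ctx, im f⟩) _ H) (sends_homMk_iff.2 (e.2 h1)) h1
  exact h2.congr (fun _ _ => .eq_refl' _ _)
    fun s v => (Provable.subst_of _ hχ (h.2 s v)).eq_symm

theorem exists_eq_sub (S : Subobject Y) :
    ∃ (A : Formula κ L Y.ctx) (hA : Provable T A Y.formula), S = sub A hA :=
  ⟨_, _, (S.mk_arrow.symm.trans (sub_im S.arrow).symm)⟩

theorem isImageSubobject_im (f : X ⟶ Y) : IsImageSubobject f (sub (im f) (im_le f)) := by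
  refine ⟨factors_sub_iff.2 fun χ x y h => im_intro h, fun S hS => ?_⟩
  obtain ⟨B, hB, rfl⟩ := exists_eq_sub S
  rw [sub_le_sub_iff]
  refine im_elim (y := .id _) (by rw [Formula.subst_id]; exact .refl _) fun χ' _ h => ?_
  exact factors_sub_iff.1 hS _ _ _ h

theorem isLUB_disj {I : Set κ.out} {hI : Cardinal.mk I < κ} (A : I → Formula κ L Y.ctx)
    (hA : ∀ i, Provable T (A i) Y.formula) :
    IsLUB (Set.range fun i => sub (A i) (hA i)) (sub (.disj I hI A) (.disj_elim I hI A _ hA)) := by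
  constructor
  · rintro _ ⟨i, rfl⟩
    exact sub_le_sub_iff.2 (.disj_intro I hI A i)
  · intro S hS
    obtain ⟨B, hB, rfl⟩ := exists_eq_sub S
    exact sub_le_sub_iff.2 (.disj_elim I hI A _ fun i => sub_le_sub_iff.1 (hS ⟨i, rfl⟩))

/-- Puts a κ-small family of subobjects into the form required by `isLUB_disj`: indexed by a subset
of `κ.out` and given by formulae. -/
theorem exists_isLUB {ι : Type u} (hι : Cardinal.mk ι < κ) (S : ι → Subobject Y) :
    ∃ (I : Set κ.out) (_ : Cardinal.mk I < κ) (A : I → Formula κ L Y.ctx)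
      (hA : ∀ i, Provable T (A i) Y.formula),
      (Set.range S = Set.range fun i => sub (A i) (hA i)) ∧ ∃ e : I ≃ ι, ∀ i,
      S (e i) = sub (A i) (hA i) := by
  obtain ⟨I, hI, ⟨e⟩⟩ := exists_equiv_set_out hι
  choose A hA h using fun i => exists_eq_sub (S (e i))
  exact ⟨I, hI, A, hA, by simp only [← h]; exact (e.surjective.range_comp S).symm, e, h⟩

/-- To compare the pullback of the subobject `A` with `S`, it suffices to compare them on terms. -/
theorem pullback_sub_le {A : Formula κ L Y.ctx} {hA : Provable T A Y.formula} {g : X ⟶ Y}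
    {B : Formula κ L X.ctx} {hB : Provable T B X.formula}
    (h : ∀ {Ξ : List L.Srt} (χ : Formula κ L Ξ) (x : Subst L X.ctx Ξ) (y : Subst L Y.ctx Ξ),
      Sends χ g x y → Provable T χ (A.subst y) → Provable T χ (B.subst x)) :
    (Subobject.pullback g).obj (sub A hA) ≤ sub B hB := by
  rw [le_iff_factors]
  intro W f hf
  rw [pullback_factors_iff, factors_sub_iff] at hf
  refine factors_sub_iff.2 fun χ w x hx => ?_
  refine sends_elim g hx.cod fun χ' hχ h1 => ?_
  rw [Formula.subst_subst]
  exact h _ _ _ h1 (hf _ _ _ ((hx.subst _ hχ).comp h1))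

/-- Stability of images and unions reflects that `im_elim` and `disj_cases` retain the side
hypothesis, here that `g` sends y' to y. -/
instance : KappaCoherentCategory κ (Syn T) where
  exists_image f := ⟨_, isImageSubobject_im f⟩
  image_pullback {X Y X' Y' f f' g g'} sq I hI := by
    obtain rfl := hI.unique (isImageSubobject_im f)
    refine ⟨?_, fun S hS => ?_⟩
    · rw [Set.mem_ofPred_eq, pullback_factors_iff, ← sq.w]
      exact Subobject.factors_of_factors_right _ (isImageSubobject_im f).1
    · obtain ⟨B, hB, rfl⟩ := exists_eq_sub S
      refine pullback_sub_le fun χ y' y hy h => ?_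
      refine im_elim h fun χ' hχ hx => ?_
      rw [Formula.subst_subst]
      have hy' := hy.subst _ hχ
      -- In the context of `χ'`, the element of `X` and the element y' of `Y'` have the same value
      -- in `Y`. They define a morphism from `χ'` to the pullback `X'` whose composite with `f'` is
      -- y'; since `f'` factors through `B`, so does y'.
      have e : ofSubst (X := ⟨_, χ'⟩) _ hx.dom ≫ f = ofSubst _ hy'.dom ≫ g :=
        ((ofSubst_comp_eq_iff (hy := hx.cod)).2 hx).trans (ofSubst_comp_eq_iff.2 hy').symm
      have := Subobject.factors_of_factors_right (P := sub B hB) (sq.lift _ _ e) hS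
      rwa [sq.lift_snd, factors_sub_ofSubst_iff] at this
  exists_union hι S := by
    obtain ⟨I, hI, A, hA, h, -⟩ := exists_isLUB hι S
    exact ⟨_, h ▸ isLUB_disj (hI := hI) A hA⟩
  union_pullback {X Y} g ι hι S U hU := by
    obtain ⟨I, hI, A, hA, h, e, he⟩ := exists_isLUB hι S
    rw [h] at hU
    obtain rfl := hU.unique (isLUB_disj (hI := hI) A hA)
    refine ⟨?_, fun R hR => ?_⟩
    · rintro _ ⟨i, rfl⟩
      obtain ⟨i, rfl⟩ := e.surjective i
      refine (Subobject.pullback g).monotone ?_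
      rw [he]
      exact sub_le_sub_iff.2 (.disj_intro I hI A i)
    · obtain ⟨B, hB, rfl⟩ := exists_eq_sub R
      refine pullback_sub_le fun χ y' y hy h => ?_
      refine .disj_cases h fun i => ?_
      -- The i-th case is adjoined to the hypothesis. From the resulting object, y' is a morphism
      -- that lies in the pullback of the i-th subobject, hence in the upper bound.
      have h1 : Sends (Formula.and χ ((A i).subst y)) g y' y := .cut (.and_left _ _) hy
      have h2 : ((Subobject.pullback g).obj (sub (A i) (hA i))).Factors
          (ofSubst (X := ⟨_, Formula.and χ ((A i).subst y)⟩) y' h1.dom) := by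
        rw [pullback_factors_iff, (ofSubst_comp_eq_iff (hy := h1.cod)).2 h1,
          factors_sub_ofSubst_iff]
        exact .and_right _ _
      have h3 := Subobject.factors_of_le _ (hR ⟨e i, rfl⟩) (by dsimp only; rw [he]; exact h2)
      rwa [factors_sub_ofSubst_iff] at h3

end Syn

end KappaCoherent
-- Distributivity and Frobenius in a κ-coherent category
namespace KappaCoherent

section

variable {C : Type u₁} [Category.{v₁} C]

theorem subobject_ext {Y : C} {R S : Subobject Y}
    (h : ∀ {X : C} (f : X ⟶ Y), R.Factors f ↔ S.Factors f) : R = S :=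
  le_antisymm ((le_iff_factors _ _).2 fun f => (h f).1) ((le_iff_factors _ _).2 fun f => (h f).2)

theorem factors_mk_iff {A W Y : C} {i : A ⟶ Y} [Mono i] {h : W ⟶ Y} :
    (Subobject.mk i).Factors h ↔ ∃ l : W ⟶ A, l ≫ i = h := Iff.rfl

/-- Quantification along `p` is left adjoint to pullback along `p`, by the universal property of the
image. -/
theorem isImageSubobject_arrow_comp_iff [HasFiniteLimits C] {X Y : C} (A : Subobject X) (p : X ⟶ Y)
    {I : Subobject Y} (h : IsImageSubobject (A.arrow ≫ p) I) (B : Subobject Y) :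
    I ≤ B ↔ A ≤ (Subobject.pullback p).obj B := by
  have e : B.Factors (A.arrow ≫ p) ↔ A ≤ (Subobject.pullback p).obj B := by
    rw [← pullback_factors_iff]
    exact ⟨Subobject.le_of_factors, fun h => Subobject.factors_of_le _ h (Subobject.factors_self A)⟩
  rw [← e]
  exact ⟨fun h' => Subobject.factors_of_le _ h' h.1, fun h' => h.2 h'⟩

/-- The Beck–Chevalley square: through it, quantification over `A` commutes with substitution along
`f`. -/
theorem isPullback_prod_snd [HasFiniteLimits C] (A : C) {X Y : C} (f : X ⟶ Y) :
    IsPullback (prod.lift prod.fst (prod.snd ≫ f) : A ⨯ X ⟶ A ⨯ Y) prod.snd prod.snd f := by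
  refine isPullback_of_exists (prod.lift_snd _ _)
    (fun a b h => ⟨prod.lift (a ≫ prod.fst) b, ?_, prod.lift_snd _ _⟩) fun m m' h1 h2 => ?_
  · refine prod.hom_ext ?_ ?_
    · rw [Category.assoc, prod.lift_fst, prod.lift_fst]
    · rw [Category.assoc, prod.lift_snd, prod.lift_snd_assoc, h]
  · refine prod.hom_ext ?_ h2
    have := h1 =≫ prod.fst
    rwa [Category.assoc, Category.assoc, prod.lift_fst] at this

/-- Intersecting with `A` amounts to restricting to the domain of `A`, which makes pullback
stability applicable to intersections. -/
theorem inf_le_iff_pullback_le [HasFiniteLimits C] {X : C} (A B W : Subobject X) :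
    A ⊓ B ≤ W ↔ (Subobject.pullback A.arrow).obj B ≤ (Subobject.pullback A.arrow).obj W := by
  simp only [le_iff_factors, Subobject.inf_factors, pullback_factors_iff]
  refine ⟨fun h X f hf => h _ ⟨Subobject.factors_comp_arrow f, hf⟩, fun h X f hf => ?_⟩
  have := h (A.factorThru f hf.1)
  rw [Subobject.factorThru_arrow] at this
  exact this hf.2

theorem inf_isLUB_le {κ : Cardinal.{u}} [HasFiniteLimits C] [KappaCoherentCategory κ C] {X : C}
    {ι : Type u} (hι : Cardinal.mk ι < κ) (A : Subobject X) {B : ι → Subobject X}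
    {U W : Subobject X} (hU : IsLUB (Set.range B) U) (h : ∀ i, A ⊓ B i ≤ W) : A ⊓ U ≤ W := by
  rw [inf_le_iff_pullback_le]
  refine (KappaCoherentCategory.union_pullback A.arrow hι B U hU).2 ?_
  rintro _ ⟨i, rfl⟩
  exact (inf_le_iff_pullback_le _ _ _).1 (h i)

/-- Restricted to `A`, the image of `p` becomes the image of the pullback of `p`, and minimality can
be used there. -/
theorem inf_image_le {κ : Cardinal.{u}} [HasFiniteLimits C] [KappaCoherentCategory κ C] {X Y : C}
    (A W : Subobject Y) {p : X ⟶ Y} {I : Subobject Y} (hI : IsImageSubobject p I)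
    (h : (Subobject.pullback p).obj A ≤ (Subobject.pullback p).obj W) : A ⊓ I ≤ W := by
  rw [inf_le_iff_pullback_le]
  have sq := IsPullback.of_hasPullback p A.arrow
  refine (KappaCoherentCategory.image_pullback (κ := κ) sq I hI).2 ?_
  rw [Set.mem_ofPred_eq, pullback_factors_iff, ← sq.w, ← pullback_factors_iff]
  refine Subobject.factors_of_le _ h ?_
  rw [pullback_factors_iff, sq.w]
  exact Subobject.factors_comp_arrow _

end

section Products

variable {C : Type u₁} [Category.{v₁} C] [HasFiniteLimits C] {S : Type u}

theorem comp_prodLift (M : S → C) {W X : C} {Γ : List S} (g : W ⟶ X)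
    (a : ∀ s, Var Γ s → (X ⟶ M s)) : g ≫ prodLift M a = prodLift M fun s v => g ≫ a s v :=
  prod_hom_ext M fun s v => by rw [Category.assoc, prodLift_proj, prodLift_proj]

end Products

/-! ### Substitution as pullback, and soundness -/

namespace Struct

variable {κ : Cardinal.{u}} {L : Signature.{u}} {C : Type u₁} [Category.{v₁} C]
  [HasFiniteLimits C] (M : Struct L C) {Γ Δ Θ Ξ : List L.Srt}

/-- The morphism `M(y⃗) ⟶ M(x⃗)` given by terms. -/
noncomputable def interpSubst (σ : Subst L Γ Δ) : prodObj M.obj Δ ⟶ prodObj M.obj Γ :=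
  prodLift M.obj fun s v => M.interpTerm (σ s v)

theorem interpSubst_proj (σ : Subst L Γ Δ) {s : L.Srt} (v : Var Γ s) :
    M.interpSubst σ ≫ prodProj M.obj v = M.interpTerm (σ s v) :=
  prodLift_proj _ _ _

theorem interpTerm_subst (σ : Subst L Γ Δ) {s : L.Srt} (t : Term L Γ s) :
    M.interpTerm (t.subst σ) = M.interpSubst σ ≫ M.interpTerm t := by
  induction t with
  | var v => exact (M.interpSubst_proj σ v).symm
  | app f ts ih =>
    simp only [Term.subst, interpTerm, ih]
    rw [← comp_prodLift, Category.assoc]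

theorem interpSubst_comp (σ : Subst L Γ Δ) (τ : Subst L Δ Θ) :
    M.interpSubst (σ.comp τ) = M.interpSubst τ ≫ M.interpSubst σ := by
  refine prod_hom_ext _ fun s v => ?_
  rw [Category.assoc, interpSubst_proj, interpSubst_proj]
  exact M.interpTerm_subst τ (σ s v)

theorem interpSubst_id (Γ : List L.Srt) : M.interpSubst (.id Γ) = 𝟙 _ :=
  prod_hom_ext _ fun s v => by rw [interpSubst_proj, Category.id_comp]; rfl

theorem interpSubst_wk (s : L.Srt) (Γ : List L.Srt) :
    M.interpSubst (.wk s Γ) = (prod.snd : M.obj s ⨯ prodObj M.obj Γ ⟶ _) :=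
  prod_hom_ext _ fun s v => by rw [interpSubst_proj]; rfl

theorem interpSubst_cons {s : L.Srt} (t : Term L Δ s) (σ : Subst L Γ Δ) :
    M.interpSubst (.cons t σ) = prod.lift (M.interpTerm t) (M.interpSubst σ) := rfl

theorem interpSubst_lift (s : L.Srt) (σ : Subst L Γ Δ) : M.interpSubst (.lift s σ) =
    prod.lift prod.fst ((prod.snd : M.obj s ⨯ prodObj M.obj Δ ⟶ _) ≫ M.interpSubst σ) := by
  rw [Subst.lift, interpSubst_cons, interpSubst_comp, interpSubst_wk]
  rfl

theorem isPullback_lift (s : L.Srt) (σ : Subst L Γ Δ) :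
    IsPullback (M.interpSubst (.lift s σ)) (prod.snd : M.obj s ⨯ prodObj M.obj Δ ⟶ _)
      (prod.snd : M.obj s ⨯ prodObj M.obj Γ ⟶ _) (M.interpSubst σ) := by
  rw [interpSubst_lift]
  exact isPullback_prod_snd _ _

variable [KappaCoherentCategory κ C]

theorem isLUB_interp_disj {I : Set κ.out} (hI : Cardinal.mk I < κ) (φ : I → Formula κ L Γ) :
    IsLUB (Set.range fun i => M.interp (φ i)) (M.interp (.disj I hI φ)) :=
  (KappaCoherentCategory.exists_union (κ := κ) hI fun i => M.interp (φ i)).choose_spec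

theorem isImageSubobject_interp_ex {s : L.Srt} (φ : Formula κ L (s :: Γ)) :
    IsImageSubobject
      ((M.interp φ).arrow ≫ (prod.snd : M.obj s ⨯ prodObj M.obj Γ ⟶ prodObj M.obj Γ))
      (M.interp (.ex s φ)) :=
  (KappaCoherentCategory.exists_image κ _).choose_spec

theorem interp_ex_le_iff {s : L.Srt} {φ : Formula κ L (s :: Γ)} {B : Subobject _} :
    M.interp (.ex s φ) ≤ B ↔
      M.interp φ ≤ (Subobject.pullback (M.interpSubst (.wk s Γ))).obj B := by
  rw [interpSubst_wk]
  exact isImageSubobject_arrow_comp_iff _ _ (M.isImageSubobject_interp_ex φ) B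

/-- For disjunctions and quantifiers, stability makes the pulled-back interpretation a union,
respectively an image, of the same data as the interpretation of the substituted formula; such
objects are unique. `Δ` is generalised because binders enlarge it. -/
theorem interp_subst (φ : Formula κ L Γ) (σ : Subst L Γ Δ) :
    M.interp (φ.subst σ) = (Subobject.pullback (M.interpSubst σ)).obj (M.interp φ) := by
  induction φ generalizing Δ with
  | rel p ts =>
    simp only [Formula.subst, interp]
    rw [← Subobject.pullback_comp, comp_prodLift]
    simp only [interpTerm_subst]
  | eq t t' =>
    simp only [Formula.subst, interp]
    refine subobject_ext fun f => ?_
    rw [pullback_factors_iff, equalizerSubobject_factors_iff, equalizerSubobject_factors_iff,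
      interpTerm_subst, interpTerm_subst, Category.assoc, Category.assoc]
  | top => exact (Subobject.pullback_top _).symm
  | and φ ψ ih ih' => simp only [Formula.subst, interp, ih, ih', Subobject.inf_pullback]
  | disj I hI φ ih =>
    refine (M.isLUB_interp_disj hI fun i => (φ i).subst σ).unique ?_
    simp only [ih]
    exact KappaCoherentCategory.union_pullback _ hI _ _ (M.isLUB_interp_disj hI φ)
  | ex s φ ih =>
    have h := M.isImageSubobject_interp_ex (φ.subst (σ.lift s))
    rw [ih] at h
    -- The square relating `φ` to its pullback is pasted onto the square of the bound variable.
    exact h.unique (KappaCoherentCategory.image_pullback (κ := κ)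
      ((Subobject.isPullback _ _).paste_vert (M.isPullback_lift s σ)) _
        (M.isImageSubobject_interp_ex φ))

theorem factors_interp_subst_iff {φ : Formula κ L Γ} {σ : Subst L Γ Δ} {W : C}
    {w : W ⟶ prodObj M.obj Δ} :
    (M.interp (φ.subst σ)).Factors w ↔ (M.interp φ).Factors (w ≫ M.interpSubst σ) := by
  rw [interp_subst, pullback_factors_iff]

theorem factors_interp_eq_iff {s : L.Srt} {t t' : Term L Γ s} {W : C}
    {w : W ⟶ prodObj M.obj Γ} : (M.interp (κ := κ) (.eq t t')).Factors w ↔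
      w ≫ M.interpTerm t = w ≫ M.interpTerm t' :=
  equalizerSubobject_factors_iff _ _ _

theorem factors_interp_and_iff {φ ψ : Formula κ L Γ} {W : C} {w : W ⟶ prodObj M.obj Γ} :
    (M.interp (.and φ ψ)).Factors w ↔ (M.interp φ).Factors w ∧ (M.interp ψ).Factors w :=
  Subobject.inf_factors _

theorem factors_interp_top {W : C} (w : W ⟶ prodObj M.obj Γ) :
    (M.interp (κ := κ) (.top)).Factors w :=
  Subobject.top_factors _

/-- Soundness of `κ`-coherent logic. -/
theorem interp_le_of_provable {T : Theory κ L} (hM : ∀ S ∈ T, M.Valid S) {φ ψ : Formula κ L Γ}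
    (h : Provable T φ ψ) : M.interp φ ≤ M.interp ψ := by
  induction h with
  | ax S hS => exact hM S hS
  | refl φ => exact le_rfl
  | cut _ _ ih ih' => exact ih.trans ih'
  | subst σ _ ih => rw [interp_subst, interp_subst]; exact (Subobject.pullback _).monotone ih
  | eq_refl t => exact (le_iff_factors _ _).2 fun w _ => M.factors_interp_eq_iff.2 rfl
  | eq_subst t t' φ =>
    refine (le_iff_factors _ _).2 fun w hw => ?_
    rw [factors_interp_and_iff, factors_interp_eq_iff, factors_interp_subst_iff,
      interpSubst_cons, prod.comp_lift] at hw
    rw [factors_interp_subst_iff, interpSubst_cons, prod.comp_lift, ← hw.1]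
    exact hw.2
  | top_intro φ => exact le_top
  | and_left φ ψ => exact inf_le_left
  | and_right φ ψ => exact inf_le_right
  | and_intro _ _ ih ih' => exact le_inf ih ih'
  | disj_intro I hI φ i => exact (M.isLUB_interp_disj hI φ).1 ⟨i, rfl⟩
  | disj_elim I hI φ ψ _ ih =>
    refine (M.isLUB_interp_disj hI φ).2 ?_
    rintro _ ⟨i, rfl⟩
    exact ih i
  | distrib I hI φ ψ =>
    exact inf_isLUB_le hI _ (M.isLUB_interp_disj hI ψ)
      fun i => (M.isLUB_interp_disj hI fun i => .and φ (ψ i)).1 ⟨i, rfl⟩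
  | ex_intro φ t =>
    -- The unit of the adjunction: `φ` entails the weakening of its own quantification.
    -- Instantiating at `t` cancels the weakening.
    have h := M.interp_ex_le_iff.1 (le_refl (M.interp (.ex _ φ)))
    refine (le_iff_factors _ _).2 fun w hw => ?_
    have := Subobject.factors_of_le _ h (M.factors_interp_subst_iff.1 hw)
    rwa [pullback_factors_iff, Category.assoc, ← interpSubst_comp, Subst.wk_cons, interpSubst_id,
      Category.comp_id] at this
  | ex_elim _ ih => rwa [interp_ex_le_iff, ← interp_subst]
  | frobenius φ ψ =>
    refine inf_image_le (κ := κ) _ _ (M.isImageSubobject_interp_ex ψ) ?_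
    -- What remains concerns elements of `ψ` whose projection satisfies `φ`; they satisfy the
    -- conjunction, so the unit of the adjunction applies.
    have h := M.interp_ex_le_iff.1
      (le_refl (M.interp (.ex _ (.and (φ.subst (.wk _ _)) ψ))))
    rw [interpSubst_wk, le_iff_factors] at h
    refine (le_iff_factors _ _).2 fun w hw => ?_
    rw [pullback_factors_iff, ← Category.assoc] at hw ⊢
    rw [← pullback_factors_iff]
    refine h _ (M.factors_interp_and_iff.2 ⟨?_, Subobject.factors_comp_arrow _⟩)
    rwa [factors_interp_subst_iff, interpSubst_wk]

end Struct

end KappaCoherent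
-- Blocks of variables in a structure
namespace KappaCoherent

theorem mapSubobject_mk {D : Type u₂} [Category.{v₂} D] {E : Type u₁} [Category.{v₁} E]
    (F : D ⥤ E) [PreservesFiniteLimits F] {A X : D} (i : A ⟶ X) [Mono i] :
    mapSubobject F (Subobject.mk i) = Subobject.mk (F.map i) := by
  refine Subobject.mk_eq_mk_of_comm _ _ (F.mapIso (Subobject.underlyingIso i)) ?_
  rw [Functor.mapIso_hom, ← Functor.map_comp, Subobject.underlyingIso_hom_comp_eq_mk]

section

variable {C : Type u₁} [Category.{v₁} C] [HasFiniteLimits C] {S : Type u}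

/-- The morphism to `M(x⃗, y⃗)` with the components `a` and `b`. -/
noncomputable def prodAppend (M : S → C) {W : C} : {Γ Δ : List S} →
    (a : W ⟶ prodObj M Γ) → (b : W ⟶ prodObj M Δ) → (W ⟶ prodObj M (Γ ++ Δ))
  | [], _, _, b => b
  | _ :: _, _, a, b => prod.lift (a ≫ prod.fst) (prodAppend M (a ≫ prod.snd) b)

theorem comp_prodAppend (M : S → C) {V W : C} {Γ Δ : List S} (g : V ⟶ W)
    (a : W ⟶ prodObj M Γ) (b : W ⟶ prodObj M Δ) :
    g ≫ prodAppend M a b = prodAppend M (g ≫ a) (g ≫ b) := by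
  induction Γ with
  | nil => rfl
  | cons s Γ ih =>
    refine (prod.comp_lift _ _ _).trans ?_
    rw [ih, ← Category.assoc, ← Category.assoc]
    rfl

end

namespace Struct

variable {κ : Cardinal.{u}} {L : Signature.{u}} {C : Type u₁} [Category.{v₁} C]
  [HasFiniteLimits C] (M : Struct L C) {Γ Δ Θ Ξ : List L.Srt}

theorem prodAppend_inl {W : C} (a : W ⟶ prodObj M.obj Γ) (b : W ⟶ prodObj M.obj Δ) :
    prodAppend M.obj a b ≫ M.interpSubst (.inl Γ Δ) = a := by
  induction Γ with
  | nil => exact terminal.hom_ext _ _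
  | cons s Γ ih =>
    rw [Subst.inl, interpSubst_cons, interpSubst_comp, interpSubst_wk]
    refine (prod.comp_lift _ _ _).trans (prod.hom_ext ?_ ?_)
    · rw [prod.lift_fst]
      exact prod.lift_fst _ _
    · rw [prod.lift_snd]
      refine Eq.trans ?_ (ih (a ≫ prod.snd))
      rw [← Category.assoc]
      exact congrArg (· ≫ _) (prod.lift_snd _ _)

theorem prodAppend_inr {W : C} (a : W ⟶ prodObj M.obj Γ) (b : W ⟶ prodObj M.obj Δ) :
    prodAppend M.obj a b ≫ M.interpSubst (.inr Γ Δ) = b := by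
  induction Γ with
  | nil =>
    rw [Subst.inr, interpSubst_id]
    exact Category.comp_id _
  | cons s Γ ih =>
    rw [Subst.inr, interpSubst_comp, interpSubst_wk]
    refine Eq.trans ?_ (ih (a ≫ prod.snd))
    rw [← Category.assoc]
    exact congrArg (· ≫ _) (prod.lift_snd _ _)

theorem interpSubst_append (σ : Subst L Γ Ξ) (τ : Subst L Δ Ξ) :
    M.interpSubst (.append σ τ) = prodAppend M.obj (M.interpSubst σ) (M.interpSubst τ) := by
  induction Γ with
  | nil => rfl
  | cons s Γ ih =>
    rw [Subst.append, interpSubst_cons, ih]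
    refine (congrArg₂ prod.lift ?_ (congrArg (prodAppend M.obj · _) ?_))
    · exact (prod.lift_fst _ _).symm
    · exact (prod.lift_snd _ _).symm

theorem prodAppend_eta {W : C} (w : W ⟶ prodObj M.obj (Γ ++ Δ)) :
    prodAppend M.obj (w ≫ M.interpSubst (.inl Γ Δ)) (w ≫ M.interpSubst (.inr Γ Δ)) = w := by
  rw [← comp_prodAppend, ← interpSubst_append, Subst.append_inl_inr, interpSubst_id,
    Category.comp_id]

variable [KappaCoherentCategory κ C]

theorem interp_exs_le_iff {Δ : List L.Srt} {φ : Formula κ L (Δ ++ Γ)} {B : Subobject _} :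
    M.interp (.exs Δ φ) ≤ B ↔
      M.interp φ ≤ (Subobject.pullback (M.interpSubst (.inr Δ Γ))).obj B := by
  induction Δ with
  | nil =>
    change M.interp φ ≤ B ↔ M.interp φ ≤ (Subobject.pullback (M.interpSubst (.id Γ))).obj B
    rw [interpSubst_id, Subobject.pullback_id]
  | cons s Δ ih =>
    refine (ih (φ := .ex s φ)).trans ?_
    rw [interp_ex_le_iff, ← Subobject.pullback_comp, ← interpSubst_comp]
    rfl

theorem factors_interp_eqs {Δ : List L.Srt} {σ τ : Subst L Δ Γ} {W : C}
    {w : W ⟶ prodObj M.obj Γ} (h : (M.interp (κ := κ) (.eqs σ τ)).Factors w) :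
    w ≫ M.interpSubst σ = w ≫ M.interpSubst τ := by
  induction Δ with
  | nil => exact terminal.hom_ext _ _
  | cons s Δ ih =>
    rw [Formula.eqs, factors_interp_and_iff, factors_interp_eq_iff] at h
    refine prod.hom_ext ?_ ?_
    · rw [Category.assoc, Category.assoc]
      exact (congrArg (w ≫ ·) (prod.lift_fst _ _)).trans
        (h.1.trans (congrArg (w ≫ ·) (prod.lift_fst _ _)).symm)
    · rw [Category.assoc, Category.assoc]
      exact (congrArg (w ≫ ·) (prod.lift_snd _ _)).trans
        ((ih h.2).trans (congrArg (w ≫ ·) (prod.lift_snd _ _)).symm)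

end Struct

/-! ## The functor given by a model -/

namespace Model

variable {κ : Cardinal.{u}} {L : Signature.{u}} {T : Theory κ L} {C : Type u₁} [Category.{v₁} C]
  [HasFiniteLimits C] [KappaCoherentCategory κ C] (M : Model T C) {Γ Δ Θ Ξ : List L.Srt}
  {X Y Z : Syn T} {V W : C}

open Syn

theorem factors_of_provable {φ ψ : Formula κ L Γ} (h : Provable T φ ψ)
    {w : W ⟶ prodObj M.str.obj Γ} (hw : (M.str.interp φ).Factors w) :
    (M.str.interp ψ).Factors w :=
  Subobject.factors_of_le _ (M.str.interp_le_of_provable M.valid h) hw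

/-- In the model `M`, the morphism `f` sends `x` to `y`. -/
def Sends (f : X ⟶ Y) (x : W ⟶ prodObj M.str.obj X.ctx) (y : W ⟶ prodObj M.str.obj Y.ctx) : Prop :=
  (M.str.interp (graph f)).Factors (prodAppend M.str.obj y x)

/-- Soundness in the form used below: a fact derived in the syntax is evaluated at a generalised
element `w` of its context. -/
theorem sends_of_sends {f : X ⟶ Y} {χ : Formula κ L Ξ} {x : Subst L X.ctx Ξ} {y : Subst L Y.ctx Ξ}
    (h : Syn.Sends χ f x y) {w : W ⟶ prodObj M.str.obj Ξ} (hw : (M.str.interp χ).Factors w) :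
    M.Sends f (w ≫ M.str.interpSubst x) (w ≫ M.str.interpSubst y) := by
  have := M.factors_of_provable h hw
  rwa [Struct.factors_interp_subst_iff, Struct.interpSubst_append, comp_prodAppend] at this

theorem sends_inl_inr {f : X ⟶ Y} {w : W ⟶ prodObj M.str.obj (Y.ctx ++ X.ctx)} :
    M.Sends f (w ≫ M.str.interpSubst (.inr _ _)) (w ≫ M.str.interpSubst (.inl _ _)) ↔
      (M.str.interp (graph f)).Factors w := by
  rw [Sends, Struct.prodAppend_eta]

variable {M}

theorem Sends.comp_left {f : X ⟶ Y} {x : W ⟶ prodObj M.str.obj X.ctx}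
    {y : W ⟶ prodObj M.str.obj Y.ctx} (h : M.Sends f x y) (g : V ⟶ W) :
    M.Sends f (g ≫ x) (g ≫ y) := by
  rw [Sends, ← comp_prodAppend]
  exact Subobject.factors_of_factors_right _ h

theorem Sends.dom {f : X ⟶ Y} {x : W ⟶ prodObj M.str.obj X.ctx}
    {y : W ⟶ prodObj M.str.obj Y.ctx} (h : M.Sends f x y) : (M.str.interp X.formula).Factors x := by
  have := M.factors_of_provable (sends_graph f).dom h
  rwa [Struct.factors_interp_subst_iff, Struct.prodAppend_inr] at this

theorem Sends.cod {f : X ⟶ Y} {x : W ⟶ prodObj M.str.obj X.ctx}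
    {y : W ⟶ prodObj M.str.obj Y.ctx} (h : M.Sends f x y) : (M.str.interp Y.formula).Factors y := by
  have := M.factors_of_provable (sends_graph f).cod h
  rwa [Struct.factors_interp_subst_iff, Struct.prodAppend_inl] at this

theorem Sends.uniq {f : X ⟶ Y} {x : W ⟶ prodObj M.str.obj X.ctx}
    {y y' : W ⟶ prodObj M.str.obj Y.ctx} (h : M.Sends f x y) (h' : M.Sends f x y') : y = y' := by
  have := M.factors_of_provable (isFunctional_graph f).unique
    (w := prodAppend M.str.obj y (prodAppend M.str.obj y' x)) (by
      rw [Struct.factors_interp_and_iff, Struct.factors_interp_subst_iff,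
        Struct.factors_interp_subst_iff, Struct.interpSubst_append, Struct.interpSubst_append,
        comp_prodAppend, comp_prodAppend, Struct.interpSubst_comp, Struct.interpSubst_comp,
        Struct.prodAppend_inl, ← Category.assoc, ← Category.assoc, Struct.prodAppend_inr,
        Struct.prodAppend_inl, Struct.prodAppend_inr]
      exact ⟨h, h'⟩)
  have := M.str.factors_interp_eqs this
  rwa [Struct.prodAppend_inl, Struct.interpSubst_comp, ← Category.assoc, Struct.prodAppend_inr,
    Struct.prodAppend_inl] at this

variable (M)

/-- Unique choice: by uniqueness the projection `p` of the graph to M(x⃗) is a monomorphism, so it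
is a subobject without passing to an image. Totality puts the interpretation of `X` below it, and an
element of `X` therefore lifts to the graph. -/
theorem exists_sends (f : X ⟶ Y) {x : W ⟶ prodObj M.str.obj X.ctx}
    (h : (M.str.interp X.formula).Factors x) : ∃ y, M.Sends f x y := by
  let p := (M.str.interp (graph f)).arrow ≫ M.str.interpSubst (.inr _ _)
  have hp {V : C} (a : V ⟶ _) : M.Sends f (a ≫ p)
      (a ≫ (M.str.interp (graph f)).arrow ≫ M.str.interpSubst (.inl _ _)) := by
    rw [← Category.assoc, ← Category.assoc, sends_inl_inr]
    exact Subobject.factors_comp_arrow _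
  have : Mono p := ⟨fun a b hab => by
    have ha := hp a
    rw [hab] at ha
    have e := ha.uniq (hp b)
    rw [← cancel_mono (M.str.interp (graph f)).arrow, ← M.str.prodAppend_eta (a ≫ _),
      ← M.str.prodAppend_eta (b ≫ _)]
    simp only [Category.assoc]
    exact congrArg₂ (prodAppend M.str.obj) e hab⟩
  have h1 : M.str.interp X.formula ≤ Subobject.mk p := by
    refine (M.str.interp_le_of_provable M.valid (isFunctional_graph f).total).trans ?_
    rw [Struct.interp_exs_le_iff]
    refine Subobject.le_of_factors ?_
    rw [pullback_factors_iff]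
    exact Subobject.mk_factors_self p
  obtain ⟨a, ha⟩ := Subobject.factors_of_le _ h1 h
  exact ⟨_, ha ▸ hp a⟩

theorem exists_mapSyn (f : X ⟶ Y) :
    ∃ h : (M.str.interp X.formula : C) ⟶ (M.str.interp Y.formula : C),
      M.Sends f (M.str.interp X.formula).arrow (h ≫ (M.str.interp Y.formula).arrow) := by
  obtain ⟨y, hy⟩ := M.exists_sends f (Subobject.factors_self (M.str.interp X.formula))
  exact ⟨Subobject.factorThru _ y hy.cod, by rwa [Subobject.factorThru_arrow]⟩

/-- The action on morphisms of the functor given by the model `M`. -/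
noncomputable def mapSyn (f : X ⟶ Y) :
    (M.str.interp X.formula : C) ⟶ (M.str.interp Y.formula : C) :=
  (M.exists_mapSyn f).choose

theorem sends_mapSyn (f : X ⟶ Y) : M.Sends f (M.str.interp X.formula).arrow
    (M.mapSyn f ≫ (M.str.interp Y.formula).arrow) :=
  (M.exists_mapSyn f).choose_spec

theorem mapSyn_comp_arrow {f : X ⟶ Y} {a : W ⟶ (M.str.interp X.formula : C)}
    {y : W ⟶ prodObj M.str.obj Y.ctx} (h : M.Sends f (a ≫ (M.str.interp X.formula).arrow) y) :
    a ≫ M.mapSyn f ≫ (M.str.interp Y.formula).arrow = y :=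
  ((M.sends_mapSyn f).comp_left a).uniq h

theorem mapSyn_eq {f : X ⟶ Y} {h : (M.str.interp X.formula : C) ⟶ (M.str.interp Y.formula : C)}
    (hh : M.Sends f (M.str.interp X.formula).arrow (h ≫ (M.str.interp Y.formula).arrow)) :
    M.mapSyn f = h := by
  rw [← cancel_mono (M.str.interp Y.formula).arrow]
  exact (M.sends_mapSyn f).uniq hh

theorem Sends.comp {f : X ⟶ Y} {g : Y ⟶ Z} {x : W ⟶ prodObj M.str.obj X.ctx}
    {y : W ⟶ prodObj M.str.obj Y.ctx} {z : W ⟶ prodObj M.str.obj Z.ctx} (h : M.Sends f x y)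
    (h' : M.Sends g y z) : M.Sends (f ≫ g) x z := by
  -- The composition is derived once in the generic context z⃗, y⃗, x⃗ and then evaluated at the
  -- given elements.
  have h1 : Syn.Sends (T := T)
      (.and ((graph f).subst (.append ((Subst.inl Y.ctx X.ctx).comp (.inr Z.ctx _))
          ((Subst.inr Y.ctx X.ctx).comp (.inr Z.ctx _))))
        ((graph g).subst (.append (.inl Z.ctx _) ((Subst.inl Y.ctx X.ctx).comp (.inr Z.ctx _)))))
      (f ≫ g) _ _ := Syn.Sends.comp (f := f) (g := g) (.and_left _ _) (.and_right _ _)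
  have := M.sends_of_sends h1 (w := prodAppend M.str.obj z (prodAppend M.str.obj y x)) (by
    rw [Struct.factors_interp_and_iff, Struct.factors_interp_subst_iff,
      Struct.factors_interp_subst_iff, Struct.interpSubst_append, Struct.interpSubst_append,
      comp_prodAppend, comp_prodAppend, Struct.interpSubst_comp, Struct.interpSubst_comp,
      Struct.prodAppend_inl, ← Category.assoc, ← Category.assoc, Struct.prodAppend_inr,
      Struct.prodAppend_inl, Struct.prodAppend_inr]
    exact ⟨h, h'⟩)
  rwa [Struct.prodAppend_inl, Struct.interpSubst_comp, ← Category.assoc, Struct.prodAppend_inr,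
    Struct.prodAppend_inr] at this

/-- The functor given by the model `M`. -/
noncomputable def synFunctor : Syn T ⥤ C where
  obj X := (M.str.interp X.formula : C)
  map f := M.mapSyn f
  map_id X := by
    refine M.mapSyn_eq ?_
    have := M.sends_of_sends (x := .id _) (y := .id _)
      (sends_id_iff.2 ⟨subst_id_refl X, fun _ _ => .eq_refl' _ _⟩)
      (Subobject.factors_self (M.str.interp X.formula))
    rw [Struct.interpSubst_id, Category.comp_id] at this
    rwa [Category.id_comp]
  map_comp f g := by
    refine M.mapSyn_eq ?_
    rw [Category.assoc]
    exact (M.sends_mapSyn f).comp M ((M.sends_mapSyn g).comp_left _)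

/-- The inclusion of the value at `φ(x⃗)` of the functor given by `M` into `M(x⃗)`. -/
noncomputable def synArrow (X : Syn T) : M.synFunctor.obj X ⟶ prodObj M.str.obj X.ctx :=
  (M.str.interp X.formula).arrow

instance (X : Syn T) : Mono (M.synArrow X) :=
  inferInstanceAs (Mono (M.str.interp X.formula).arrow)

theorem factors_synArrow {X : Syn T} (a : W ⟶ M.synFunctor.obj X) :
    (M.str.interp X.formula).Factors (a ≫ M.synArrow X) :=
  Subobject.factors_comp_arrow _

theorem exists_synArrow {X : Syn T} {x : W ⟶ prodObj M.str.obj X.ctx}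
    (h : (M.str.interp X.formula).Factors x) :
    ∃ a : W ⟶ M.synFunctor.obj X, a ≫ M.synArrow X = x :=
  ⟨Subobject.factorThru _ x h, Subobject.factorThru_arrow _ x h⟩

theorem sends_synArrow_iff {f : X ⟶ Y} {a : W ⟶ M.synFunctor.obj X}
    {y : W ⟶ prodObj M.str.obj Y.ctx} :
    M.Sends f (a ≫ M.synArrow X) y ↔ a ≫ M.synFunctor.map f ≫ M.synArrow Y = y :=
  ⟨M.mapSyn_comp_arrow, by rintro rfl; exact (M.sends_mapSyn f).comp_left a⟩

theorem synFunctor_map_ofSubst {σ : Subst L Y.ctx X.ctx}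
    {hσ : Provable T X.formula (Y.formula.subst σ)} :
    M.synFunctor.map (ofSubst σ hσ) ≫ M.synArrow Y = M.synArrow X ≫ M.str.interpSubst σ := by
  have := M.sends_of_sends (sends_ofSubst_self (hσ := hσ))
    (Subobject.factors_self (M.str.interp X.formula))
  rw [Struct.interpSubst_id] at this
  have h := (M.sends_synArrow_iff (a := 𝟙 _)).1 (by
    rw [Category.id_comp]; rwa [Category.comp_id] at this)
  rwa [Category.id_comp] at h

/-! ### The functor given by a model is `κ`-coherent -/

theorem preservesTerminal_synFunctor :
    PreservesLimit (Functor.empty.{0} (Syn T)) M.synFunctor := by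
  refine preservesLimit_of_preserves_limit_cone isTerminalTop
    ((isLimitMapConeEmptyConeEquiv _ _).symm ?_)
  have : IsIso (M.synArrow ⟨[], .top⟩) :=
    (Subobject.isIso_arrow_iff_eq_top _).2 rfl
  exact terminalIsTerminal.ofIso (asIso (M.synArrow ⟨[], .top⟩)).symm

/-- In generalised elements, the value at `pullbackObj f g` consists of triples (z, x, y) with f(x)
= z = g(y), and z is redundant. -/
theorem isPullback_synFunctor (f : X ⟶ Z) (g : Y ⟶ Z) :
    IsPullback (M.synFunctor.map (pullbackFst f g)) (M.synFunctor.map (pullbackSnd f g))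
      (M.synFunctor.map f) (M.synFunctor.map g) := by
  refine isPullback_of_exists ?_ (fun {W} a b h => ?_) fun {W} m m' h1 h2 => ?_
  · rw [← Functor.map_comp, ← Functor.map_comp, (isPullback_pullbackObj f g).w]
  · have ha := M.sends_synArrow_iff (f := f) (a := a).2 rfl
    have hb := M.sends_synArrow_iff (f := g) (a := b).2 rfl
    rw [← reassoc_of% h] at hb
    obtain ⟨z, hz⟩ : ∃ z, z = a ≫ M.synFunctor.map f ≫ M.synArrow Z := ⟨_, rfl⟩
    rw [← hz] at ha hb
    obtain ⟨l, hl⟩ := M.exists_synArrow (X := pullbackObj f g)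
      (x := prodAppend M.str.obj z
        (prodAppend M.str.obj (a ≫ M.synArrow X) (b ≫ M.synArrow Y))) (by
      rw [Struct.factors_interp_and_iff, Struct.factors_interp_subst_iff,
        Struct.factors_interp_subst_iff, Struct.interpSubst_append, Struct.interpSubst_append,
        comp_prodAppend, comp_prodAppend, Struct.interpSubst_comp, Struct.interpSubst_comp,
        Struct.prodAppend_inl, ← Category.assoc, ← Category.assoc, Struct.prodAppend_inr,
        Struct.prodAppend_inl, Struct.prodAppend_inr]
      exact ⟨ha, hb⟩)
    refine ⟨l, ?_, ?_⟩
    · rw [← cancel_mono (M.synArrow X), Category.assoc, pullbackFst, synFunctor_map_ofSubst,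
        reassoc_of% hl, Struct.interpSubst_comp, ← Category.assoc, Struct.prodAppend_inr,
        Struct.prodAppend_inl]
    · rw [← cancel_mono (M.synArrow Y), Category.assoc, pullbackSnd, synFunctor_map_ofSubst,
        reassoc_of% hl, Struct.interpSubst_comp, ← Category.assoc, Struct.prodAppend_inr,
        Struct.prodAppend_inr]
  · have h3 : m ≫ M.synFunctor.map (pullbackMid f g) = m' ≫ M.synFunctor.map (pullbackMid f g) := by
      rw [← pullbackFst_comp, Functor.map_comp, reassoc_of% h1]
    replace h1 := h1 =≫ M.synArrow X
    replace h2 := h2 =≫ M.synArrow Y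
    replace h3 := h3 =≫ M.synArrow Z
    rw [Category.assoc, Category.assoc, pullbackFst, synFunctor_map_ofSubst,
      Struct.interpSubst_comp, ← Category.assoc, ← Category.assoc, ← Category.assoc,
      ← Category.assoc] at h1
    rw [Category.assoc, Category.assoc, pullbackSnd, synFunctor_map_ofSubst,
      Struct.interpSubst_comp, ← Category.assoc, ← Category.assoc, ← Category.assoc,
      ← Category.assoc] at h2
    rw [Category.assoc, Category.assoc, pullbackMid, synFunctor_map_ofSubst, ← Category.assoc,
      ← Category.assoc] at h3
    rw [← cancel_mono (M.synArrow _), ← M.str.prodAppend_eta (m ≫ _),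
      ← M.str.prodAppend_eta (m' ≫ _), ← M.str.prodAppend_eta ((m ≫ _) ≫ _),
      ← M.str.prodAppend_eta ((m' ≫ _) ≫ _), h1, h2, h3]

instance : PreservesFiniteLimits M.synFunctor := by
  have := M.preservesTerminal_synFunctor
  have := preservesLimitsOfShape_pempty_of_preservesTerminal M.synFunctor
  have : PreservesLimitsOfShape WalkingCospan M.synFunctor := ⟨fun {K} => by
    have : PreservesLimit (cospan (K.map WalkingCospan.Hom.inl) (K.map WalkingCospan.Hom.inr))
        M.synFunctor :=
      preservesLimit_of_preserves_limit_cone (isPullback_pullbackObj _ _).isLimit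
        ((isLimitMapConePullbackConeEquiv _ (isPullback_pullbackObj _ _).w).symm
          (M.isPullback_synFunctor _ _).isLimit)
    exact preservesLimit_of_iso_diagram _ (diagramIsoCospan K).symm⟩
  exact preservesFiniteLimits_of_preservesTerminal_and_pullbacks _

/-- Inside M(y⃗), the subobject that the functor assigns to `A` is the interpretation of `A`.
Preservation of images and unions thus reduces to the universal properties that define `interp`. -/
theorem factors_mapSubobject_sub_iff {A : Formula κ L Y.ctx} {hA : Provable T A Y.formula}
    {h : W ⟶ M.synFunctor.obj Y} : (mapSubobject M.synFunctor (sub A hA)).Factors h ↔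
      (M.str.interp A).Factors (h ≫ M.synArrow Y) := by
  have e : M.synFunctor.map (incl A hA) ≫ M.synArrow Y = M.synArrow ⟨Y.ctx, A⟩ := by
    rw [incl, synFunctor_map_ofSubst]
    refine (congrArg (_ ≫ ·) (M.str.interpSubst_id _)).trans (Category.comp_id _)
  rw [sub, mapSubobject_mk, factors_mk_iff]
  constructor
  · rintro ⟨l, rfl⟩
    rw [Category.assoc, e]
    exact M.factors_synArrow l
  · intro hh
    obtain ⟨l, hl⟩ := M.exists_synArrow (X := ⟨Y.ctx, A⟩) hh
    refine ⟨l, ?_⟩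
    rw [← cancel_mono (M.synArrow Y), ← hl, ← e, ← Category.assoc]

theorem factors_mk_arrow_comp_iff (B : Subobject (M.synFunctor.obj Y))
    (h : W ⟶ M.synFunctor.obj Y) :
    (Subobject.mk (B.arrow ≫ M.synArrow Y)).Factors (h ≫ M.synArrow Y) ↔ B.Factors h := by
  rw [factors_mk_iff]
  constructor
  · rintro ⟨l, hl⟩
    rw [← Category.assoc, cancel_mono] at hl
    rw [← hl]
    exact Subobject.factors_comp_arrow l
  · intro hh
    exact ⟨B.factorThru h hh, by rw [Subobject.factorThru_arrow_assoc]⟩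

/-- A subobject of `φ(x⃗)` that is contained in another one may be compared with it in `M(x⃗)`. -/
theorem mapSubobject_sub_le {A : Formula κ L Y.ctx} {hA : Provable T A Y.formula}
    {B : Subobject (M.synFunctor.obj Y)}
    (h : M.str.interp A ≤ Subobject.mk (B.arrow ≫ M.synArrow Y)) :
    mapSubobject M.synFunctor (sub A hA) ≤ B :=
  (le_iff_factors _ _).2 fun f hf => (M.factors_mk_arrow_comp_iff B f).1
    (Subobject.factors_of_le _ h (M.factors_mapSubobject_sub_iff.1 hf))

theorem le_mk_of_mapSubobject_sub_le {A : Formula κ L Y.ctx} {hA : Provable T A Y.formula}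
    {B : Subobject (M.synFunctor.obj Y)} (h : mapSubobject M.synFunctor (sub A hA) ≤ B) :
    M.str.interp A ≤ Subobject.mk (B.arrow ≫ M.synArrow Y) := by
  refine (le_iff_factors _ _).2 fun f hf => ?_
  obtain ⟨l, rfl⟩ := M.exists_synArrow (M.factors_of_provable hA hf)
  rw [factors_mk_arrow_comp_iff]
  exact Subobject.factors_of_le _ h (M.factors_mapSubobject_sub_iff.2 hf)

instance : IsKappaCoherentFunctor κ M.synFunctor where
  map_image {X Y} f I hI := by
    obtain rfl := hI.unique (isImageSubobject_im f)
    refine ⟨?_, fun B hB => M.mapSubobject_sub_le ?_⟩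
    · rw [Set.mem_ofPred_eq, factors_mapSubobject_sub_iff]
      have h1 := (M.sends_synArrow_iff (f := f) (a := 𝟙 _)).2 rfl
      rw [Category.id_comp, Category.id_comp] at h1
      have h2 : Provable T (graph f) ((im f).subst (.inl _ _)) := im_intro (sends_graph f)
      have h3 := M.factors_of_provable h2 h1
      rwa [Struct.factors_interp_subst_iff, Struct.prodAppend_inl] at h3
    · rw [Syn.im, Struct.interp_exs_le_iff, le_iff_factors]
      intro W w hw
      rw [Struct.factors_interp_subst_iff, Struct.interpSubst_append, comp_prodAppend] at hw
      change M.Sends f _ _ at hw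
      -- An element of the graph is a pair whose first part is an element a of `X` and whose second
      -- part is the image of a under `f`; the latter lies in `B` because the functor's value at `f`
      -- factors through `B`.
      obtain ⟨a, ha⟩ := M.exists_synArrow hw.dom
      rw [← ha, sends_synArrow_iff] at hw
      rw [pullback_factors_iff, ← hw, ← Category.assoc, factors_mk_arrow_comp_iff]
      exact Subobject.factors_of_factors_right a hB
  map_union {Y} ι hι S U hU := by
    obtain ⟨I, hI, A, hA, h, e, he⟩ := exists_isLUB hι S
    rw [h] at hU
    obtain rfl := hU.unique (isLUB_disj (hI := hI) A hA)
    refine ⟨?_, fun B hB => M.mapSubobject_sub_le ?_⟩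
    · rintro _ ⟨i, rfl⟩
      obtain ⟨i, rfl⟩ := e.surjective i
      dsimp only
      rw [he, le_iff_factors]
      intro W f hf
      rw [factors_mapSubobject_sub_iff] at hf ⊢
      exact Subobject.factors_of_le _ ((M.str.isLUB_interp_disj hI A).1 ⟨i, rfl⟩) hf
    · refine (M.str.isLUB_interp_disj hI A).2 ?_
      rintro _ ⟨i, rfl⟩
      refine M.le_mk_of_mapSubobject_sub_le (hA := hA i) ?_
      rw [← he]
      exact hB ⟨e i, rfl⟩

end Model

end KappaCoherent
namespace KappaCoherent

namespace Syn

variable {κ : Cardinal.{u}} {L : Signature.{u}} {T : Theory κ L} {Γ Δ Θ : List L.Srt}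
  {X Y Z W : Syn T}

/-! ### Contexts as objects of the syntactic category -/

variable (T) in
/-- The formula `⊤` in the variables `Γ`. -/
abbrev ctxObj (Γ : List L.Srt) : Syn T := ⟨Γ, .top⟩

theorem provable_ctxObj_subst (χ : Formula κ L Γ) (σ : Subst L Δ Γ) :
    Provable T χ ((ctxObj T Δ).formula.subst σ) := .top_intro _

/-- The morphism to a context given by terms. -/
def toCtx (σ : Subst L Δ X.ctx) : X ⟶ ctxObj T Δ :=
  ofSubst (Y := ctxObj T Δ) σ (provable_ctxObj_subst _ _)

/-- The morphism of contexts given by terms. -/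
def termHom (σ : Subst L Δ Γ) : ctxObj T Γ ⟶ ctxObj T Δ := toCtx (X := ctxObj T Γ) σ

theorem ofSubst_eq_toCtx (σ : Subst L Δ X.ctx)
    (hσ : Provable T X.formula ((ctxObj T Δ).formula.subst σ)) :
    ofSubst (Y := ctxObj T Δ) σ hσ = toCtx σ := rfl

theorem toCtx_eq_iff {σ τ : Subst L Δ X.ctx} :
    toCtx σ = toCtx (T := T) τ ↔ ∀ s v, Provable T X.formula (.eq (σ s v) (τ s v)) :=
  ofSubst_eq_iff

theorem ofSubst_toCtx {σ : Subst L Y.ctx X.ctx}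
    {hσ : Provable T X.formula (Y.formula.subst σ)} (τ : Subst L Δ Y.ctx) :
    ofSubst σ hσ ≫ toCtx τ = toCtx (τ.comp σ) :=
  ofSubst_comp

theorem toCtx_termHom (σ : Subst L Δ X.ctx) (τ : Subst L Θ Δ) :
    toCtx σ ≫ termHom τ = toCtx (τ.comp σ) :=
  ofSubst_toCtx (Y := ctxObj T Δ) τ

theorem termHom_comp (σ : Subst L Δ Γ) (τ : Subst L Θ Δ) :
    termHom σ ≫ termHom τ = termHom (T := T) (τ.comp σ) :=
  toCtx_termHom (X := ctxObj T Γ) σ τ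

theorem termHom_id (Γ : List L.Srt) : termHom (T := T) (.id Γ) = 𝟙 _ :=
  (id_eq_ofSubst _).symm

/-- The substitution of a single term. -/
abbrev single {s : L.Srt} (t : Term L Γ s) : Subst L [s] Γ := .cons t nofun

theorem single_comp {s : L.Srt} (t : Term L Γ s) (σ : Subst L Γ Δ) :
    (single t).comp σ = single (t.subst σ) := by
  funext r v
  cases v with
  | head => rfl
  | tail v => cases v

variable (T) in
def varHom {s : L.Srt} (v : Var Γ s) : ctxObj T Γ ⟶ ctxObj T [s] := termHom (single (.var v))

theorem termHom_varHom (σ : Subst L Δ Γ) {s : L.Srt} (v : Var Δ s) :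
    termHom σ ≫ varHom T v = termHom (single (σ s v)) := by
  rw [varHom, termHom_comp, single_comp]
  rfl

/-- The product decomposition of a context, written as a pullback over the terminal object so that
`IsPullback.map` transports it along functors that preserve finite limits. -/
theorem isPullback_cons (s : L.Srt) (Γ : List L.Srt) :
    IsPullback (varHom T .head) (termHom (.wk s Γ))
      (isTerminalTop.from (ctxObj T [s])) (isTerminalTop.from (ctxObj T Γ)) := by
  refine isPullback_of_exists (isTerminalTop.hom_ext _ _) (fun {W} a b _ => ?_)
    fun {W} m m' h1 h2 => ?_
  · obtain ⟨W', σ, hσ, x, hx, y, hy, h1, h2, h3⟩ := exists_ofSubst₂ a b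
    rw [ofSubst_eq_toCtx] at h2 h3
    refine ⟨inv (ofSubst σ hσ) ≫ toCtx (.cons (x s .head) y), ?_, ?_⟩
    · rw [Category.assoc, IsIso.inv_comp_eq, h2, varHom, toCtx_termHom, toCtx_eq_iff]
      intro r v
      cases v with
      | head => exact .eq_refl' _ _
      | tail v => cases v
    · rw [Category.assoc, IsIso.inv_comp_eq, h3, toCtx_termHom, toCtx_eq_iff]
      exact fun _ _ => .eq_refl' _ _
  · obtain ⟨W', σ, hσ, x, hx, y, hy, h3, h4, h5⟩ := exists_ofSubst₂ m m'
    rw [ofSubst_eq_toCtx] at h4 h5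
    rw [← cancel_epi (ofSubst σ hσ), h4, h5, toCtx_eq_iff]
    replace h1 := congrArg (ofSubst σ hσ ≫ ·) h1
    replace h2 := congrArg (ofSubst σ hσ ≫ ·) h2
    simp only [← Category.assoc, h4, h5] at h1 h2
    rw [varHom, toCtx_termHom, toCtx_termHom, toCtx_eq_iff] at h1
    rw [toCtx_termHom, toCtx_termHom, toCtx_eq_iff] at h2
    intro r v
    cases v with
    | head => exact h1 _ .head
    | tail v => exact h2 _ v

/-- The inclusion of a formula in its context. -/
def inclTop (X : Syn T) : X ⟶ ctxObj T X.ctx := toCtx (.id X.ctx)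

instance (X : Syn T) : Mono (inclTop X) :=
  mono_incl (Y := ctxObj T X.ctx) X.formula (.top_intro _)

theorem inclTop_termHom (X : Syn T) (σ : Subst L Δ X.ctx) : inclTop X ≫ termHom σ = toCtx σ := by
  rw [inclTop, toCtx_termHom, Subst.comp_id]

theorem ofSubst_inclTop {σ : Subst L Y.ctx X.ctx}
    {hσ : Provable T X.formula (Y.formula.subst σ)} :
    ofSubst σ hσ ≫ inclTop Y = toCtx σ := by
  rw [inclTop, ofSubst_toCtx, Subst.id_comp]

theorem incl_inclTop (A : Formula κ L Y.ctx) (hA : Provable T A Y.formula) :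
    incl A hA ≫ inclTop Y = inclTop ⟨Y.ctx, A⟩ :=
  ofSubst_inclTop

/-- The subobject of a context given by a formula. -/
noncomputable abbrev subTop (φ : Formula κ L Γ) : Subobject (ctxObj T Γ) :=
  sub (Y := ctxObj T Γ) φ (.top_intro _)

theorem exists_lift_eq {s : L.Srt} {t t' : Term L Γ s} {W : Syn T} {k : W ⟶ ctxObj T Γ}
    (h : k ≫ termHom (single t) = k ≫ termHom (single t')) :
    ∃ l, l ≫ inclTop ⟨Γ, .eq t t'⟩ = k := by
  refine (factors_sub_iff (Y := ctxObj T Γ) (A := .eq t t') (hA := .top_intro _)).2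
    fun χ x y hy => ?_
  have h1 := hy.comp (sends_ofSubst (X := ctxObj T Γ) (Y := ctxObj T [s]) (σ := single t)
    (hσ := .top_intro _) hy.cod)
  have h2 := hy.comp (sends_ofSubst (X := ctxObj T Γ) (Y := ctxObj T [s]) (σ := single t')
    (hσ := .top_intro _) hy.cod)
  change Sends χ (k ≫ termHom (single t)) _ _ at h1
  rw [h] at h1
  exact h1.uniq h2 s .head

theorem termHom_single_eq {s : L.Srt} (t t' : Term L Γ s) :
    inclTop ⟨Γ, .eq t t'⟩ ≫ termHom (single t) =
      inclTop (T := T) ⟨Γ, .eq t t'⟩ ≫ termHom (single t') := by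
  rw [inclTop_termHom, inclTop_termHom, toCtx_eq_iff]
  intro r v
  cases v with
  | head => exact .refl _
  | tail v => cases v

noncomputable def isLimitFork_eq {s : L.Srt} (t t' : Term L Γ s) :
    IsLimit (Fork.ofι (inclTop (T := T) ⟨Γ, .eq t t'⟩) (termHom_single_eq t t')) :=
  Fork.IsLimit.ofExistsUnique fun k => by
    obtain ⟨l, hl⟩ := exists_lift_eq k.condition
    exact ⟨l, hl, fun l' hl' =>
      (cancel_mono (inclTop (T := T) ⟨Γ, .eq t t'⟩)).1 (hl'.trans hl.symm)⟩

/-- Together with `isLimitFork_eq`, `isLUB_disj` and `isImageSubobject_ex`, this describes the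
connectives by constructions that κ-coherent functors preserve, as the induction in
`exists_restrict` requires. -/
theorem isPullback_and (φ ψ : Formula κ L Γ) :
    IsPullback (incl (T := T) (Y := ⟨Γ, φ⟩) (.and φ ψ) (.and_left _ _))
      (incl (Y := ⟨Γ, ψ⟩) (.and φ ψ) (.and_right _ _)) (inclTop ⟨Γ, φ⟩) (inclTop ⟨Γ, ψ⟩) := by
  have e1 : incl (T := T) (Y := ⟨Γ, φ⟩) (.and φ ψ) (.and_left _ _) ≫ inclTop ⟨Γ, φ⟩ =
      inclTop ⟨Γ, .and φ ψ⟩ := incl_inclTop _ _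
  have e2 : incl (T := T) (Y := ⟨Γ, ψ⟩) (.and φ ψ) (.and_right _ _) ≫ inclTop ⟨Γ, ψ⟩ =
      inclTop ⟨Γ, .and φ ψ⟩ := incl_inclTop _ _
  refine isPullback_of_exists (e1.trans e2.symm) (fun {W} a b h => ?_) fun m m' h1 _ => ?_
  · have h1 : (subTop φ).Factors (a ≫ inclTop ⟨Γ, φ⟩) := ⟨a, rfl⟩
    have h2 : (subTop ψ).Factors (a ≫ inclTop ⟨Γ, φ⟩) := ⟨b, h.symm⟩
    have h3 : (subTop (.and φ ψ)).Factors (a ≫ inclTop ⟨Γ, φ⟩) :=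
      factors_sub_iff.2 fun χ x y hy =>
        .and_intro (factors_sub_iff.1 h1 χ x y hy) (factors_sub_iff.1 h2 χ x y hy)
    obtain ⟨l, hl⟩ := factors_mk_iff.1 h3
    change l ≫ inclTop ⟨Γ, .and φ ψ⟩ = _ at hl
    refine ⟨l, ?_, ?_⟩
    · rw [← cancel_mono (inclTop ⟨Γ, φ⟩), Category.assoc, e1, hl]
    · rw [← cancel_mono (inclTop ⟨Γ, ψ⟩), Category.assoc, e2, hl, h]
  · exact (cancel_mono _).1 h1

theorem provable_ex_wk {s : L.Srt} (φ : Formula κ L (s :: Γ)) :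
    Provable T φ ((Formula.ex s φ).subst (.wk s Γ)) := by
  have := Provable.ex_intro (T := T) (φ.subst (.lift s (.wk s Γ))) (.var .head)
  rw [Formula.subst_subst, Subst.lift_comp_cons, Subst.comp_id] at this
  have e : Subst.cons (.var .head) (.wk s Γ) = Subst.id (L := L) (s :: Γ) := Subst.cons_eta (.id _)
  rwa [e, Formula.subst_id] at this

/-- The introduction and elimination rules of ∃ are the two halves of the universal property of an
image. -/
theorem isImageSubobject_ex {s : L.Srt} (φ : Formula κ L (s :: Γ)) :
    IsImageSubobject (inclTop ⟨s :: Γ, φ⟩ ≫ termHom (.wk s Γ))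
      (subTop (T := T) (.ex s φ)) := by
  rw [inclTop_termHom]
  refine ⟨factors_sub_ofSubst_iff.2 (provable_ex_wk φ), fun S hS => ?_⟩
  obtain ⟨B, hB, rfl⟩ := exists_eq_sub S
  exact sub_le_sub_iff.2 (.ex_elim (factors_sub_ofSubst_iff.1 hS))

/-! ### Natural transformations between `κ`-coherent functors -/

section

variable {C : Type u₁} [Category.{v₁} C] {F G : Syn T ⥤ C}

/-- `G` turns a context into the product of its values at the sorts, one application of
`isPullback_cons` per variable. -/
theorem ctx_hom_ext [PreservesFiniteLimits G] {W : C} {m m' : W ⟶ G.obj (ctxObj T Γ)}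
    (h : ∀ s (v : Var Γ s), m ≫ G.map (varHom T v) = m' ≫ G.map (varHom T v)) : m = m' := by
  induction Γ with
  | nil => exact (isTerminalTop.isTerminalObj G).hom_ext _ _
  | cons s Γ ih =>
    refine ((isPullback_cons s Γ).map G).hom_ext (h s .head) (ih fun r v => ?_)
    rw [Category.assoc, Category.assoc, ← Functor.map_comp, termHom_varHom]
    exact h r v.tail

theorem exists_ctxMap [PreservesFiniteLimits G]
    (α : ∀ s, F.obj (ctxObj T [s]) ⟶ G.obj (ctxObj T [s])) (Γ : List L.Srt) :
    ∃ β : F.obj (ctxObj T Γ) ⟶ G.obj (ctxObj T Γ), ∀ s (v : Var Γ s),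
      β ≫ G.map (varHom T v) = F.map (varHom T v) ≫ α s := by
  induction Γ with
  | nil => exact ⟨(isTerminalTop.isTerminalObj G).from _, nofun⟩
  | cons s Γ ih =>
    obtain ⟨β, hβ⟩ := ih
    have sq := (isPullback_cons (T := T) s Γ).map G
    have w : (F.map (varHom T .head) ≫ α s) ≫ G.map (isTerminalTop.from _) =
        (F.map (termHom (.wk s Γ)) ≫ β) ≫ G.map (isTerminalTop.from _) :=
      (isTerminalTop.isTerminalObj G).hom_ext _ _
    refine ⟨sq.lift _ _ w, fun r v => ?_⟩
    cases v with
    | head => exact sq.lift_fst _ _ w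
    | tail v =>
      have e : varHom T v.tail = termHom (.wk s Γ) ≫ varHom T v := by
        rw [termHom_varHom]
        rfl
      rw [e, Functor.map_comp, Functor.map_comp, ← Category.assoc, sq.lift_snd, Category.assoc,
        hβ, Category.assoc]

/-- The extension to contexts of a family of morphisms defined on sorts. -/
noncomputable def ctxMap [PreservesFiniteLimits G]
    (α : ∀ s, F.obj (ctxObj T [s]) ⟶ G.obj (ctxObj T [s])) (Γ : List L.Srt) :
    F.obj (ctxObj T Γ) ⟶ G.obj (ctxObj T Γ) :=
  (exists_ctxMap α Γ).choose

theorem ctxMap_varHom [PreservesFiniteLimits G]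
    (α : ∀ s, F.obj (ctxObj T [s]) ⟶ G.obj (ctxObj T [s])) {s : L.Srt} (v : Var Γ s) :
    ctxMap α Γ ≫ G.map (varHom T v) = F.map (varHom T v) ≫ α s :=
  (exists_ctxMap α Γ).choose_spec s v

theorem varHom_head (s : L.Srt) : varHom T (.head : Var [s] s) = 𝟙 _ := by
  rw [← termHom_id]
  exact congrArg termHom (by
    funext r v
    cases v with
    | head => rfl
    | tail v => cases v)

theorem ctxMap_single [PreservesFiniteLimits G]
    (α : ∀ s, F.obj (ctxObj T [s]) ⟶ G.obj (ctxObj T [s])) (s : L.Srt) :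
    ctxMap α [s] = α s := by
  simpa [varHom_head] using ctxMap_varHom α (.head : Var [s] s)

variable (T) in
/-- The morphism given by an operation. -/
def opHom (f : L.Op) : ctxObj T (L.opDom f) ⟶ ctxObj T [L.opCod f] :=
  termHom (single (.app f fun _ v => .var v))

section

variable [PreservesFiniteLimits G] {α : ∀ s, F.obj (ctxObj T [s]) ⟶ G.obj (ctxObj T [s])}

theorem ctxMap_termHom_of (σ : Subst L Δ Γ)
    (h : ∀ s v, ctxMap α Γ ≫ G.map (termHom (single (σ s v))) =
      F.map (termHom (single (σ s v))) ≫ α s) :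
    ctxMap α Γ ≫ G.map (termHom σ) = F.map (termHom σ) ≫ ctxMap α Δ := by
  refine ctx_hom_ext fun s v => ?_
  rw [Category.assoc, Category.assoc, ctxMap_varHom, ← Functor.map_comp, ← Category.assoc,
    ← Functor.map_comp, termHom_varHom, h]

/-- A compound term is its operation precomposed with the block of its arguments, so compatibility
spreads from operations to all terms. -/
theorem ctxMap_term
    (hα : ∀ f, ctxMap α (L.opDom f) ≫ G.map (opHom T f) = F.map (opHom T f) ≫ α (L.opCod f))
    {s : L.Srt} (t : Term L Γ s) :
    ctxMap α Γ ≫ G.map (termHom (single t)) = F.map (termHom (single t)) ≫ α s := by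
  induction t with
  | var v => exact ctxMap_varHom α v
  | app f ts ih =>
    have e : termHom (T := T) (single (.app f ts)) = termHom ts ≫ opHom T f := by
      rw [opHom, termHom_comp, single_comp]
      rfl
    rw [e, Functor.map_comp, Functor.map_comp, Category.assoc, ← hα, ← Category.assoc,
      ctxMap_termHom_of ts ih, Category.assoc]

theorem ctxMap_termHom
    (hα : ∀ f, ctxMap α (L.opDom f) ≫ G.map (opHom T f) = F.map (opHom T f) ≫ α (L.opCod f))
    (σ : Subst L Δ Γ) :
    ctxMap α Γ ≫ G.map (termHom σ) = F.map (termHom σ) ≫ ctxMap α Δ :=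
  ctxMap_termHom_of σ fun _ _ => ctxMap_term hα _

end

end

end Syn

end KappaCoherent
-- Extending transformations from sorts to formulae
namespace KappaCoherent

namespace Syn

variable {κ : Cardinal.{u}} {L : Signature.{u}} {T : Theory κ L} {Γ Δ Θ : List L.Srt}
  {X Y Z W : Syn T} {C : Type u₁} [Category.{v₁} C] {F G : Syn T ⥤ C}

theorem mapSubobject_subTop [PreservesFiniteLimits G] (φ : Formula κ L Γ) :
    mapSubobject G (subTop φ) = Subobject.mk (G.map (inclTop (T := T) ⟨Γ, φ⟩)) :=
  mapSubobject_mk G (inclTop (T := T) ⟨Γ, φ⟩)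

/-- A family of morphisms on the sorts that commutes with the operations restricts to all formulae,
if there are no predicates. -/
theorem exists_restrict [IsEmpty L.Pred] [HasPullbacks C] [IsKappaCoherentFunctor κ F]
    [IsKappaCoherentFunctor κ G] {α : ∀ s, F.obj (ctxObj T [s]) ⟶ G.obj (ctxObj T [s])}
    (hα : ∀ f, ctxMap α (L.opDom f) ≫ G.map (opHom T f) = F.map (opHom T f) ≫ α (L.opCod f))
    (φ : Formula κ L Γ) : ∃ a, a ≫ G.map (inclTop (T := T) ⟨Γ, φ⟩) =
      F.map (inclTop (T := T) ⟨Γ, φ⟩) ≫ ctxMap α Γ := by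
  induction φ with
  | rel p ts => exact (IsEmpty.false p).elim
  | @eq Γ s t t' =>
    have l := isLimitForkMapOfIsLimit G (termHom_single_eq t t') (isLimitFork_eq t t')
    have h : (F.map (inclTop (T := T) ⟨Γ, .eq t t'⟩) ≫ ctxMap α Γ) ≫ G.map (termHom (single t)) =
        (F.map (inclTop (T := T) ⟨Γ, .eq t t'⟩) ≫ ctxMap α Γ) ≫ G.map (termHom (single t')) := by
      rw [Category.assoc, Category.assoc, ctxMap_term hα, ctxMap_term hα, ← Category.assoc,
        ← Category.assoc, ← Functor.map_comp, ← Functor.map_comp, termHom_single_eq]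
    exact ⟨(Fork.IsLimit.lift' l _ h).1, (Fork.IsLimit.lift' l _ h).2⟩
  | @top Γ =>
    have e : inclTop (T := T) ⟨Γ, .top⟩ = 𝟙 _ := termHom_id Γ
    exact ⟨ctxMap α Γ, by
      rw [e, CategoryTheory.Functor.map_id, CategoryTheory.Functor.map_id, Category.id_comp]
      exact Category.comp_id _⟩
  | @and Γ φ ψ ih ih' =>
    obtain ⟨a, ha⟩ := ih
    obtain ⟨b, hb⟩ := ih'
    have sq := (isPullback_and (T := T) φ ψ).map G
    have e1 : incl (T := T) (Y := ⟨Γ, φ⟩) (.and φ ψ) (.and_left _ _) ≫ inclTop ⟨Γ, φ⟩ =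
        inclTop ⟨Γ, .and φ ψ⟩ := incl_inclTop _ _
    have e2 : incl (T := T) (Y := ⟨Γ, ψ⟩) (.and φ ψ) (.and_right _ _) ≫ inclTop ⟨Γ, ψ⟩ =
        inclTop ⟨Γ, .and φ ψ⟩ := incl_inclTop _ _
    have w : (F.map (incl (T := T) (Y := ⟨Γ, φ⟩) (.and φ ψ) (.and_left _ _)) ≫ a) ≫
          G.map (inclTop ⟨Γ, φ⟩) =
        (F.map (incl (T := T) (Y := ⟨Γ, ψ⟩) (.and φ ψ) (.and_right _ _)) ≫ b) ≫
          G.map (inclTop ⟨Γ, ψ⟩) := by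
      rw [Category.assoc, Category.assoc, ha, hb, ← Category.assoc, ← Category.assoc,
        ← Functor.map_comp, ← Functor.map_comp, e1, e2]
    refine ⟨sq.lift _ _ w, ?_⟩
    rw [← e1, Functor.map_comp, ← Category.assoc, sq.lift_fst, Category.assoc, ha,
      Functor.map_comp, Category.assoc]
  | @disj Γ I hI φ ih =>
    have h1 := IsKappaCoherentFunctor.map_union (F := F) hI _ _
      (isLUB_disj (T := T) (Y := ctxObj T Γ) (hI := hI) φ fun _ => .top_intro _)
    -- Preservation of the union by `F` reduces the claim to single disjuncts; on the side of `G` it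
    -- is enough that each disjunct entails the disjunction.
    have h2 : mapSubobject F (subTop (T := T) (.disj I hI φ)) ≤
        (Subobject.pullback (ctxMap α Γ)).obj (mapSubobject G (subTop (.disj I hI φ))) := by
      refine h1.2 ?_
      rintro _ ⟨i, rfl⟩
      change mapSubobject F (subTop (φ i)) ≤ _
      rw [mapSubobject_subTop, mk_le_iff_factors, pullback_factors_iff]
      obtain ⟨a, ha⟩ := ih i
      have e : incl (T := T) (Y := ⟨Γ, .disj I hI φ⟩) (φ i) (.disj_intro I hI φ i) ≫
        inclTop ⟨Γ, .disj I hI φ⟩ = inclTop ⟨Γ, φ i⟩ := incl_inclTop _ _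
      rw [← ha, mapSubobject_subTop, factors_mk_iff, ← e, Functor.map_comp]
      exact ⟨_, Category.assoc _ _ _⟩
    rwa [mapSubobject_subTop, mk_le_iff_factors, pullback_factors_iff, mapSubobject_subTop,
      factors_mk_iff] at h2
  | @ex Γ s φ ih =>
    have h1 := IsKappaCoherentFunctor.map_image (κ := κ) (F := F) _ _
      (isImageSubobject_ex (T := T) φ)
    -- Likewise for ∃: `F` preserves the image, so it suffices to follow the restriction to `φ`
    -- along the projection that forgets the bound variable, with which `ctxMap` commutes.
    have h2 : mapSubobject F (subTop (T := T) (.ex s φ)) ≤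
        (Subobject.pullback (ctxMap α Γ)).obj (mapSubobject G (subTop (.ex s φ))) := by
      refine h1.2 ?_
      rw [Set.mem_ofPred_eq, pullback_factors_iff]
      obtain ⟨a, ha⟩ := ih
      obtain ⟨b, hb⟩ := factors_mk_iff.1 (isImageSubobject_ex (T := T) φ).1
      change b ≫ inclTop ⟨Γ, .ex s φ⟩ = _ at hb
      rw [Functor.map_comp, Category.assoc, ← ctxMap_termHom hα, ← Category.assoc, ← ha,
        Category.assoc, ← Functor.map_comp, ← hb, mapSubobject_subTop, factors_mk_iff,
        Functor.map_comp]
      exact ⟨_, Category.assoc _ _ _⟩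
    rwa [mapSubobject_subTop, mk_le_iff_factors, pullback_factors_iff, mapSubobject_subTop,
      factors_mk_iff] at h2

/-- A family of morphisms on the sorts that commutes with the operations extends to a natural
transformation, if there are no predicates. -/
theorem exists_natTrans [IsEmpty L.Pred] [HasPullbacks C] [IsKappaCoherentFunctor κ F]
    [IsKappaCoherentFunctor κ G] {α : ∀ s, F.obj (ctxObj T [s]) ⟶ G.obj (ctxObj T [s])}
    (hα : ∀ f, ctxMap α (L.opDom f) ≫ G.map (opHom T f) = F.map (opHom T f) ≫ α (L.opCod f)) :
    ∃ η : F ⟶ G, ∀ s, η.app (ctxObj T [s]) = α s := by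
  have h (X : Syn T) : ∃ a : F.obj X ⟶ G.obj X,
      a ≫ G.map (inclTop X) = F.map (inclTop X) ≫ ctxMap α X.ctx := exists_restrict hα X.formula
  choose a ha using h
  -- Naturality along terms can be tested in the context of `Y`, since `G` keeps the inclusion of
  -- `Y` in its context monic.
  have hterm {X Y : Syn T} (σ : Subst L Y.ctx X.ctx)
      (hσ : Provable T X.formula (Y.formula.subst σ)) :
      F.map (ofSubst σ hσ) ≫ a Y = a X ≫ G.map (ofSubst σ hσ) := by
    have e : ofSubst σ hσ ≫ inclTop Y = inclTop X ≫ termHom σ := by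
      rw [ofSubst_inclTop, inclTop_termHom]
    rw [← cancel_mono (G.map (inclTop Y)), Category.assoc, Category.assoc, ha, ← Functor.map_comp,
      e, Functor.map_comp, reassoc_of% ha X, ctxMap_termHom hα, ← Functor.map_comp_assoc, e,
      Functor.map_comp, Category.assoc]
  refine ⟨{ app := a, naturality := fun X Y f => ?_ }, fun s => ?_⟩
  -- An isomorphism given by terms makes `f` a term morphism, so its naturality square follows from
  -- two squares for terms.
  · obtain ⟨W, σ, hσ, τ, hτ, h1, h2⟩ := exists_ofSubst f
    rw [← cancel_epi (F.map (ofSubst σ hσ)), ← Functor.map_comp_assoc, h2, hterm, ← h2,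
      Functor.map_comp, ← Category.assoc, ← hterm, Category.assoc]
  · have := ha (ctxObj T [s])
    have e : inclTop (ctxObj T [s]) = 𝟙 _ := termHom_id [s]
    rwa [e, CategoryTheory.Functor.map_id, CategoryTheory.Functor.map_id, Category.id_comp,
      Category.comp_id, ctxMap_single] at this

/-- Natural transformations into a functor that preserves finite limits are determined by their
components at the sorts. -/
theorem natTrans_ext [PreservesFiniteLimits G] {η θ : F ⟶ G}
    (h : ∀ s, η.app (ctxObj T [s]) = θ.app (ctxObj T [s])) : η = θ := by
  ext X
  rw [← cancel_mono (G.map (inclTop X))]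
  refine ctx_hom_ext fun s v => ?_
  rw [Category.assoc, Category.assoc, ← Functor.map_comp, ← η.naturality, ← θ.naturality, h]

end Syn

end KappaCoherent
namespace KappaCoherent

/-! ## The theory of a schema -/

section

variable {C : Type u₁} [Category.{v₁} C] [HasFiniteLimits C]

/-- A context with one variable is interpreted as `A ⨯ ⊤_ C` rather than `A`. This isomorphism
mediates between unary operations and morphisms of `C`. -/
instance isIso_prod_fst_terminal (A : C) : IsIso (prod.fst : A ⨯ ⊤_ C ⟶ A) :=
  ⟨prod.lift (𝟙 A) (terminal.from A), by
    refine prod.hom_ext ?_ (terminal.hom_ext _ _)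
    rw [Category.assoc, prod.lift_fst, Category.comp_id, Category.id_comp], prod.lift_fst _ _⟩

theorem prodMap_fst {S : Type u} {M N : S → C} (α : ∀ s, M s ⟶ N s) (X : S) :
    prodMap α [X] ≫ (prod.fst : N X ⨯ ⊤_ C ⟶ N X) = (prod.fst : M X ⨯ ⊤_ C ⟶ M X) ≫ α X :=
  prod.lift_fst _ _

end

section

variable {κ : Cardinal.{u}} {L : Signature.{u}} {C : Type u₁} [Category.{v₁} C]
  [HasFiniteLimits C] [KappaCoherentCategory κ C]

theorem Struct.valid_eq_iff (M : Struct L C) {Γ : List L.Srt} {s : L.Srt} (t t' : Term L Γ s) :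
    M.Valid (κ := κ) ⟨Γ, .top, .eq t t'⟩ ↔ M.interpTerm t = M.interpTerm t' := by
  constructor
  · intro h
    have h1 := Subobject.factors_of_le _ h (M.factors_interp_top (κ := κ) (𝟙 _))
    rwa [M.factors_interp_eq_iff, Category.id_comp, Category.id_comp] at h1
  · intro h
    refine (le_iff_factors _ _).2 fun w _ => M.factors_interp_eq_iff.2 ?_
    rw [h]

end

section

variable {D : Type u} [SmallCategory D] {C : Type u₁} [Category.{v₁} C] [HasFiniteLimits C]

/-- The morphism that interprets a unary operation. -/
noncomputable def schUnary (M : Struct (schSignature D) C) {X Y : D} (f : X ⟶ Y) :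
    M.obj X ⟶ M.obj Y :=
  inv (prod.fst : M.obj X ⨯ ⊤_ C ⟶ M.obj X) ≫ M.op ⟨X, Y, f⟩

theorem fst_schUnary (M : Struct (schSignature D) C) {X Y : D} (f : X ⟶ Y) :
    (prod.fst : M.obj X ⨯ ⊤_ C ⟶ M.obj X) ≫ schUnary M f = M.op ⟨X, Y, f⟩ :=
  IsIso.hom_inv_id_assoc _ _

theorem schUnary_schStruct (F : D ⥤ C) {X Y : D} (f : X ⟶ Y) :
    schUnary (schStruct F) f = F.map f :=
  IsIso.inv_hom_id_assoc _ _

theorem interpTerm_schApp (M : Struct (schSignature D) C) {Γ : List D} {X Y : D} (f : X ⟶ Y)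
    (t : Term (schSignature D) Γ X) :
    M.interpTerm (schApp f t) = M.interpTerm t ≫ schUnary M f := by
  have e : M.interpTerm (schApp f t) =
    prodLift M.obj (Γ := [X]) (fun s v => M.interpTerm (match v with | .head => t)) ≫
      M.op ⟨X, Y, f⟩ := rfl
  rw [e, ← fst_schUnary, ← Category.assoc]
  exact congrArg (· ≫ schUnary M f) (prod.lift_fst _ _)

theorem interpTerm_schVar (M : Struct (schSignature D) C) (X : D) :
    M.interpTerm (schVar X) = (prod.fst : M.obj X ⨯ ⊤_ C ⟶ M.obj X) := rfl

/-- Both sides of each axiom begin with the isomorphism `prod.fst`; cancelling it leaves the functor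
laws for `schUnary`. -/
theorem forall_valid_sch_iff {κ : Cardinal.{u}} [KappaCoherentCategory κ C]
    (M : Struct (schSignature D) C) : (∀ S ∈ Sch κ D, M.Valid S) ↔
      (∀ X : D, schUnary M (𝟙 X) = 𝟙 _) ∧ ∀ {X Y Z : D} (f : X ⟶ Y) (g : Y ⟶ Z),
        schUnary M (f ≫ g) = schUnary M f ≫ schUnary M g := by
  have hid (X : D) : M.Valid (κ := κ) ⟨[X], .top, .eq (s := X) (schApp (𝟙 X) (schVar X))
      (schVar X)⟩ ↔ schUnary M (𝟙 X) = 𝟙 _ := by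
    rw [Struct.valid_eq_iff, interpTerm_schApp, interpTerm_schVar]
    exact (cancel_epi_id (prod.fst : M.obj X ⨯ ⊤_ C ⟶ M.obj X))
  have hcomp {X Y Z : D} (f : X ⟶ Y) (g : Y ⟶ Z) : M.Valid (κ := κ) ⟨[X], .top,
      .eq (s := Z) (schApp g (schApp f (schVar X))) (schApp (f ≫ g) (schVar X))⟩ ↔
        schUnary M (f ≫ g) = schUnary M f ≫ schUnary M g := by
    rw [Struct.valid_eq_iff, interpTerm_schApp, interpTerm_schApp, interpTerm_schApp,
      interpTerm_schVar, Category.assoc]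
    exact (cancel_epi (prod.fst : M.obj X ⨯ ⊤_ C ⟶ M.obj X)).trans eq_comm
  constructor
  · exact fun h => ⟨fun X => (hid X).1 (h _ (.id X)), fun f g => (hcomp f g).1 (h _ (.comp f g))⟩
  · rintro ⟨h1, h2⟩ _ (⟨f, g⟩ | X)
    · exact (hcomp f g).2 (h2 f g)
    · exact (hid X).2 (h1 X)

variable (κ : Cardinal.{u}) [KappaCoherentCategory κ C]

/-- The model of `Sch(D)` given by a functor. -/
noncomputable def schModel (F : D ⥤ C) : Model (Sch κ D) C where
  str := schStruct F
  valid := (forall_valid_sch_iff _).2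
    ⟨fun X => (schUnary_schStruct F _).trans (F.map_id X), fun f g =>
      (schUnary_schStruct F _).trans ((F.map_comp f g).trans
        (congrArg₂ (· ≫ ·) (schUnary_schStruct F f) (schUnary_schStruct F g)).symm)⟩

variable {κ} in
/-- The functor given by a model of `Sch(D)`. -/
noncomputable def schFunctor (M : Model (Sch κ D) C) : D ⥤ C where
  obj := M.str.obj
  map f := schUnary M.str f
  map_id := ((forall_valid_sch_iff _).1 M.valid).1
  map_comp := ((forall_valid_sch_iff _).1 M.valid).2

theorem schFunctor_schModel (F : D ⥤ C) : schFunctor (schModel κ F) = F :=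
  Functor.hext (fun _ => rfl) fun _ _ f => heq_of_eq (schUnary_schStruct F f)

/-- A strict equality is possible because a signature without predicates leaves no choice for `rel`,
and each operation is recovered exactly by `fst_schUnary`. -/
theorem schModel_schFunctor (M : Model (Sch κ D) C) : schModel κ (schFunctor M) = M := by
  obtain ⟨⟨obj, rel, op⟩, valid⟩ := M
  have h : schStruct (schFunctor ⟨⟨obj, rel, op⟩, valid⟩) = ⟨obj, rel, op⟩ := by
    have h1 : (schStruct (schFunctor ⟨⟨obj, rel, op⟩, valid⟩)).rel = rel :=
      funext fun p => p.elim
    have h2 : (schStruct (schFunctor ⟨⟨obj, rel, op⟩, valid⟩)).op = op :=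
      funext fun ⟨X, Y, f⟩ => fst_schUnary ⟨obj, rel, op⟩ f
    exact congrArg₂ (Struct.mk obj) h1 h2
  simp only [schModel, h]

variable (D C) in
/-- Functors `D ⥤ C` as models of `Sch(D)`. -/
noncomputable def schModelFunctor : (D ⥤ C) ⥤ Model (Sch κ D) C where
  obj F := schModel κ F
  map {F G} α :=
    { app := fun X => α.app X
      op := fun f => by
        change (prod.fst ≫ F.map f.2.2) ≫ α.app f.2.1 = prodMap (fun X => α.app X) [f.1] ≫
          prod.fst ≫ G.map f.2.2
        rw [Category.assoc, α.naturality, ← Category.assoc, ← Category.assoc]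
        exact congrArg (· ≫ _) (prodMap_fst (fun X => α.app X) f.1).symm
      rel := nofun }
  map_id F := rfl
  map_comp α β := rfl

theorem schModelFunctor_obj_bijective : Function.Bijective (schModelFunctor D C κ).obj :=
  ⟨Function.LeftInverse.injective (schFunctor_schModel κ),
    Function.RightInverse.surjective (schModel_schFunctor κ)⟩

instance : (schModelFunctor D C κ).Faithful where
  map_injective {F G α β} h := by
    ext X
    exact congrFun (congrArg Model.Hom.app h) X

/-- The naturality square in terms of unary operations. -/
theorem naturality_of_op {F G : D ⥤ C} {α : ∀ X, F.obj X ⟶ G.obj X} {X Y : D} {f : X ⟶ Y}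
    (h : ((prod.fst : F.obj X ⨯ ⊤_ C ⟶ F.obj X) ≫ F.map f) ≫ α Y =
      prodMap α [X] ≫ (prod.fst : G.obj X ⨯ ⊤_ C ⟶ G.obj X) ≫ G.map f) :
    F.map f ≫ α Y = α X ≫ G.map f := by
  rw [← cancel_epi (prod.fst : F.obj X ⨯ ⊤_ C ⟶ F.obj X), ← Category.assoc, h, ← Category.assoc,
    ← Category.assoc]
  exact congrArg (· ≫ G.map f) (prodMap_fst α X)

instance : (schModelFunctor D C κ).Full where
  map_surjective β :=
    ⟨{ app := fun X => Model.Hom.app β X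
       naturality := fun X Y f => naturality_of_op (α := fun X => Model.Hom.app β X)
        (Model.Hom.op β ⟨X, Y, f⟩) }, rfl⟩

instance : (schModelFunctor D C κ).EssSurj where
  mem_essImage M := by
    obtain ⟨F, rfl⟩ := (schModelFunctor_obj_bijective κ).2 M
    exact (schModelFunctor D C κ).obj_mem_essImage F

instance : (schModelFunctor D C κ).IsEquivalence where

end

/-! ## Functors on the syntactic category of a schema -/

section

variable (D : Type u) [SmallCategory D] (κ : Cardinal.{u})

open Syn

variable {D} in
theorem schApp_subst {X Y : D} (f : X ⟶ Y) {Γ Δ : List D} (t : Term (schSignature D) Γ X)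
    (σ : Subst (schSignature D) Γ Δ) : (schApp f t).subst σ = schApp f (t.subst σ) :=
  congrArg (Term.app (L := schSignature D) ⟨X, Y, f⟩) (by
    funext s v
    cases v with
    | head => rfl
    | tail v => cases v)

/-- The generic model of `Sch(D)`. -/
def schGeneric : D ⥤ Syn (Sch κ D) where
  obj X := ctxObj (Sch κ D) [X]
  map f := termHom (L := schSignature D) (single (schApp f (schVar _)))
  map_id X := by
    rw [← termHom_id]
    refine toCtx_eq_iff.2 fun s v => ?_
    cases v with
    | head => exact .ax _ (SchAxiom.id X)
    | tail v => cases v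
  map_comp {X Y Z} f g := by
    rw [termHom_comp]
    refine toCtx_eq_iff.2 fun s v => ?_
    cases v with
    | head =>
      have e : (schApp g (schVar Y)).subst (single (schApp f (schVar X))) =
          schApp g (schApp f (schVar X)) := schApp_subst g _ _
      change Provable _ .top (.eq _ ((schApp g (schVar Y)).subst (single (schApp f (schVar X)))))
      rw [e]
      exact (Provable.ax _ (SchAxiom.comp (κ := κ) f g)).eq_symm
    | tail v => cases v

variable (C : Type u₁) [Category.{v₁} C]

/-- Restriction of `κ`-coherent functors on `Syn(Sch(D))` along the generic model. -/
def schRestrict : Coh κ (Syn (Sch κ D)) C ⥤ D ⥤ C :=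
  ObjectProperty.ι _ ⋙ (Functor.whiskeringLeft D (Syn (Sch κ D)) C).obj (schGeneric D κ)

instance : (schRestrict D κ C).Faithful where
  map_injective {F G α β} h := by
    have := F.property
    have := G.property
    refine ObjectProperty.hom_ext _ (natTrans_ext fun s => ?_)
    exact congrArg (fun η => NatTrans.app η s) h

theorem opHom_sch {X Y : D} (f : X ⟶ Y) :
    opHom (L := schSignature D) (Sch κ D) ⟨X, Y, f⟩ = (schGeneric D κ).map f := by
  have e : Term.app (L := schSignature D) ⟨X, Y, f⟩ (fun _ v => .var v) = schApp f (schVar X) :=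
    congrArg (Term.app (L := schSignature D) ⟨X, Y, f⟩) (by
      funext s v
      cases v with
      | head => rfl
      | tail v => cases v)
  exact congrArg (fun t => termHom (T := Sch κ D) (single t)) e

variable [HasFiniteLimits C]

/-- Naturality over `D` is exactly compatibility with the operations of the signature, once `ctxMap`
on a single sort is identified with the component of `α`; `exists_natTrans` does the rest. -/
instance : (schRestrict D κ C).Full where
  map_surjective {F G} α := by
    have := F.property
    have := G.property
    obtain ⟨η, hη⟩ := exists_natTrans (T := Sch κ D) (F := F.obj) (G := G.obj) (α := α.app)
      fun f => by
        obtain ⟨X, Y, f⟩ := f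
        have e := ctxMap_single (T := Sch κ D) (F := F.obj) (G := G.obj) α.app X
        rw [opHom_sch]
        exact (congrArg (fun b => b ≫ G.obj.map ((schGeneric D κ).map f)) e).trans
          (α.naturality f).symm
    refine ⟨ObjectProperty.homMk η, ?_⟩
    ext X
    exact hη X

variable {C} {D κ} [KappaCoherentCategory κ C] (F : D ⥤ C)

/-- The comparison of the functor on `Syn(Sch(D))` given by `F` with `F`. -/
noncomputable def synFunctorFst (X : D) :
    (schModel κ F).synFunctor.obj (ctxObj (Sch κ D) [X]) ⟶ F.obj X :=
  (schModel κ F).synArrow (ctxObj (Sch κ D) [X]) ≫ (prod.fst : F.obj X ⨯ ⊤_ C ⟶ F.obj X)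

instance isIso_synFunctorFst (X : D) : IsIso (synFunctorFst (κ := κ) F X) := by
  -- The formula ⊤ is interpreted as the largest subobject, so its inclusion in the product is
  -- invertible.
  have : IsIso ((schModel κ F).synArrow (ctxObj (Sch κ D) [X])) :=
    (Subobject.isIso_arrow_iff_eq_top _).2 rfl
  exact IsIso.comp_isIso' this (isIso_prod_fst_terminal (F.obj X))

theorem interpSubst_single (M : Struct (schSignature D) C) {Γ : List D} {X : D}
    (t : Term (schSignature D) Γ X) : M.interpSubst (single t) ≫
      (prod.fst : M.obj X ⨯ ⊤_ C ⟶ M.obj X) = M.interpTerm t :=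
  prod.lift_fst _ _

theorem synFunctorFst_naturality {X Y : D} (f : X ⟶ Y) :
    (schModel κ F).synFunctor.map ((schGeneric D κ).map f) ≫ synFunctorFst F Y =
      synFunctorFst F X ≫ F.map f := by
  have h : (schModel κ F).synFunctor.map ((schGeneric D κ).map f) ≫
      (schModel κ F).synArrow (ctxObj (Sch κ D) [Y]) =
        (schModel κ F).synArrow (ctxObj (Sch κ D) [X]) ≫
          (schStruct F).interpSubst (single (schApp f (schVar X))) :=
    (schModel κ F).synFunctor_map_ofSubst (X := ctxObj (Sch κ D) [X])
      (Y := ctxObj (Sch κ D) [Y]) (hσ := .top_intro _)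
  have e : (schStruct F).interpTerm (schApp f (schVar X)) =
      (prod.fst : F.obj X ⨯ ⊤_ C ⟶ F.obj X) ≫ F.map f := by
    rw [interpTerm_schApp, schUnary_schStruct]
    rfl
  have h' := congrArg (· ≫ (prod.fst : F.obj Y ⨯ ⊤_ C ⟶ F.obj Y)) h
  refine (Category.assoc _ _ _).symm.trans (h'.trans ((Category.assoc _ _ _).trans ?_))
  refine Eq.trans ?_ (Category.assoc _ _ _).symm
  exact congrArg ((schModel κ F).synArrow (ctxObj (Sch κ D) [X]) ≫ ·)
    ((interpSubst_single (schStruct F) _).trans e)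

instance : (schRestrict D κ C).EssSurj where
  mem_essImage F := ⟨⟨(schModel κ F).synFunctor, inferInstance⟩,
    ⟨NatIso.ofComponents (fun X => @asIso C _ _ _ _ (isIso_synFunctorFst (κ := κ) F X))
      fun f => synFunctorFst_naturality F f⟩⟩

end

end KappaCoherent

/-! ### The theorem -/

theorem mainTheorem1 {D : Type u} [SmallCategory D] (κ : Cardinal.{u}) (hκ : κ.IsRegular) :
    (∃ _ : HasFiniteLimits (KappaCoherent.Syn (KappaCoherent.Sch κ D)),
      KappaCoherent.KappaCoherentCategory κ (KappaCoherent.Syn (KappaCoherent.Sch κ D))) ∧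
    ∀ (C : Type u₁) [Category.{v₁} C] [HasFiniteLimits C]
      [KappaCoherent.KappaCoherentCategory κ C],
      Nonempty ((D ⥤ C) ≌ KappaCoherent.Coh κ (KappaCoherent.Syn (KappaCoherent.Sch κ D)) C) ∧
      ∃ e : (D ⥤ C) ≌ KappaCoherent.Model (KappaCoherent.Sch κ D) C,
        Function.Bijective e.functor.obj ∧
        ∀ F : D ⥤ C, (e.functor.obj F).str = KappaCoherent.schStruct F := by
  refine ⟨⟨inferInstance, inferInstance⟩, fun C _ _ _ => ⟨?_, ?_⟩⟩
  · have : (KappaCoherent.schRestrict D κ C).IsEquivalence := { }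
    exact ⟨(KappaCoherent.schRestrict D κ C).asEquivalence.symm⟩
  · exact ⟨(KappaCoherent.schModelFunctor D C κ).asEquivalence,
      KappaCoherent.schModelFunctor_obj_bijective κ, fun F => rfl⟩
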